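/- Setting. Fix $0<\rho_1<\rho_2$ and $\theta_1,\theta_2\in\mathbb{R}$, and put $s=\rho_2+\rho_1$, $d=\rho_2-\rho_1$, $\theta=\theta_2-\theta_1$, $L=\pi/(sd)$, $\langle x\rangle=(1+x^2)^{1/2}$, $\langle f,g\rangle=\int_{\mathbb{R}}f^*g\,dx$. Let $$N(x)=2\rho_1\rho_2\cos\theta-(\rho_1^2+\rho_2^2)\cosh(2sx)+s^2\sinh(2\rho_1x)\sinh(2\rho_2x)$$ (which never vanishes), $$a^{(0)}(x)=\frac{\rho_1\rho_2}{N(x)}\Big(s^2\sinh(2\rho_1x)\sinh(2\rho_2x)+\rho_1^2e^{-i\theta}+\rho_2^2e^{i\theta}-2\rho_1\rho_2\cosh(2sx)\Big),$$ $$a^{(1)}(x)=\frac{i}{N(x)}\Big((\rho_1^2-\rho_2^2)\rho_1\cosh(2\rho_2x)\sinh(2\rho_1x)+(\rho_2^2-\rho_1^2)\rho_2\cosh(2\rho_1x)\sinh(2\rho_2x)\Big),$$ and $a(x,\lambda)=(\lambda^2+a^{(1)}(x)\lambda+a^{(0)}(x))e^{-2i\lambda x}$ for $\lambda\in\mathbb{C}$.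 (These are the time-zero modes of the even, time-periodic two-soliton potential with discrete data $\lambda_k=i\rho_k$, $g^{(k)}=e^{i\theta_k}$.) The dispersive modes are, for $\lambda\ge0$, $$\Psi_{\rm d}^{\rm (e)}(x,\lambda)=\frac{a(x,\lambda)+a(x,-\lambda)}{\sqrt{2\pi(\lambda^2+\rho_1^2)(\lambda^2+\rho_2^2)}},\qquad \Psi_{\rm d}^{\rm (o)}(x,\lambda)=\frac{a(x,\lambda)-a(x,-\lambda)}{\sqrt{2\pi(\lambda^2+\rho_1^2)(\lambda^2+\rho_2^2)}},$$ and the bound states are $$\Psi_{\rm b}^{\rm (e)}(x)=\frac{1}{\sqrt{4s}}\Big[\frac{2e^{i\theta_1}}{\rho_1-\rho_2}a(x,-i\rho_1)+\frac{2e^{i\theta_2}}{\rho_2-\rho_1}a(x,-i\rho_2)\Big],$$ $$\Psi_{\rm b}^{\rm (o)}(x)=\frac{1}{\sqrt{4s}}\Big[\sqrt{\tfrac{\rho_2}{\rho_1}}\,\frac{2e^{i\theta_1}}{\rho_1-\rho_2}a(x,-i\rho_1)+\sqrt{\tfrac{\rho_1}{\rho_2}}\,\frac{2e^{i\theta_2}}{\rho_2-\rho_1}a(x,-i\rho_2)\Big].$$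 Fix $\beta>0$ with $e^{2i\beta L}=e^{2i\rho_1^2L}$. The operator $\mathcal{B}$ on $L^2(\mathbb{R})$, its evolution group and the projections onto the even and odd continuous subspaces are $$\mathcal{B}f=\sum_{p\in\{{\rm e,o}\}}\Big(-2\beta\langle\Psi_{\rm b}^{(p)},f\rangle\Psi_{\rm b}^{(p)}+\int_0^\infty2\lambda^2\langle\Psi_{\rm d}^{(p)}(\cdot,\lambda),f\rangle\Psi_{\rm d}^{(p)}(\cdot,\lambda)\,d\lambda\Big),$$ $$e^{-it\mathcal{B}}f=\sum_{p\in\{{\rm e,o}\}}\Big(e^{2i\beta t}\langle\Psi_{\rm b}^{(p)},f\rangle\Psi_{\rm b}^{(p)}+\int_0^\infty e^{-2i\lambda^2t}\langle\Psi_{\rm d}^{(p)}(\cdot,\lambda),f\rangle\Psi_{\rm d}^{(p)}(\cdot,\lambda)\,d\lambda\Big),$$ $$\mathcal{P}_{\rm c}^{(p)}f=\int_0^\infty\langle\Psi_{\rm d}^{(p)}(\cdot,\lambda),f\rangle\Psi_{\rm d}^{(p)}(\cdot,\lambda)\,d\lambda ,$$ where $\langle\Psi_{\rm d}^{(p)}(\cdot,\lambda),f\rangle$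 is the $L^2(0,\infty)$-limit of $\int_{-R}^R$ and $\int_0^\infty\cdots d\lambda$ the $L^2(\mathbb{R})$-limit of $\int_0^R$ as $R\to\infty$, and $f$ is in the domain of $\mathcal{B}$ when the functions $\lambda^2\langle\Psi_{\rm d}^{(p)}(\cdot,\lambda),f\rangle$ are in $L^2(0,\infty)$ and these limits exist. Proposition. Fix $\sigma>7/2$ and $\mu_{\min}>0$. There are constants $M^{\rm (e)},M^{\rm (o)}>0$, depending only on $\mu_{\min}$ (and on the fixed data $\rho_1,\rho_2,\theta_1,\theta_2,\beta,\sigma$), such that for all real $\mu$ with $|\mu|\ge\mu_{\min}$, all $t=\kappa r$ with $\kappa=\pm1$ and $r\ge0$, and all $f\in L^2(\mathbb{R})$ with $\langle\cdot\rangle^{\sigma}f\in L^2(\mathbb{R})$, the following holds for $p={\rm e}$ and $p={\rm o}$. For every $\delta>0$ the function $u_\delta=(\mathcal{B}-2\mu-2i\kappa\delta)^{-1}e^{-it\mathcal{B}}\mathcal{P}_{\rm c}^{(p)}f$ is well defined (as the unique solution $u_\delta$ in the domain of $\mathcal{B}$ of $(\mathcal{B}-2\mu-2i\kappa\delta)u_\delta=e^{-it\mathcal{B}}\mathcal{P}_{\rm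 c}^{(p)}f$) and has a continuous representative; as $\delta\downarrow0$ these representatives converge at every point to a function $v=\lim_{\delta\downarrow0}u_\delta$, and $\|\langle\cdot\rangle^{-\sigma}(u_\delta-v)\|_2\to0$; and $$\|\langle\cdot\rangle^{-\sigma}v\|_2\le M^{\rm (e)}\langle r\rangle^{-1/2}\|\langle\cdot\rangle^{\sigma}f\|_2\ \text{ if } p={\rm e},\qquad \|\langle\cdot\rangle^{-\sigma}v\|_2\le M^{\rm (o)}\langle r\rangle^{-3/2}\|\langle\cdot\rangle^{\sigma}f\|_2\ \text{ if } p={\rm o}.$$ -/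

import Mathlib

open Filter Topology MeasureTheory

noncomputable section

namespace TwoSoliton

/-- The weight `⟨x⟩ = (1 + x²)^{1/2}`. -/
def weight (x : ℝ) : ℝ := Real.sqrt (1 + x ^ 2)

/-- The parameters of an even time-periodic two-soliton potential: discrete data `λₖ = i ρₖ`,
`gₖ = exp (i θₖ)` for `k = 1, 2`, and a positive Floquet exponent `β` of the bound states
(a choice of branch of the logarithm of the Floquet multiplier over the period
`L = π / ((ρ₂ + ρ₁) (ρ₂ - ρ₁))`). -/
structure Data where
  ρ₁ : ℝ
  ρ₂ : ℝ
  θ₁ : ℝ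
  θ₂ : ℝ
  β : ℝ
  ρ₁_pos : 0 < ρ₁
  ρ₁_lt_ρ₂ : ρ₁ < ρ₂
  β_pos : 0 < β
  floquet :
    Complex.exp (2 * Complex.I * β * (Real.pi / ((ρ₂ + ρ₁) * (ρ₂ - ρ₁)) : ℝ)) =
      Complex.exp (2 * Complex.I * ρ₁ ^ 2 * (Real.pi / ((ρ₂ + ρ₁) * (ρ₂ - ρ₁)) : ℝ))

/-- The two symmetry classes of modes. -/
inductive Parity where
  | even
  | odd

namespace Data

variable (D : Data)

/-- The common (nonvanishing) denominator of the coefficients of `a(x,0,λ)`. -/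
def denom (x : ℝ) : ℝ :=
  2 * D.ρ₁ * D.ρ₂ * Real.cos (D.θ₂ - D.θ₁)
    - (D.ρ₁ ^ 2 + D.ρ₂ ^ 2) * Real.cosh (2 * (D.ρ₁ + D.ρ₂) * x)
    + (D.ρ₁ + D.ρ₂) ^ 2 * (Real.sinh (2 * D.ρ₁ * x) * Real.sinh (2 * D.ρ₂ * x))

/-- The coefficient `a⁽⁰⁾(x,0)`. -/
def a0 (x : ℝ) : ℂ :=
  D.ρ₁ * D.ρ₂ *
    (((D.ρ₁ + D.ρ₂) ^ 2 * (Real.sinh (2 * D.ρ₁ * x) * Real.sinh (2 * D.ρ₂ * x)) : ℝ)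
      + D.ρ₁ ^ 2 * Complex.exp (-(Complex.I * (D.θ₂ - D.θ₁)))
      + D.ρ₂ ^ 2 * Complex.exp (Complex.I * (D.θ₂ - D.θ₁))
      - (2 * D.ρ₁ * D.ρ₂ * Real.cosh (2 * (D.ρ₁ + D.ρ₂) * x) : ℝ)) / D.denom x

/-- The coefficient `a⁽¹⁾(x,0)`. -/
def a1 (x : ℝ) : ℂ :=
  Complex.I *
    (((D.ρ₁ ^ 2 - D.ρ₂ ^ 2) * D.ρ₁ * (Real.cosh (2 * D.ρ₂ * x) * Real.sinh (2 * D.ρ₁ * x))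
      + (D.ρ₂ ^ 2 - D.ρ₁ ^ 2) * D.ρ₂ *
          (Real.cosh (2 * D.ρ₁ * x) * Real.sinh (2 * D.ρ₂ * x)) : ℝ)) / D.denom x

/-- The mode function `a(x,0,λ) = (λ² + a⁽¹⁾ λ + a⁽⁰⁾) exp (-2 i λ x)`, for complex `λ`. -/
def a (x : ℝ) (l : ℂ) : ℂ :=
  (l ^ 2 + D.a1 x * l + D.a0 x) * Complex.exp (-(2 * Complex.I * l * x))

/-- The normalized even and odd bound states at `t = 0`. -/
def boundMode : Parity → ℝ → ℂ
  | .even, x =>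
      1 / (Real.sqrt (4 * (D.ρ₁ + D.ρ₂)) : ℂ) *
        (2 / (D.ρ₁ - D.ρ₂) * Complex.exp (Complex.I * D.θ₁) * D.a x (-(Complex.I * D.ρ₁))
          + 2 / (D.ρ₂ - D.ρ₁) * Complex.exp (Complex.I * D.θ₂) * D.a x (-(Complex.I * D.ρ₂)))
  | .odd, x =>
      1 / (Real.sqrt (4 * (D.ρ₁ + D.ρ₂)) : ℂ) *
        ((Real.sqrt (D.ρ₂ / D.ρ₁) : ℂ) * (2 / (D.ρ₁ - D.ρ₂)) *
            Complex.exp (Complex.I * D.θ₁) * D.a x (-(Complex.I * D.ρ₁))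
          + (Real.sqrt (D.ρ₁ / D.ρ₂) : ℂ) * (2 / (D.ρ₂ - D.ρ₁)) *
            Complex.exp (Complex.I * D.θ₂) * D.a x (-(Complex.I * D.ρ₂)))

/-- The even and odd dispersive (continuum) modes `Ψ_d(x,0,λ)`, used for `λ ≥ 0`. -/
def contMode : Parity → ℝ → ℝ → ℂ
  | .even, x, l =>
      (D.a x l + D.a x (-l)) /
        (Real.sqrt (2 * Real.pi * (l ^ 2 + D.ρ₁ ^ 2) * (l ^ 2 + D.ρ₂ ^ 2)) : ℂ)
  | .odd, x, l =>
      (D.a x l - D.a x (-l)) /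
        (Real.sqrt (2 * Real.pi * (l ^ 2 + D.ρ₁ ^ 2) * (l ^ 2 + D.ρ₂ ^ 2)) : ℂ)

/-- The inner product `⟨Ψ_b, f⟩` (conjugate linear in the first slot). -/
def boundCoeff (p : Parity) (f : ℝ → ℂ) : ℂ :=
  ∫ x, starRingEnd ℂ (D.boundMode p x) * f x

/-- `A(λ) = ⟨Ψ_d(·,0,λ), f⟩` for `f ∈ L²(ℝ)`; as usual for generalized eigenfunctions, the
inner product is the limit in `L²(0,∞)` of the integrals over `[-R,R]`. -/
def IsModeCoeff (p : Parity) (f A : ℝ → ℂ) : Prop :=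
  MemLp f 2 volume ∧ MemLp A 2 (volume.restrict (Set.Ioi 0)) ∧
    Tendsto (fun R : ℝ =>
        eLpNorm (fun l => (∫ x in (-R)..R, starRingEnd ℂ (D.contMode p x l) * f x) - A l) 2
          (volume.restrict (Set.Ioi 0)))
      atTop (𝓝 0)

/-- `g = ∫₀^∞ A(λ) Ψ_d(·,0,λ) dλ` for `A ∈ L²(0,∞)`; the integral is the limit in `L²(ℝ)` of
the integrals over `[0,R]`. -/
def IsModeSum (p : Parity) (A g : ℝ → ℂ) : Prop :=
  MemLp A 2 (volume.restrict (Set.Ioi 0)) ∧ MemLp g 2 volume ∧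
    Tendsto (fun R : ℝ =>
        eLpNorm (fun x => (∫ l in (0 : ℝ)..R, A l * D.contMode p x l) - g x) 2 volume)
      atTop (𝓝 0)

/-- `g = ∫₀^∞ m(λ) ⟨Ψ_d(·,0,λ), f⟩ Ψ_d(·,0,λ) dλ`, with `f` in the natural domain. -/
def IsContPart (p : Parity) (m f g : ℝ → ℂ) : Prop :=
  ∃ A : ℝ → ℂ, D.IsModeCoeff p f A ∧ D.IsModeSum p (fun l => m l * A l) g

/-- `g = P_c f`, the projection onto the even (odd) continuous spectral subspace. -/
def IsContProj (p : Parity) (f g : ℝ → ℂ) : Prop := D.IsContPart p (fun _ => 1) f g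

/-- The operator acting as multiplication by `mb` on both bound states and by `m(λ)` on both
dispersive modes of parameter `λ`, as the graph `f ↦ g`. -/
def IsDiagonal (mb : ℂ) (m : ℝ → ℂ) (f g : ℝ → ℂ) : Prop :=
  ∃ ge go : ℝ → ℂ, D.IsContPart .even m f ge ∧ D.IsContPart .odd m f go ∧
    g =ᵐ[volume] fun x =>
      mb * D.boundCoeff .even f * D.boundMode .even x
        + mb * D.boundCoeff .odd f * D.boundMode .odd x + ge x + go x

/-- The graph of the Floquet Hamiltonian: `g = B f`, with `f` in the domain of `B`. -/
def IsB (f g : ℝ → ℂ) : Prop :=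
  D.IsDiagonal (-2 * D.β) (fun l => 2 * (l : ℂ) ^ 2) f g

/-- `g = exp (-i t B) f`. -/
def IsEvolution (t : ℝ) (f g : ℝ → ℂ) : Prop :=
  D.IsDiagonal (Complex.exp (2 * Complex.I * D.β * t))
    (fun l => Complex.exp (-(2 * Complex.I * (l : ℂ) ^ 2 * t))) f g

/-- `(B - z) u = h`, with `u` in the domain of `B`. -/
def SolvesResolvent (z : ℂ) (h u : ℝ → ℂ) : Prop :=
  ∃ w : ℝ → ℂ, D.IsB u w ∧ (fun x => w x - z * u x) =ᵐ[volume] h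

/-- `u = (B - z)⁻¹ h`: `u` is the unique (up to null sets) solution of `(B - z) u = h`. -/
def IsResolvent (z : ℂ) (h u : ℝ → ℂ) : Prop :=
  D.SolvesResolvent z h u ∧ ∀ u' : ℝ → ℂ, D.SolvesResolvent z h u' → u' =ᵐ[volume] u

end Data

/-- The decay exponent: `1/2` in the even case, `3/2` in the odd case. -/
def rate : Parity → ℝ
  | .even => 1 / 2
  | .odd => 3 / 2

end TwoSoliton

end

/-! ### The denominator of the modes and the factorization identity -/

noncomputable section

namespace TwoSoliton

namespace Data

variable (D : Data)

/-! Write N for the denominator and θ = θ₂ - θ₁. Then a⁽¹⁾ = -iN'/(2N) and a⁽⁰⁾ = (ρ₁² + ρ₂²)/2 -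
N''/(8N) + ic/N with a real constant c, so a(x,λ) = P e^{-2iλx} for the operator P = -∂²/4 +
(i/2)a⁽¹⁾∂ + a⁽⁰⁾ (`darboux`). The formal adjoint satisfies P* a(·,λ) = (λ² + ρ₁²)(λ² + ρ₂²)
e^{-2iλx} (`adjoint_a`, resting on `modeNum_identity`): P is a double Darboux transformation. Hence
the dispersive modes inherit their orthogonality from Plancherel, and the bound states, built from
the exponentially decaying a(·,-iρₖ), are orthogonal to all of them because P* annihilates them.
These relations (`exists_synthesis_analysis`) suffice; completeness of the modes is never needed.
They turn multipliers in λ into operators on the continuous subspaces and make the resolvent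
equation uniquely solvable off the real axis (`solvesResolvent_unique`).

The solution u_δ therefore has an explicit integral kernel, the integral over real λ of (2λ² - 2μ -
2iκδ)⁻¹ e^{-2iλ²κr} against a(x,λ) conj(a(y,λ) ± a(y,-λ)) / (2π(λ² + ρ₁²)(λ² + ρ₂²)). By partial
fractions the mode product over the symbol is e^{2iλ(y-x)} times 1 plus a bounded combination of (ρₖ
∓ iλ)⁻¹, and dividing by ρₖ ∓ iλ averages the Fourier transform against an exponential
(`integral_fourier_div`). So the kernel is a "dressing" of the free kernel Φ(z) = ∫ (2λ² - 2μ -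
2iκδ)⁻¹ e^{-2iλ²κr} e^{2iλz} dλ (`resolventKernel_eq`), and growth of order 1 + z² is preserved up
to the factors 1 + x² and 1 + y².

For κ = 1 (κ = -1 is the complex conjugate) the free resolvent is an integral over future times, so
up to a constant Φ(z) = ∫₀^∞ e^{2iωs} (r+s)^{-1/2} e^{iz²/(2(r+s))} ds with ω = μ + iδ
(`freeKernel_eq_integral`). The phase e^{2iωs} oscillates because μ stays away from 0; one
integration by parts on s > 1 bounds Φ by (1+r)^{-1/2} uniformly in δ and lets δ tend to 0. In the
odd class a⁽⁰⁾ is even, so the constant Φ(0) cancels between y and -y; Φ(z) - Φ(0) has amplitude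
τ^{-1/2}(e^{iz²/(2τ)} - 1) = O(z² τ^{-3/2}), whence the faster rate (`exists_parityKernel_bound`).

The kernel is thus bounded by a constant times (1+r)^{-rate} (1+x²)(1+y²). Cauchy-Schwarz in y and
integration in x use that ⟨x⟩^{2-σ} is square integrable; dominated convergence gives the limit δ →
0, pointwise and in the weighted norm. -/

lemma ρ₂_pos : 0 < D.ρ₂ := D.ρ₁_pos.trans D.ρ₁_lt_ρ₂

/-- The `k`-th derivative of the denominator, in closed form, for even `k = 2 j`. -/
def denomEven (j : ℕ) (x : ℝ) : ℝ :=
  (if j = 0 then 2 * D.ρ₁ * D.ρ₂ * Real.cos (D.θ₂ - D.θ₁) else 0)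
    - ((D.ρ₂ - D.ρ₁) ^ 2 * (2 * (D.ρ₁ + D.ρ₂)) ^ (2 * j) * Real.cosh (2 * (D.ρ₁ + D.ρ₂) * x)
      + (D.ρ₁ + D.ρ₂) ^ 2 * (2 * (D.ρ₂ - D.ρ₁)) ^ (2 * j)
          * Real.cosh (2 * (D.ρ₂ - D.ρ₁) * x)) / 2

/-- The `k`-th derivative of the denominator, in closed form, for odd `k = 2 j + 1`. -/
def denomOdd (j : ℕ) (x : ℝ) : ℝ :=
  - ((D.ρ₂ - D.ρ₁) ^ 2 * (2 * (D.ρ₁ + D.ρ₂)) ^ (2 * j + 1) * Real.sinh (2 * (D.ρ₁ + D.ρ₂) * x)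
      + (D.ρ₁ + D.ρ₂) ^ 2 * (2 * (D.ρ₂ - D.ρ₁)) ^ (2 * j + 1)
          * Real.sinh (2 * (D.ρ₂ - D.ρ₁) * x)) / 2

/-- Product-to-sum formulas reduce the denominator to a constant and two hyperbolic cosines, so
every derivative has a closed form. -/
lemma denom_eq_denomEven (x : ℝ) : D.denom x = D.denomEven 0 x := by
  have h1 : 2 * (D.ρ₁ + D.ρ₂) * x = 2 * D.ρ₂ * x + 2 * D.ρ₁ * x := by ring
  have h2 : 2 * (D.ρ₂ - D.ρ₁) * x = 2 * D.ρ₂ * x - 2 * D.ρ₁ * x := by ring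
  simp only [denom, denomEven, h1, h2, Real.cosh_add, Real.cosh_sub, if_true]
  ring

lemma hasDerivAt_denomEven (j : ℕ) (x : ℝ) :
    HasDerivAt (D.denomEven j) (D.denomOdd j x) x := by
  have h1 : HasDerivAt (fun x => 2 * (D.ρ₁ + D.ρ₂) * x) (2 * (D.ρ₁ + D.ρ₂)) x := by
    simpa using (hasDerivAt_id x).const_mul (2 * (D.ρ₁ + D.ρ₂))
  have h2 : HasDerivAt (fun x => 2 * (D.ρ₂ - D.ρ₁) * x) (2 * (D.ρ₂ - D.ρ₁)) x := by
    simpa using (hasDerivAt_id x).const_mul (2 * (D.ρ₂ - D.ρ₁))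
  have := ((((h1.cosh).const_mul ((D.ρ₂ - D.ρ₁) ^ 2 * (2 * (D.ρ₁ + D.ρ₂)) ^ (2 * j))).add
    ((h2.cosh).const_mul ((D.ρ₁ + D.ρ₂) ^ 2 * (2 * (D.ρ₂ - D.ρ₁)) ^ (2 * j)))).div_const 2).const_sub
      (if j = 0 then 2 * D.ρ₁ * D.ρ₂ * Real.cos (D.θ₂ - D.θ₁) else 0)
  refine this.congr_deriv ?_
  simp only [denomOdd]
  ring

lemma hasDerivAt_denomOdd (j : ℕ) (x : ℝ) :
    HasDerivAt (D.denomOdd j) (D.denomEven (j + 1) x) x := by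
  have h1 : HasDerivAt (fun x => 2 * (D.ρ₁ + D.ρ₂) * x) (2 * (D.ρ₁ + D.ρ₂)) x := by
    simpa using (hasDerivAt_id x).const_mul (2 * (D.ρ₁ + D.ρ₂))
  have h2 : HasDerivAt (fun x => 2 * (D.ρ₂ - D.ρ₁) * x) (2 * (D.ρ₂ - D.ρ₁)) x := by
    simpa using (hasDerivAt_id x).const_mul (2 * (D.ρ₂ - D.ρ₁))
  have := (((h1.sinh).const_mul ((D.ρ₂ - D.ρ₁) ^ 2 * (2 * (D.ρ₁ + D.ρ₂)) ^ (2 * j + 1))).add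
    ((h2.sinh).const_mul ((D.ρ₁ + D.ρ₂) ^ 2 * (2 * (D.ρ₂ - D.ρ₁)) ^ (2 * j + 1)))).neg.div_const 2
  refine this.congr_deriv ?_
  simp only [denomEven, Nat.add_eq_zero_iff, one_ne_zero, and_false, if_false]
  ring

/-- The product of hyperbolic cosines to which the denominator is comparable. -/
def coshProd (x : ℝ) : ℝ := Real.cosh (2 * D.ρ₁ * x) * Real.cosh (2 * D.ρ₂ * x)

lemma one_le_coshProd (x : ℝ) : 1 ≤ D.coshProd x :=
  one_le_mul_of_one_le_of_one_le (Real.one_le_cosh _) (Real.one_le_cosh _)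

lemma abs_sinh_le_cosh (y : ℝ) : |Real.sinh y| ≤ Real.cosh y := by
  rw [abs_le]
  have h1 := Real.cosh_add_sinh y
  have h2 := Real.cosh_sub_sinh y
  constructor <;> nlinarith [Real.exp_pos y, Real.exp_pos (-y)]

lemma cosh_add_le (x : ℝ) : Real.cosh (2 * (D.ρ₁ + D.ρ₂) * x) ≤ 2 * D.coshProd x := by
  have h1 : 2 * (D.ρ₁ + D.ρ₂) * x = 2 * D.ρ₁ * x + 2 * D.ρ₂ * x := by ring
  rw [h1, Real.cosh_add, coshProd]
  have := abs_le.mp (abs_sinh_le_cosh (2 * D.ρ₁ * x))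
  have h := mul_le_mul (abs_sinh_le_cosh (2 * D.ρ₁ * x)) (abs_sinh_le_cosh (2 * D.ρ₂ * x))
    (abs_nonneg _) (Real.cosh_pos _).le
  rw [← abs_mul] at h
  linarith [le_abs_self (Real.sinh (2 * D.ρ₁ * x) * Real.sinh (2 * D.ρ₂ * x))]

lemma cosh_sub_le (x : ℝ) : Real.cosh (2 * (D.ρ₂ - D.ρ₁) * x) ≤ 2 * D.coshProd x := by
  have h1 : 2 * (D.ρ₂ - D.ρ₁) * x = 2 * D.ρ₂ * x - 2 * D.ρ₁ * x := by ring
  rw [h1, Real.cosh_sub, coshProd]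
  have h := mul_le_mul (abs_sinh_le_cosh (2 * D.ρ₁ * x)) (abs_sinh_le_cosh (2 * D.ρ₂ * x))
    (abs_nonneg _) (Real.cosh_pos _).le
  rw [← abs_mul] at h
  nlinarith [neg_abs_le (Real.sinh (2 * D.ρ₁ * x) * Real.sinh (2 * D.ρ₂ * x))]

/-- Replace cos θ by the larger cosh(2ρ₁x - 2ρ₂x) and expand: the coefficient of the product of
hyperbolic sines is then zero, and that of the product of cosines is -(ρ₂ - ρ₁)². Besides
nonvanishing, this gives the sharp exponential size of the denominator. -/
lemma denom_le (x : ℝ) : D.denom x ≤ - ((D.ρ₂ - D.ρ₁) ^ 2 * D.coshProd x) := by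
  have h1 : 2 * (D.ρ₁ + D.ρ₂) * x = 2 * D.ρ₁ * x + 2 * D.ρ₂ * x := by ring
  rw [denom, h1, Real.cosh_add, coshProd]
  have hp : 0 < D.ρ₁ * D.ρ₂ := mul_pos D.ρ₁_pos D.ρ₂_pos
  have hc := Real.one_le_cosh (2 * D.ρ₁ * x - 2 * D.ρ₂ * x)
  rw [Real.cosh_sub] at hc
  nlinarith [Real.cos_le_one (D.θ₂ - D.θ₁)]

lemma denom_neg (x : ℝ) : D.denom x < 0 := by
  have h := D.denom_le x
  have h1 := D.one_le_coshProd x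
  have h2 : 0 < (D.ρ₂ - D.ρ₁) ^ 2 := pow_pos (sub_pos.mpr D.ρ₁_lt_ρ₂) 2
  nlinarith

lemma denom_ne_zero (x : ℝ) : (D.denom x : ℂ) ≠ 0 := by
  exact_mod_cast (D.denom_neg x).ne

/-- `a(x,λ) = modeNum x λ * exp (-2 i λ x) / denom x`. -/
def modeNum (l : ℂ) (x : ℝ) : ℂ :=
  (l ^ 2 + (D.ρ₁ ^ 2 + D.ρ₂ ^ 2) / 2) * D.denomEven 0 x - Complex.I * l / 2 * D.denomOdd 0 x
    - D.denomEven 1 x / 8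
    + Complex.I * (D.ρ₁ * D.ρ₂ * (D.ρ₁ + D.ρ₂) * (D.ρ₂ - D.ρ₁) * Real.sin (D.θ₂ - D.θ₁))

/-- First derivative of `modeNum`. -/
def modeNum' (l : ℂ) (x : ℝ) : ℂ :=
  (l ^ 2 + (D.ρ₁ ^ 2 + D.ρ₂ ^ 2) / 2) * D.denomOdd 0 x - Complex.I * l / 2 * D.denomEven 1 x
    - D.denomOdd 1 x / 8

/-- Second derivative of `modeNum`. -/
def modeNum'' (l : ℂ) (x : ℝ) : ℂ :=
  (l ^ 2 + (D.ρ₁ ^ 2 + D.ρ₂ ^ 2) / 2) * D.denomEven 1 x - Complex.I * l / 2 * D.denomOdd 1 x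
    - D.denomEven 2 x / 8

lemma hasDerivAt_modeNum (l : ℂ) (x : ℝ) : HasDerivAt (D.modeNum l) (D.modeNum' l x) x :=
  (((((D.hasDerivAt_denomEven 0 x).ofReal_comp.const_mul _).sub
    ((D.hasDerivAt_denomOdd 0 x).ofReal_comp.const_mul _)).sub
      ((D.hasDerivAt_denomEven 1 x).ofReal_comp.div_const 8)).add_const _)

lemma hasDerivAt_modeNum' (l : ℂ) (x : ℝ) : HasDerivAt (D.modeNum' l) (D.modeNum'' l x) x :=
  ((((D.hasDerivAt_denomOdd 0 x).ofReal_comp.const_mul _).sub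
    ((D.hasDerivAt_denomEven 1 x).ofReal_comp.const_mul _)).sub
      ((D.hasDerivAt_denomOdd 1 x).ofReal_comp.div_const 8))

/-- Together with `a0_eq`, this expresses the coefficients by the denominator and its first two
derivatives, which makes the adjoint computation algebraic. In particular a⁽¹⁾ is purely imaginary.
-/
lemma a1_eq (x : ℝ) : D.a1 x = - Complex.I * D.denomOdd 0 x / (2 * D.denom x) := by
  have h1 : 2 * (D.ρ₁ + D.ρ₂) * x = 2 * D.ρ₁ * x + 2 * D.ρ₂ * x := by ring
  have h2 : 2 * (D.ρ₂ - D.ρ₁) * x = 2 * D.ρ₂ * x - 2 * D.ρ₁ * x := by ring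
  have hN := D.denom_ne_zero x
  rw [a1, denomOdd, h1, h2, Real.sinh_add, Real.sinh_sub]
  field_simp
  push_cast
  ring

lemma a0_eq (x : ℝ) : D.a0 x = (D.ρ₁ ^ 2 + D.ρ₂ ^ 2) / 2 - D.denomEven 1 x / (8 * D.denom x)
    + Complex.I * (D.ρ₁ * D.ρ₂ * (D.ρ₁ + D.ρ₂) * (D.ρ₂ - D.ρ₁) * Real.sin (D.θ₂ - D.θ₁))
      / D.denom x := by
  have hN := D.denom_ne_zero x
  have h1 : 2 * (D.ρ₁ + D.ρ₂) * x = 2 * D.ρ₁ * x + 2 * D.ρ₂ * x := by ring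
  have h2 : 2 * (D.ρ₂ - D.ρ₁) * x = 2 * D.ρ₂ * x - 2 * D.ρ₁ * x := by ring
  have e1 : Complex.exp (Complex.I * (D.θ₂ - D.θ₁)) =
      Real.cos (D.θ₂ - D.θ₁) + Real.sin (D.θ₂ - D.θ₁) * Complex.I := by
    rw [mul_comm, Complex.exp_mul_I]; push_cast; rfl
  have e2 : Complex.exp (-(Complex.I * (D.θ₂ - D.θ₁))) =
      Real.cos (D.θ₂ - D.θ₁) - Real.sin (D.θ₂ - D.θ₁) * Complex.I := by
    rw [mul_comm, ← neg_mul, Complex.exp_mul_I, Complex.cos_neg, Complex.sin_neg]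
    push_cast; ring
  rw [a0, e1, e2, h1, Real.cosh_add]
  field_simp
  rw [denomEven, denom, h1, h2, Real.cosh_add, Real.cosh_sub]
  push_cast
  ring_nf

lemma a_eq (x : ℝ) (l : ℂ) :
    D.a x l = D.modeNum l x * Complex.exp (-(2 * Complex.I * l * x)) / D.denom x := by
  have hN := D.denom_ne_zero x
  have hN' := hN
  rw [denom_eq_denomEven] at hN'
  rw [a, a0_eq, a1_eq, modeNum, denom_eq_denomEven]
  field_simp
  ring

/-- The algebraic identity behind `P^* P = (Λ² + ρ₁²) (Λ² + ρ₂²)`, where `a(x,λ) = P e^{-2iλx}`. -/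
lemma modeNum_identity (l : ℂ) (x : ℝ) :
    -(D.denom x : ℂ) * (D.modeNum'' l x - 4 * Complex.I * l * D.modeNum' l x
        - 4 * l ^ 2 * D.modeNum l x) / 4
      + D.denomOdd 0 x * (D.modeNum' l x - 2 * Complex.I * l * D.modeNum l x) / 4
      + ((D.ρ₁ ^ 2 + D.ρ₂ ^ 2) / 2 * D.denom x - D.denomEven 1 x / 8
        - Complex.I * (D.ρ₁ * D.ρ₂ * (D.ρ₁ + D.ρ₂) * (D.ρ₂ - D.ρ₁) * Real.sin (D.θ₂ - D.θ₁)))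
        * D.modeNum l x
      = (l ^ 2 + D.ρ₁ ^ 2) * (l ^ 2 + D.ρ₂ ^ 2) * (D.denom x : ℂ) ^ 2 := by
  rw [denom_eq_denomEven, modeNum, modeNum', modeNum'']
  simp only [denomEven, denomOdd, if_true, one_ne_zero, if_false, OfNat.ofNat_ne_zero]
  have h1 := Real.sinh_sq (2 * (D.ρ₁ + D.ρ₂) * x)
  have h2 := Real.sinh_sq (2 * (D.ρ₂ - D.ρ₁) * x)
  have h3 := Real.sin_sq_add_cos_sq (D.θ₂ - D.θ₁)
  generalize Real.sinh (2 * (D.ρ₁ + D.ρ₂) * x) = S at *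
  generalize Real.cosh (2 * (D.ρ₁ + D.ρ₂) * x) = C at *
  generalize Real.sinh (2 * (D.ρ₂ - D.ρ₁) * x) = h at *
  generalize Real.cosh (2 * (D.ρ₂ - D.ρ₁) * x) = c at *
  generalize Real.sin (D.θ₂ - D.θ₁) = st at *
  generalize Real.cos (D.θ₂ - D.θ₁) = ct at *
  replace h1 : (S : ℂ) ^ 2 = C ^ 2 - 1 := by exact_mod_cast h1
  replace h2 : (h : ℂ) ^ 2 = c ^ 2 - 1 := by exact_mod_cast h2
  replace h3 : (st : ℂ) ^ 2 + ct ^ 2 = 1 := by exact_mod_cast h3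
  push_cast
  generalize (D.ρ₁ : ℂ) = r1
  generalize (D.ρ₂ : ℂ) = r2
  have hI : Complex.I ^ 2 = -1 := Complex.I_sq
  generalize Complex.I = i at *
  -- With all functions replaced by indeterminates, the identity follows from the two hyperbolic
  -- Pythagorean relations, the trigonometric one and i² = -1.
  linear_combination ((r1 + r2) ^ 2 * (r2 - r1) ^ 4 * ((r2 - r1) ^ 2 - (r1 + r2) ^ 2) / 16) * h1
    + ((r1 + r2) ^ 4 * (r2 - r1) ^ 2 * ((r1 + r2) ^ 2 - (r2 - r1) ^ 2) / 16) * h2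
    + (r1 * r2 * (r1 + r2) * (r2 - r1)) ^ 2 * h3
    + ((2 * r1 * r2 * ct - ((r2 - r1) ^ 2 * C + (r1 + r2) ^ 2 * c) / 2) * l *
          (l * (r1 + r2) ^ 2 * (r2 - r1) ^ 2 * (C + c))
        + ((r1 + r2) * (r2 - r1) * ((r2 - r1) * S + (r1 + r2) * h) * l / 2
            - r1 * r2 * (r1 + r2) * (r2 - r1) * st) *
          (l * ((r1 + r2) * (r2 - r1) * ((r2 - r1) * S + (r1 + r2) * h)) / 2
            + r1 * r2 * (r1 + r2) * (r2 - r1) * st)) * hI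

end Data
end TwoSoliton

/-! ### Derivatives of the modes in x and integration by parts against P -/

namespace TwoSoliton

namespace Data

variable (D : Data)

/-- The symbol `(λ² + ρ₁²) (λ² + ρ₂²)`. -/
def symbol (l : ℂ) : ℂ := (l ^ 2 + D.ρ₁ ^ 2) * (l ^ 2 + D.ρ₂ ^ 2)

/-- The derivative of `a(x,λ)` in `x`. -/
def aDeriv (l : ℂ) (x : ℝ) : ℂ :=
  (D.modeNum' l x - 2 * Complex.I * l * D.modeNum l x) * Complex.exp (-(2 * Complex.I * l * x))
      / D.denom x
    - D.modeNum l x * Complex.exp (-(2 * Complex.I * l * x)) * D.denomOdd 0 x / D.denom x ^ 2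

/-- The second derivative of `a(x,λ)` in `x`. -/
def aDeriv2 (l : ℂ) (x : ℝ) : ℂ :=
  (D.modeNum'' l x - 4 * Complex.I * l * D.modeNum' l x - 4 * l ^ 2 * D.modeNum l x)
      * Complex.exp (-(2 * Complex.I * l * x)) / D.denom x
    - 2 * (D.modeNum' l x - 2 * Complex.I * l * D.modeNum l x)
      * Complex.exp (-(2 * Complex.I * l * x)) * D.denomOdd 0 x / D.denom x ^ 2
    - D.modeNum l x * Complex.exp (-(2 * Complex.I * l * x)) * D.denomEven 1 x / D.denom x ^ 2
    + 2 * D.modeNum l x * Complex.exp (-(2 * Complex.I * l * x)) * D.denomOdd 0 x ^ 2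
      / D.denom x ^ 3

lemma hasDerivAt_denom (x : ℝ) :
    HasDerivAt (fun x => (D.denom x : ℂ)) (D.denomOdd 0 x) x := by
  have h : D.denom = D.denomEven 0 := funext D.denom_eq_denomEven
  rw [h]
  exact (D.hasDerivAt_denomEven 0 x).ofReal_comp

lemma hasDerivAt_cexp (l : ℂ) (x : ℝ) :
    HasDerivAt (fun x : ℝ => Complex.exp (-(2 * Complex.I * l * x)))
      (-(2 * Complex.I * l) * Complex.exp (-(2 * Complex.I * l * x))) x := by
  have h : HasDerivAt (fun x : ℝ => -(2 * Complex.I * l * x)) (-(2 * Complex.I * l)) x := by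
    simpa using ((hasDerivAt_id x).ofReal_comp.const_mul (2 * Complex.I * l)).fun_neg
  exact h.cexp.congr_deriv (by ring)

lemma hasDerivAt_a (l : ℂ) (x : ℝ) : HasDerivAt (fun x => D.a x l) (D.aDeriv l x) x := by
  have hN := D.denom_ne_zero x
  have h : (fun x => D.a x l) = fun x =>
      D.modeNum l x * Complex.exp (-(2 * Complex.I * l * x)) / D.denom x := by
    funext y; exact D.a_eq y l
  rw [h]
  refine (((D.hasDerivAt_modeNum l x).mul (hasDerivAt_cexp l x)).div
    (D.hasDerivAt_denom x) hN).congr_deriv ?_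
  rw [aDeriv, Pi.mul_apply]
  field_simp
  ring

lemma hasDerivAt_aDeriv (l : ℂ) (x : ℝ) : HasDerivAt (D.aDeriv l) (D.aDeriv2 l x) x := by
  have hN := D.denom_ne_zero x
  have h1 := (((D.hasDerivAt_modeNum' l x).sub
    ((D.hasDerivAt_modeNum l x).const_mul (2 * Complex.I * l))).mul (hasDerivAt_cexp l x)).div
    (D.hasDerivAt_denom x) hN
  have h2 := ((((D.hasDerivAt_modeNum l x).mul (hasDerivAt_cexp l x)).mul
    (D.hasDerivAt_denomOdd 0 x).ofReal_comp)).div ((D.hasDerivAt_denom x).pow 2) (pow_ne_zero 2 hN)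
  refine (h1.sub h2).congr_deriv ?_
  simp only [aDeriv2, Pi.mul_apply, Pi.sub_apply, Pi.pow_apply, zero_add, Nat.cast_ofNat]
  generalize Complex.exp (-(2 * Complex.I * l * x)) = e
  have hI := Complex.I_sq
  generalize Complex.I = i at *
  field_simp
  linear_combination (4 * D.modeNum l x * D.denom x ^ 3 * l ^ 2 * e) * hI

lemma continuous_a (l : ℂ) : Continuous fun x => D.a x l :=
  continuous_iff_continuousAt.mpr fun x => (D.hasDerivAt_a l x).continuousAt

/-- `P^* a(·,λ) = (λ² + ρ₁²) (λ² + ρ₂²) e^{-2iλx}`. -/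
lemma adjoint_a (l : ℂ) (x : ℝ) :
    -(D.aDeriv2 l x) / 4
      + ((-(D.denomEven 1 x) / (2 * D.denom x) + D.denomOdd 0 x ^ 2 / (2 * D.denom x ^ 2)) * D.a x l
        - D.denomOdd 0 x / (2 * D.denom x) * D.aDeriv l x) / 2
      + starRingEnd ℂ (D.a0 x) * D.a x l
      = D.symbol l * Complex.exp (-(2 * Complex.I * l * x)) := by
  have hN := D.denom_ne_zero x
  have h0 : starRingEnd ℂ (D.a0 x) = (D.ρ₁ ^ 2 + D.ρ₂ ^ 2) / 2
      - D.denomEven 1 x / (8 * D.denom x)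
      - Complex.I * (D.ρ₁ * D.ρ₂ * (D.ρ₁ + D.ρ₂) * (D.ρ₂ - D.ρ₁) * Real.sin (D.θ₂ - D.θ₁))
      / D.denom x := by
    rw [a0_eq]
    simp only [map_add, map_sub, map_div₀, map_mul, map_pow, Complex.conj_ofReal, Complex.conj_I,
      map_ofNat]
    ring
  have key := D.modeNum_identity l x
  rw [h0, aDeriv2, aDeriv, a_eq, symbol]
  generalize Complex.exp (-(2 * Complex.I * l * x)) = e
  field_simp
  linear_combination 128 * e * D.denom x * key

/-- Two integrations by parts move P onto the mode, where `adjoint_a` applies. Only boundedness is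
assumed, so that both real λ and the points -iρₖ are covered; for the latter the symbol vanishes and
the third bound is harmless. -/
lemma integral_conj_a_mul (l : ℂ) (φ : SchwartzMap ℝ ℂ) {c : ℝ} (h0 : ∀ x, ‖D.a x l‖ ≤ c)
    (h1 : ∀ x, ‖D.aDeriv l x‖ ≤ c)
    (h2 : ∀ x : ℝ, ‖D.symbol l * Complex.exp (-(2 * Complex.I * l * x))‖ ≤ c)
    (hb : ∀ x, ‖D.a1 x‖ ≤ c) (ha : ∀ x, ‖D.a0 x‖ ≤ c) :
    ∫ x, starRingEnd ℂ (D.a x l) * (-(deriv (deriv φ) x) / 4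
        + Complex.I / 2 * D.a1 x * deriv φ x + D.a0 x * φ x)
      = ∫ x : ℝ, starRingEnd ℂ (D.symbol l * Complex.exp (-(2 * Complex.I * l * x))) * φ x := by
  set ψ := SchwartzMap.derivCLM ℂ ℂ φ with hψ
  set χ := SchwartzMap.derivCLM ℂ ℂ ψ with hχ
  have e1 : deriv φ = ψ := by funext x; exact (SchwartzMap.derivCLM_apply ℂ φ x).symm
  have e2 : deriv (deriv φ) = χ := by
    rw [e1]; funext x; exact (SchwartzMap.derivCLM_apply ℂ ψ x).symm
  have d1 : ∀ x, HasDerivAt φ (ψ x) x := fun x => by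
    have := φ.differentiableAt (x := x) |>.hasDerivAt
    rwa [e1] at this
  have d2 : ∀ x, HasDerivAt ψ (χ x) x := fun x => by
    have := ψ.differentiableAt (x := x) |>.hasDerivAt
    rw [← e1, e2] at this
    rwa [← e1]
  rw [e2, e1]
  have hca1 : Continuous D.a1 := by
    have : D.a1 = fun x => - Complex.I * D.denomOdd 0 x / (2 * D.denom x) := funext D.a1_eq
    rw [this]
    refine Continuous.div ?_ ?_ ?_
    · exact continuous_const.mul (Complex.continuous_ofReal.comp
        (continuous_iff_continuousAt.mpr fun x => (D.hasDerivAt_denomOdd 0 x).continuousAt))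
    · exact continuous_const.mul (continuous_iff_continuousAt.mpr
        fun x => (D.hasDerivAt_denom x).continuousAt)
    · intro x; exact mul_ne_zero two_ne_zero (D.denom_ne_zero x)
  have hca0 : Continuous D.a0 := by
    have : D.a0 = fun x => D.a x 0 := by funext x; simp [a]
    rw [this]; exact D.continuous_a 0
  have hcg : Continuous fun x => starRingEnd ℂ (D.a x l) :=
    Complex.continuous_conj.comp (D.continuous_a l)
  have hce : Continuous fun x : ℝ =>
      starRingEnd ℂ (D.symbol l * Complex.exp (-(2 * Complex.I * l * x))) :=
    Complex.continuous_conj.comp (by fun_prop)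
  have i1 : Integrable fun x => starRingEnd ℂ (D.a x l) * (-(χ x) / 4
        + Complex.I / 2 * D.a1 x * ψ x + D.a0 x * φ x) := by
    refine Integrable.bdd_mul (c := c) ?_ hcg.aestronglyMeasurable
      (Eventually.of_forall fun x => by simpa using h0 x)
    refine ((χ.integrable.neg.div_const 4).add ?_).add ?_
    · exact ψ.integrable.bdd_mul (c := ‖Complex.I / 2‖ * c) (by fun_prop)
        (Eventually.of_forall fun x => by
          rw [norm_mul]; exact mul_le_mul_of_nonneg_left (hb x) (norm_nonneg _))
    · exact φ.integrable.bdd_mul (c := c) (by fun_prop) (Eventually.of_forall ha)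
  have i2 : Integrable fun x : ℝ =>
      starRingEnd ℂ (D.symbol l * Complex.exp (-(2 * Complex.I * l * x))) * φ x :=
    φ.integrable.bdd_mul (c := c) hce.aestronglyMeasurable
      (Eventually.of_forall fun x => by rw [RCLike.norm_conj]; exact h2 x)
  rw [← sub_eq_zero, ← integral_sub i1 i2]
  -- J collects the boundary terms; its derivative is the difference of the two integrands, and it
  -- tends to 0 at both ends because φ and φ' decay.
  set J : ℝ → ℂ := fun x => -(starRingEnd ℂ (D.a x l) * ψ x - starRingEnd ℂ (D.aDeriv l x) * φ x) / 4
    + D.denomOdd 0 x / (2 * D.denom x) * (starRingEnd ℂ (D.a x l) * φ x) / 2 with hJ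
  have hlim : Tendsto J (cocompact ℝ) (𝓝 0) := by
    have bd : ∀ (u : ℝ → ℂ) (v : SchwartzMap ℝ ℂ), (∃ c, ∀ x, ‖u x‖ ≤ c) →
        Tendsto (fun x => u x * v x) (cocompact ℝ) (𝓝 0) := by
      rintro u v ⟨k, hk⟩
      have hv := v.tendsto_cocompact
      rw [tendsto_zero_iff_norm_tendsto_zero] at hv ⊢
      refine squeeze_zero (fun x => norm_nonneg _) (fun x => ?_)
        (by simpa using hv.const_mul k)
      rw [norm_mul]; exact mul_le_mul_of_nonneg_right (hk x) (norm_nonneg _)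
    have t1 := bd (fun x => starRingEnd ℂ (D.a x l)) ψ ⟨c, fun x => by simpa using h0 x⟩
    have t2 := bd (fun x => starRingEnd ℂ (D.aDeriv l x)) φ ⟨c, fun x => by simpa using h1 x⟩
    have t3 := bd (fun x => D.denomOdd 0 x / (2 * D.denom x) * starRingEnd ℂ (D.a x l)) φ
      ⟨c * c, fun x => by
        have e : (D.denomOdd 0 x / (2 * D.denom x) : ℂ) = Complex.I * D.a1 x := by
          rw [a1_eq]; linear_combination (D.denomOdd 0 x / (2 * D.denom x) : ℂ) * Complex.I_sq
        rw [norm_mul, e, norm_mul, Complex.norm_I, one_mul, RCLike.norm_conj]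
        exact mul_le_mul (hb x) (h0 x) (norm_nonneg _) ((norm_nonneg _).trans (hb x))⟩
    have := (((t1.sub t2).neg.div_const 4).add (t3.div_const 2))
    simpa [hJ, mul_assoc] using this
  have hd : ∀ x, HasDerivAt J (starRingEnd ℂ (D.a x l) * (-(χ x) / 4
        + Complex.I / 2 * D.a1 x * ψ x + D.a0 x * φ x)
      - starRingEnd ℂ (D.symbol l * Complex.exp (-(2 * Complex.I * l * x))) * φ x) x := by
    intro x
    have hN := D.denom_ne_zero x
    have g1 : HasDerivAt (fun x => starRingEnd ℂ (D.a x l)) (starRingEnd ℂ (D.aDeriv l x)) x :=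
      (D.hasDerivAt_a l x).star
    have g2 : HasDerivAt (fun x => starRingEnd ℂ (D.aDeriv l x)) (starRingEnd ℂ (D.aDeriv2 l x)) x :=
      (D.hasDerivAt_aDeriv l x).star
    have g3 : HasDerivAt (fun x : ℝ => (D.denomOdd 0 x : ℂ) / (2 * D.denom x))
        ((D.denomEven 1 x) / (2 * D.denom x) - D.denomOdd 0 x ^ 2 / (2 * D.denom x ^ 2)) x := by
      refine ((D.hasDerivAt_denomOdd 0 x).ofReal_comp.div ((D.hasDerivAt_denom x).const_mul 2)
        (mul_ne_zero two_ne_zero hN)).congr_deriv ?_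
      field_simp
    refine (((((g1.mul (d2 x)).sub (g2.mul (d1 x))).neg).div_const 4).add
      ((g3.mul (g1.mul (d1 x))).div_const 2)).congr_deriv ?_
    rw [← D.adjoint_a l x, a1_eq]
    simp only [map_add, map_sub, map_neg, map_mul, map_div₀, map_pow, Complex.conj_ofReal,
      map_ofNat, Complex.conj_conj, Pi.mul_apply]
    field_simp
    linear_combination (4 * starRingEnd ℂ (D.a x l) * D.denomOdd 0 x * D.denom x * ψ x) * Complex.I_sq
  have := integral_of_hasDerivAt_of_tendsto hd (i1.sub i2)
    (hlim.mono_left (by rw [cocompact_eq_atBot_atTop]; exact le_sup_left))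
    (hlim.mono_left (by rw [cocompact_eq_atBot_atTop]; exact le_sup_right))
  rw [this, sub_zero]

end Data
end TwoSoliton

/-! ### Bounds uniform in x, expressed as `IsBigO` along the filter `⊤` -/

namespace TwoSoliton

namespace Data

variable (D : Data)

open Asymptotics

lemma isBigO_coshProd_denom : D.coshProd =O[⊤] fun x => (D.denom x : ℂ) := by
  have hd : 0 < (D.ρ₂ - D.ρ₁) ^ 2 := pow_pos (sub_pos.mpr D.ρ₁_lt_ρ₂) 2
  refine isBigO_top.mpr ⟨1 / (D.ρ₂ - D.ρ₁) ^ 2, fun x => ?_⟩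
  have h := D.denom_le x
  have h1 := D.one_le_coshProd x
  rw [Complex.norm_real, Real.norm_eq_abs, Real.norm_eq_abs, abs_of_nonneg (by linarith),
    abs_of_neg (D.denom_neg x), one_div, ← div_eq_inv_mul, le_div_iff₀ hd]
  linarith

lemma isBigO_one_coshProd : (fun _ : ℝ => (1 : ℂ)) =O[⊤] D.coshProd :=
  isBigO_top.mpr ⟨1, fun x => by
    have h1 := D.one_le_coshProd x
    rw [norm_one, one_mul, Real.norm_eq_abs, abs_of_nonneg (by linarith)]; exact h1⟩

lemma isBigO_of_abs_le_cosh_add {f : ℝ → ℝ}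
    (hf : ∀ x, |f x| ≤ Real.cosh (2 * (D.ρ₁ + D.ρ₂) * x)) : f =O[⊤] D.coshProd :=
  isBigO_top.mpr ⟨2, fun x => by
    have h1 := D.one_le_coshProd x
    rw [Real.norm_eq_abs, Real.norm_eq_abs, abs_of_nonneg (by linarith : 0 ≤ D.coshProd x)]
    exact (hf x).trans (D.cosh_add_le x)⟩

lemma isBigO_of_abs_le_cosh_sub {f : ℝ → ℝ}
    (hf : ∀ x, |f x| ≤ Real.cosh (2 * (D.ρ₂ - D.ρ₁) * x)) : f =O[⊤] D.coshProd :=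
  isBigO_top.mpr ⟨2, fun x => by
    have h1 := D.one_le_coshProd x
    rw [Real.norm_eq_abs, Real.norm_eq_abs, abs_of_nonneg (by linarith : 0 ≤ D.coshProd x)]
    exact (hf x).trans (D.cosh_sub_le x)⟩

lemma isBigO_denomEven (j : ℕ) :
    (fun x => (D.denomEven j x : ℂ)) =O[⊤] fun x => (D.denom x : ℂ) := by
  refine IsBigO.trans ?_ D.isBigO_coshProd_denom
  have h1 := D.isBigO_of_abs_le_cosh_add (f := fun x => Real.cosh (2 * (D.ρ₁ + D.ρ₂) * x))
    fun x => (abs_of_pos (Real.cosh_pos _)).le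
  have h2 := D.isBigO_of_abs_le_cosh_sub (f := fun x => Real.cosh (2 * (D.ρ₂ - D.ρ₁) * x))
    fun x => (abs_of_pos (Real.cosh_pos _)).le
  have h0 : (fun _ : ℝ => (1 : ℝ)) =O[⊤] D.coshProd :=
    (isBigO_norm_left (f' := fun _ : ℝ => (1 : ℝ))).mp (by
      simpa using (D.isBigO_one_coshProd).norm_left)
  refine IsBigO.of_norm_left ?_
  simp only [Complex.norm_real]
  refine IsBigO.norm_left ?_
  refine (h0.const_mul_left
    (if j = 0 then 2 * D.ρ₁ * D.ρ₂ * Real.cos (D.θ₂ - D.θ₁) else 0)).sub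
    ((((h1.const_mul_left ((D.ρ₂ - D.ρ₁) ^ 2 * (2 * (D.ρ₁ + D.ρ₂)) ^ (2 * j))).add
    (h2.const_mul_left ((D.ρ₁ + D.ρ₂) ^ 2 * (2 * (D.ρ₂ - D.ρ₁)) ^ (2 * j)))).const_mul_left
      (1 / 2))) |>.congr_left fun x => ?_
  rw [denomEven]; ring

lemma isBigO_denomOdd (j : ℕ) :
    (fun x => (D.denomOdd j x : ℂ)) =O[⊤] fun x => (D.denom x : ℂ) := by
  refine IsBigO.trans ?_ D.isBigO_coshProd_denom
  have h1 := D.isBigO_of_abs_le_cosh_add (f := fun x => Real.sinh (2 * (D.ρ₁ + D.ρ₂) * x))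
    fun x => abs_sinh_le_cosh _
  have h2 := D.isBigO_of_abs_le_cosh_sub (f := fun x => Real.sinh (2 * (D.ρ₂ - D.ρ₁) * x))
    fun x => abs_sinh_le_cosh _
  refine IsBigO.of_norm_left ?_
  simp only [Complex.norm_real]
  refine IsBigO.norm_left ?_
  refine (((h1.const_mul_left ((D.ρ₂ - D.ρ₁) ^ 2 * (2 * (D.ρ₁ + D.ρ₂)) ^ (2 * j + 1))).add
    (h2.const_mul_left ((D.ρ₁ + D.ρ₂) ^ 2 * (2 * (D.ρ₂ - D.ρ₁)) ^ (2 * j + 1)))).const_mul_left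
      (-1 / 2)) |>.congr_left fun x => ?_
  rw [denomOdd]; ring

lemma isBigO_one_denom : (fun _ : ℝ => (1 : ℂ)) =O[⊤] fun x => (D.denom x : ℂ) :=
  D.isBigO_one_coshProd.trans D.isBigO_coshProd_denom

lemma isBigO_div_denom {f : ℝ → ℂ} (hf : f =O[⊤] fun x => (D.denom x : ℂ)) :
    (fun x => f x / D.denom x) =O[⊤] fun _ : ℝ => (1 : ℂ) := by
  obtain ⟨c, hc⟩ := isBigO_top.mp hf
  refine isBigO_top.mpr ⟨c, fun x => ?_⟩
  rw [norm_div, norm_one, mul_one, div_le_iff₀ (norm_pos_iff.mpr (D.denom_ne_zero x))]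
  exact hc x

lemma isBigO_a1 : D.a1 =O[⊤] fun _ : ℝ => (1 : ℂ) :=
  ((D.isBigO_div_denom (D.isBigO_denomOdd 0)).const_mul_left (-Complex.I / 2)).congr_left fun x => by
    rw [a1_eq]
    have hN := D.denom_ne_zero x
    field_simp

lemma isBigO_modeNum (l : ℂ) : D.modeNum l =O[⊤] fun x => (D.denom x : ℂ) := by
  refine ((((D.isBigO_denomEven 0).const_mul_left (l ^ 2 + (D.ρ₁ ^ 2 + D.ρ₂ ^ 2) / 2)).sub
    ((D.isBigO_denomOdd 0).const_mul_left (Complex.I * l / 2))).sub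
    ((D.isBigO_denomEven 1).const_mul_left (1 / 8))).add (D.isBigO_one_denom.const_mul_left
    (Complex.I * (D.ρ₁ * D.ρ₂ * (D.ρ₁ + D.ρ₂) * (D.ρ₂ - D.ρ₁) * Real.sin (D.θ₂ - D.θ₁))))
    |>.congr_left fun x => ?_
  rw [modeNum]; ring

lemma isBigO_modeNum' (l : ℂ) : D.modeNum' l =O[⊤] fun x => (D.denom x : ℂ) := by
  refine ((((D.isBigO_denomOdd 0).const_mul_left (l ^ 2 + (D.ρ₁ ^ 2 + D.ρ₂ ^ 2) / 2)).sub
    ((D.isBigO_denomEven 1).const_mul_left (Complex.I * l / 2))).sub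
    ((D.isBigO_denomOdd 1).const_mul_left (1 / 8)))
    |>.congr_left fun x => ?_
  rw [modeNum']; ring

lemma norm_cexp_mode (l x : ℝ) : ‖Complex.exp (-(2 * Complex.I * l * x))‖ = 1 := by
  have : -(2 * Complex.I * l * x) = ((-(2 * l * x) : ℝ) : ℂ) * Complex.I := by push_cast; ring
  rw [this, Complex.norm_exp_ofReal_mul_I]

lemma isBigO_a0 : D.a0 =O[⊤] fun _ : ℝ => (1 : ℂ) :=
  (D.isBigO_div_denom (D.isBigO_modeNum 0)).congr_left fun x => by
    have h1 := D.a_eq x 0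
    have h2 : D.a x 0 = D.a0 x := by simp [a]
    rw [← h2, h1]; simp

lemma isBigO_cexp (l : ℝ) :
    (fun x : ℝ => Complex.exp (-(2 * Complex.I * l * x))) =O[⊤] fun _ : ℝ => (1 : ℂ) :=
  isBigO_top.mpr ⟨1, fun x => by rw [norm_cexp_mode]; simp⟩

lemma isBigO_a (l : ℝ) : (fun x => D.a x l) =O[⊤] fun _ : ℝ => (1 : ℂ) :=
  (((D.isBigO_div_denom (D.isBigO_modeNum l)).mul (isBigO_cexp l))).congr
    (fun x => by rw [a_eq]; ring) (fun x => mul_one 1)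

/-- A general comparison function g serves two uses: g = 1 for real λ and g = `envelope` for the
bound states. -/
lemma isBigO_aDeriv_of {l : ℂ} {g : ℝ → ℂ}
    (h0 : (fun x : ℝ => D.modeNum l x * Complex.exp (-(2 * Complex.I * l * x))) =O[⊤]
      fun x => (D.denom x : ℂ) * g x)
    (h1 : (fun x : ℝ => (D.modeNum' l x - 2 * Complex.I * l * D.modeNum l x)
        * Complex.exp (-(2 * Complex.I * l * x))) =O[⊤] fun x => (D.denom x : ℂ) * g x) :
    (fun x => D.a x l) =O[⊤] g ∧ D.aDeriv l =O[⊤] g := by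
  have key : ∀ f : ℝ → ℂ, f =O[⊤] (fun x => (D.denom x : ℂ) * g x) →
      (fun x => f x / D.denom x) =O[⊤] g := by
    intro f hf
    obtain ⟨c, hc⟩ := isBigO_top.mp hf
    refine isBigO_top.mpr ⟨c, fun x => ?_⟩
    have hp := norm_pos_iff.mpr (D.denom_ne_zero x)
    rw [norm_div, div_le_iff₀ hp]
    refine (hc x).trans_eq ?_
    rw [norm_mul]; ring
  refine ⟨(key _ h0).congr_left fun x => (D.a_eq x l).symm, ?_⟩
  have h2 := (key _ h0).mul (D.isBigO_div_denom (D.isBigO_denomOdd 0))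
  refine ((key _ h1).sub (h2.trans (isBigO_of_le _ fun x => by simp))).congr_left fun x => ?_
  rw [aDeriv]
  have hN := D.denom_ne_zero x
  field_simp

lemma isBigO_aDeriv (l : ℝ) : D.aDeriv l =O[⊤] fun _ : ℝ => (1 : ℂ) := by
  refine (D.isBigO_aDeriv_of (g := fun _ => 1) ?_ ?_).2
  · exact (D.isBigO_modeNum l).mul (isBigO_cexp l)
  · exact ((D.isBigO_modeNum' l).sub ((D.isBigO_modeNum l).const_mul_left _)).mul (isBigO_cexp l)

/-- `sech`-type envelope of the bound states. -/
def envelope (x : ℝ) : ℂ := ((1 / Real.cosh (2 * D.ρ₁ * x) : ℝ) : ℂ)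

/-- An exponential of rate at most 2ρ₂ is absorbed by cosh(2ρ₂x), one of the two factors comparable
to the denominator; the other factor cosh(2ρ₁x) is left as decay. -/
lemma isBigO_cexp_coshProd {k : ℝ} (hk : |k| ≤ 2 * D.ρ₂) :
    (fun x : ℝ => Complex.exp (k * x)) =O[⊤] fun x => (D.denom x : ℂ) * D.envelope x := by
  obtain ⟨c, hc⟩ := isBigO_top.mp D.isBigO_coshProd_denom
  refine isBigO_top.mpr ⟨2 * c, fun x => ?_⟩
  have h1 : ‖Complex.exp (k * x)‖ = Real.exp (k * x) := by
    rw [← Complex.ofReal_mul, ← Complex.ofReal_exp, Complex.norm_real, Real.norm_eq_abs, abs_of_pos (Real.exp_pos _)]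
  have h2 : Real.exp (k * x) ≤ 2 * Real.cosh (2 * D.ρ₂ * x) := by
    have h3 : Real.exp (k * x) ≤ Real.exp |2 * D.ρ₂ * x| := by
      refine Real.exp_le_exp.mpr ((le_abs_self _).trans ?_)
      rw [abs_mul, abs_mul, abs_of_pos (by linarith [D.ρ₂_pos] : 0 < 2 * D.ρ₂)]
      exact mul_le_mul_of_nonneg_right hk (abs_nonneg x)
    rw [← Real.cosh_abs]
    refine h3.trans ?_
    rw [Real.cosh_eq]; linarith [Real.exp_pos (-|2 * D.ρ₂ * x|)]
  have h4 := hc x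
  have hp := Real.cosh_pos (2 * D.ρ₁ * x)
  rw [Real.norm_eq_abs, abs_of_nonneg (zero_le_one.trans (D.one_le_coshProd x)), coshProd] at h4
  rw [h1, envelope, norm_mul, Complex.norm_real, Complex.norm_real, norm_div, norm_one,
    Real.norm_of_nonneg hp.le]
  rw [Complex.norm_real] at h4
  refine h2.trans ?_
  rw [mul_one_div, ← mul_div_assoc, le_div_iff₀ hp]
  nlinarith

end Data
end TwoSoliton

/-! ### Exponential decay of the bound states and their annihilation by P* -/

namespace TwoSoliton

namespace Data

variable (D : Data)

open Asymptotics

/-- The derivative bound comes from differentiating the exponential sum: uniqueness of derivatives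
identifies the numerator of a' with the termwise derivative. -/
lemma isBigO_envelope_of_exp {l A B C : ℂ} {k₁ k₂ k₃ : ℝ}
    (h : ∀ x : ℝ, D.modeNum l x * Complex.exp (-(2 * Complex.I * l * x)) =
      A * Complex.exp (k₁ * x) + B * Complex.exp (k₂ * x) + C * Complex.exp (k₃ * x))
    (h₁ : |k₁| ≤ 2 * D.ρ₂) (h₂ : |k₂| ≤ 2 * D.ρ₂) (h₃ : |k₃| ≤ 2 * D.ρ₂) :
    (fun x => D.a x l) =O[⊤] D.envelope ∧ D.aDeriv l =O[⊤] D.envelope := by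
  have e₁ := D.isBigO_cexp_coshProd h₁
  have e₂ := D.isBigO_cexp_coshProd h₂
  have e₃ := D.isBigO_cexp_coshProd h₃
  refine D.isBigO_aDeriv_of ?_ ?_
  · simp only [h]
    exact ((e₁.const_mul_left A).add (e₂.const_mul_left B)).add (e₃.const_mul_left C)
  · have hd : ∀ (k : ℝ) (x : ℝ), HasDerivAt (fun x : ℝ => Complex.exp (k * x))
        (k * Complex.exp (k * x)) x := fun k x => by
      have : HasDerivAt (fun x : ℝ => (k : ℂ) * x) k x := by
        simpa using (hasDerivAt_id x).ofReal_comp.const_mul (k : ℂ)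
      exact this.cexp.congr_deriv (by ring)
    refine (((e₁.const_mul_left (A * k₁)).add (e₂.const_mul_left (B * k₂))).add
      (e₃.const_mul_left (C * k₃))).congr_left fun x => ?_
    have d1 := (D.hasDerivAt_modeNum l x).mul (hasDerivAt_cexp l x)
    have d2 := (((hd k₁ x).const_mul A).add ((hd k₂ x).const_mul B)).add ((hd k₃ x).const_mul C)
    have hf : (D.modeNum l * fun x : ℝ => Complex.exp (-(2 * Complex.I * l * x))) =
        (((fun x : ℝ => A * Complex.exp (k₁ * x)) + fun x : ℝ => B * Complex.exp (k₂ * x))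
          + fun x : ℝ => C * Complex.exp (k₃ * x)) := funext h
    rw [hf] at d1
    have := d1.unique d2
    linear_combination -this

/-- At this special λ two of the four growing exponentials cancel. After multiplication by e^{-2ρ₁x}
the surviving rates are -2ρ₁, 2ρ₂ and -2ρ₂, all within the range that the denominator dominates. -/
lemma modeNum_neg_I_mul_ρ₁ (x : ℝ) : D.modeNum (-(Complex.I * D.ρ₁)) x =
    (D.ρ₁ + D.ρ₂) * (D.ρ₂ - D.ρ₁) * D.ρ₁ *
      (D.ρ₂ * (Real.cos (D.θ₂ - D.θ₁) + Complex.I * Real.sin (D.θ₂ - D.θ₁))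
        + (D.ρ₂ - D.ρ₁) / 2 * Real.exp (2 * (D.ρ₁ + D.ρ₂) * x)
        - (D.ρ₁ + D.ρ₂) / 2 * Real.exp (-(2 * (D.ρ₂ - D.ρ₁) * x))) := by
  rw [← Real.cosh_add_sinh, ← Real.cosh_sub_sinh, modeNum]
  simp only [denomEven, denomOdd, if_true, one_ne_zero, if_false]
  generalize Real.sinh (2 * (D.ρ₁ + D.ρ₂) * x) = S
  generalize Real.cosh (2 * (D.ρ₁ + D.ρ₂) * x) = C
  generalize Real.sinh (2 * (D.ρ₂ - D.ρ₁) * x) = h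
  generalize Real.cosh (2 * (D.ρ₂ - D.ρ₁) * x) = c
  generalize Real.sin (D.θ₂ - D.θ₁) = st
  generalize Real.cos (D.θ₂ - D.θ₁) = ct
  push_cast
  linear_combination ((D.ρ₁ : ℂ) ^ 2 *
      (2 * D.ρ₁ * D.ρ₂ * ct - ((D.ρ₂ - D.ρ₁) ^ 2 * C + (D.ρ₁ + D.ρ₂) ^ 2 * c) / 2)
    + D.ρ₁ / 2 * (-((D.ρ₂ - D.ρ₁) ^ 2 * (2 * (D.ρ₁ + D.ρ₂)) * S
      + (D.ρ₁ + D.ρ₂) ^ 2 * (2 * (D.ρ₂ - D.ρ₁)) * h) / 2)) * Complex.I_sq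

lemma modeNum_neg_I_mul_ρ₂ (x : ℝ) : D.modeNum (-(Complex.I * D.ρ₂)) x =
    (D.ρ₁ + D.ρ₂) * (D.ρ₂ - D.ρ₁) * D.ρ₂ *
      (-D.ρ₁ * (Real.cos (D.θ₂ - D.θ₁) - Complex.I * Real.sin (D.θ₂ - D.θ₁))
        + (D.ρ₂ - D.ρ₁) / 2 * Real.exp (2 * (D.ρ₁ + D.ρ₂) * x)
        + (D.ρ₁ + D.ρ₂) / 2 * Real.exp (2 * (D.ρ₂ - D.ρ₁) * x)) := by
  rw [← Real.cosh_add_sinh, ← Real.cosh_add_sinh, modeNum]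
  simp only [denomEven, denomOdd, if_true, one_ne_zero, if_false]
  generalize Real.sinh (2 * (D.ρ₁ + D.ρ₂) * x) = S
  generalize Real.cosh (2 * (D.ρ₁ + D.ρ₂) * x) = C
  generalize Real.sinh (2 * (D.ρ₂ - D.ρ₁) * x) = h
  generalize Real.cosh (2 * (D.ρ₂ - D.ρ₁) * x) = c
  generalize Real.sin (D.θ₂ - D.θ₁) = st
  generalize Real.cos (D.θ₂ - D.θ₁) = ct
  push_cast
  linear_combination ((D.ρ₂ : ℂ) ^ 2 *
      (2 * D.ρ₁ * D.ρ₂ * ct - ((D.ρ₂ - D.ρ₁) ^ 2 * C + (D.ρ₁ + D.ρ₂) ^ 2 * c) / 2)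
    + D.ρ₂ / 2 * (-((D.ρ₂ - D.ρ₁) ^ 2 * (2 * (D.ρ₁ + D.ρ₂)) * S
      + (D.ρ₁ + D.ρ₂) ^ 2 * (2 * (D.ρ₂ - D.ρ₁)) * h) / 2)) * Complex.I_sq

lemma isBigO_envelope_ρ₁ : (fun x => D.a x (-(Complex.I * D.ρ₁))) =O[⊤] D.envelope ∧
    D.aDeriv (-(Complex.I * D.ρ₁)) =O[⊤] D.envelope := by
  have h1 := D.ρ₁_pos
  have h2 := D.ρ₁_lt_ρ₂
  refine D.isBigO_envelope_of_exp (k₁ := -(2 * D.ρ₁)) (k₂ := 2 * D.ρ₂) (k₃ := -(2 * D.ρ₂))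
    (A := (D.ρ₁ + D.ρ₂) * (D.ρ₂ - D.ρ₁) * D.ρ₁ *
      (D.ρ₂ * (Real.cos (D.θ₂ - D.θ₁) + Complex.I * Real.sin (D.θ₂ - D.θ₁))))
    (B := (D.ρ₁ + D.ρ₂) * (D.ρ₂ - D.ρ₁) * D.ρ₁ * ((D.ρ₂ - D.ρ₁) / 2))
    (C := (D.ρ₁ + D.ρ₂) * (D.ρ₂ - D.ρ₁) * D.ρ₁ * (-((D.ρ₁ + D.ρ₂) / 2))) (fun x => ?_)
    (abs_le.mpr ⟨by linarith, by linarith⟩) (abs_le.mpr ⟨by linarith, by linarith⟩)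
    (abs_le.mpr ⟨by linarith, by linarith⟩)
  have e1 : Complex.exp (-(2 * Complex.I * -(Complex.I * D.ρ₁) * x)) =
      Complex.exp ((-(2 * D.ρ₁) : ℝ) * x) := by
    congr 1; push_cast; linear_combination 2 * D.ρ₁ * x * Complex.I_sq
  have e2 : Complex.exp ((2 * D.ρ₂ : ℝ) * x) =
      Real.exp (2 * (D.ρ₁ + D.ρ₂) * x) * Complex.exp ((-(2 * D.ρ₁) : ℝ) * x) := by
    push_cast; rw [← Complex.exp_add]; congr 1; ring
  have e3 : Complex.exp ((-(2 * D.ρ₂) : ℝ) * x) =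
      Real.exp (-(2 * (D.ρ₂ - D.ρ₁) * x)) * Complex.exp ((-(2 * D.ρ₁) : ℝ) * x) := by
    push_cast; rw [← Complex.exp_add]; congr 1; ring
  rw [modeNum_neg_I_mul_ρ₁, e1, e2, e3]
  ring

lemma isBigO_envelope_ρ₂ : (fun x => D.a x (-(Complex.I * D.ρ₂))) =O[⊤] D.envelope ∧
    D.aDeriv (-(Complex.I * D.ρ₂)) =O[⊤] D.envelope := by
  have h1 := D.ρ₁_pos
  have h2 := D.ρ₁_lt_ρ₂
  refine D.isBigO_envelope_of_exp (k₁ := -(2 * D.ρ₂)) (k₂ := 2 * D.ρ₁) (k₃ := -(2 * D.ρ₁))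
    (A := (D.ρ₁ + D.ρ₂) * (D.ρ₂ - D.ρ₁) * D.ρ₂ *
      (-D.ρ₁ * (Real.cos (D.θ₂ - D.θ₁) - Complex.I * Real.sin (D.θ₂ - D.θ₁))))
    (B := (D.ρ₁ + D.ρ₂) * (D.ρ₂ - D.ρ₁) * D.ρ₂ * ((D.ρ₂ - D.ρ₁) / 2))
    (C := (D.ρ₁ + D.ρ₂) * (D.ρ₂ - D.ρ₁) * D.ρ₂ * ((D.ρ₁ + D.ρ₂) / 2)) (fun x => ?_)
    (abs_le.mpr ⟨by linarith, by linarith⟩) (abs_le.mpr ⟨by linarith, by linarith⟩)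
    (abs_le.mpr ⟨by linarith, by linarith⟩)
  have e1 : Complex.exp (-(2 * Complex.I * -(Complex.I * D.ρ₂) * x)) =
      Complex.exp ((-(2 * D.ρ₂) : ℝ) * x) := by
    congr 1; push_cast; linear_combination 2 * D.ρ₂ * x * Complex.I_sq
  have e2 : Complex.exp ((2 * D.ρ₁ : ℝ) * x) =
      Real.exp (2 * (D.ρ₁ + D.ρ₂) * x) * Complex.exp ((-(2 * D.ρ₂) : ℝ) * x) := by
    push_cast; rw [← Complex.exp_add]; congr 1; ring
  have e3 : Complex.exp ((-(2 * D.ρ₁) : ℝ) * x) =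
      Real.exp (2 * (D.ρ₂ - D.ρ₁) * x) * Complex.exp ((-(2 * D.ρ₂) : ℝ) * x) := by
    push_cast; rw [← Complex.exp_add]; congr 1; ring
  rw [modeNum_neg_I_mul_ρ₂, e1, e2, e3]
  ring

lemma isBigO_envelope_one : D.envelope =O[⊤] fun _ : ℝ => (1 : ℂ) :=
  isBigO_top.mpr ⟨1, fun x => by
    rw [envelope, Complex.norm_real, norm_one, mul_one, norm_div, norm_one,
      Real.norm_of_nonneg (Real.cosh_pos _).le]
    exact (div_le_one (Real.cosh_pos _)).mpr (Real.one_le_cosh _)⟩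

lemma memLp_envelope : MemLp D.envelope 2 := by
  have hc : Continuous D.envelope := by
    unfold envelope
    exact Complex.continuous_ofReal.comp (continuous_const.div (by fun_prop)
      fun x => (Real.cosh_pos _).ne')
  rw [memLp_two_iff_integrable_sq_norm hc.aestronglyMeasurable]
  have hi : Integrable fun x : ℝ => (1 + (2 * D.ρ₁ * x) ^ 2)⁻¹ :=
    integrable_inv_one_add_sq.comp_mul_left' (by linarith [D.ρ₁_pos] : 2 * D.ρ₁ ≠ 0)
  refine hi.mono' (by fun_prop) (Eventually.of_forall fun x => ?_)
  rw [envelope, Complex.norm_real, norm_div, norm_one, Real.norm_of_nonneg (Real.cosh_pos _).le,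
    Real.norm_of_nonneg (by positivity), div_pow, one_pow, one_div]
  refine inv_anti₀ (by positivity) ?_
  have h1 := Real.cosh_sq (2 * D.ρ₁ * x)
  have h2 : |2 * D.ρ₁ * x| ≤ |Real.sinh (2 * D.ρ₁ * x)| := by
    rw [Real.abs_sinh]
    exact Real.self_le_sinh_iff.mpr (abs_nonneg _)
  have h3 := sq_le_sq.mpr h2
  linarith

lemma memLp_of_isBigO_envelope {f : ℝ → ℂ} (hf : f =O[⊤] D.envelope) (hc : Continuous f) :
    MemLp f 2 := by
  obtain ⟨c, hc'⟩ := isBigO_top.mp hf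
  exact D.memLp_envelope.of_le_mul hc.aestronglyMeasurable (Eventually.of_forall hc')

/-- A bound state is a linear combination of `a(·,-iρ₁)` and `a(·,-iρ₂)`. -/
lemma exists_boundMode_eq (p : Parity) : ∃ A B : ℂ, ∀ x, D.boundMode p x =
    A * D.a x (-(Complex.I * D.ρ₁)) + B * D.a x (-(Complex.I * D.ρ₂)) := by
  cases p
  · refine ⟨1 / (Real.sqrt (4 * (D.ρ₁ + D.ρ₂)) : ℂ) * (2 / (D.ρ₁ - D.ρ₂) *
      Complex.exp (Complex.I * D.θ₁)), 1 / (Real.sqrt (4 * (D.ρ₁ + D.ρ₂)) : ℂ) *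
      (2 / (D.ρ₂ - D.ρ₁) * Complex.exp (Complex.I * D.θ₂)), fun x => ?_⟩
    rw [boundMode]; ring
  · refine ⟨1 / (Real.sqrt (4 * (D.ρ₁ + D.ρ₂)) : ℂ) * ((Real.sqrt (D.ρ₂ / D.ρ₁) : ℂ) *
      (2 / (D.ρ₁ - D.ρ₂)) * Complex.exp (Complex.I * D.θ₁)),
      1 / (Real.sqrt (4 * (D.ρ₁ + D.ρ₂)) : ℂ) * ((Real.sqrt (D.ρ₁ / D.ρ₂) : ℂ) *
      (2 / (D.ρ₂ - D.ρ₁)) * Complex.exp (Complex.I * D.θ₂)), fun x => ?_⟩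
    rw [boundMode]; ring

lemma memLp_boundMode (p : Parity) : MemLp (D.boundMode p) 2 := by
  obtain ⟨A, B, h⟩ := D.exists_boundMode_eq p
  rw [show D.boundMode p = _ from funext h]
  exact ((D.memLp_of_isBigO_envelope D.isBigO_envelope_ρ₁.1 (D.continuous_a _)).const_mul A).add
    ((D.memLp_of_isBigO_envelope D.isBigO_envelope_ρ₂.1 (D.continuous_a _)).const_mul B)

/-- The differential expression `P φ` with `a(x,λ) = P e^{-2iλx}`. -/
def darboux (φ : SchwartzMap ℝ ℂ) (x : ℝ) : ℂ :=
  -(deriv (deriv φ) x) / 4 + Complex.I / 2 * D.a1 x * deriv φ x + D.a0 x * φ x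

lemma integral_conj_a_mul_darboux (l : ℝ) (φ : SchwartzMap ℝ ℂ) :
    ∫ x, starRingEnd ℂ (D.a x l) * D.darboux φ x
      = ∫ x : ℝ, starRingEnd ℂ (D.symbol l * Complex.exp (-(2 * Complex.I * l * x))) * φ x := by
  obtain ⟨c0, h0⟩ := isBigO_top.mp (D.isBigO_a l)
  obtain ⟨c1, h1⟩ := isBigO_top.mp (D.isBigO_aDeriv l)
  obtain ⟨c2, h2⟩ := isBigO_top.mp D.isBigO_a0
  obtain ⟨c3, h3⟩ := isBigO_top.mp D.isBigO_a1
  simp only [norm_one, mul_one] at h0 h1 h2 h3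
  set c := max (max c0 c1) (max (max c2 c3) ‖D.symbol l‖) with hc
  refine D.integral_conj_a_mul l φ (c := c) (fun x => (h0 x).trans ?_) (fun x => (h1 x).trans ?_)
    (fun x => ?_) (fun x => (h3 x).trans ?_) (fun x => (h2 x).trans ?_)
  · simp [hc]
  · simp [hc]
  · rw [norm_mul, norm_cexp_mode, mul_one]; simp [hc]
  · simp [hc]
  · simp [hc]

/-- Applied at -iρ₁ and -iρ₂, the zeros of the symbol, this is the orthogonality of the bound states
to the range of P. -/
lemma integral_conj_a_mul_darboux_eq_zero {l : ℂ} (hl : D.symbol l = 0)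
    (h : (fun x => D.a x l) =O[⊤] D.envelope ∧ D.aDeriv l =O[⊤] D.envelope)
    (φ : SchwartzMap ℝ ℂ) : ∫ x, starRingEnd ℂ (D.a x l) * D.darboux φ x = 0 := by
  obtain ⟨c0, h0⟩ := isBigO_top.mp (h.1.trans D.isBigO_envelope_one)
  obtain ⟨c1, h1⟩ := isBigO_top.mp (h.2.trans D.isBigO_envelope_one)
  obtain ⟨c2, h2⟩ := isBigO_top.mp D.isBigO_a0
  obtain ⟨c3, h3⟩ := isBigO_top.mp D.isBigO_a1
  simp only [norm_one, mul_one] at h0 h1 h2 h3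
  set c := max (max c0 c1) (max c2 c3) with hc
  have hpos : 0 ≤ c := (norm_nonneg _).trans ((h0 0).trans (by simp [hc]))
  have := D.integral_conj_a_mul l φ (c := c) (fun x => (h0 x).trans (by simp [hc]))
    (fun x => (h1 x).trans (by simp [hc])) (fun x => by simpa [hl] using hpos)
    (fun x => (h3 x).trans (by simp [hc])) (fun x => (h2 x).trans (by simp [hc]))
  simp only [hl, zero_mul, map_zero, integral_zero] at this
  exact this

lemma symbol_neg_I_mul_ρ₁ : D.symbol (-(Complex.I * D.ρ₁)) = 0 := by
  rw [symbol]; linear_combination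
    ((D.ρ₁ : ℂ) ^ 2 * ((-(Complex.I * D.ρ₁)) ^ 2 + (D.ρ₂ : ℂ) ^ 2)) * Complex.I_sq

lemma symbol_neg_I_mul_ρ₂ : D.symbol (-(Complex.I * D.ρ₂)) = 0 := by
  rw [symbol]; linear_combination
    ((D.ρ₂ : ℂ) ^ 2 * ((-(Complex.I * D.ρ₂)) ^ 2 + (D.ρ₁ : ℂ) ^ 2)) * Complex.I_sq

end Data
end TwoSoliton

/-! ### Multiplication, dilation and Fourier transform as bounded operators on L² -/

namespace TwoSoliton

open scoped FourierTransform ENNReal NNReal ContDiff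

/-- Passes from a formula on functions to an operator on classes; `hcongr` is what makes it
independent of representatives. -/
lemma exists_clm_of_bound (T : (ℝ → ℂ) → ℝ → ℂ) (hadd : ∀ f g, T (f + g) = T f + T g)
    (hsmul : ∀ (c : ℂ) f, T (c • f) = c • T f)
    (hcongr : ∀ f g : ℝ → ℂ, f =ᵐ[volume] g → T f =ᵐ[volume] T g)
    (hmeas : ∀ f, MemLp f 2 → AEStronglyMeasurable (T f)) (c : ℝ≥0)
    (hb : ∀ f, MemLp f 2 → eLpNorm (T f) 2 ≤ c * eLpNorm f 2) :
    ∃ S : Lp ℂ 2 (volume : Measure ℝ) →L[ℂ] Lp ℂ 2 (volume : Measure ℝ),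
      ∀ f : Lp ℂ 2 (volume : Measure ℝ), S f =ᵐ[volume] T f := by
  have hmem : ∀ f : Lp ℂ 2 (volume : Measure ℝ), MemLp (T f) 2 := fun f =>
    ⟨hmeas f (Lp.memLp f), (hb f (Lp.memLp f)).trans_lt
      (ENNReal.mul_lt_top ENNReal.coe_lt_top (Lp.memLp f).2)⟩
  let L : Lp ℂ 2 (volume : Measure ℝ) →ₗ[ℂ] Lp ℂ 2 (volume : Measure ℝ) :=
    { toFun := fun f => (hmem f).toLp (T f)
      map_add' := fun f g => by
        rw [← MemLp.toLp_add]
        refine (MemLp.toLp_eq_toLp_iff _ _).mpr ?_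
        rw [← hadd]; exact hcongr _ _ (Lp.coeFn_add f g)
      map_smul' := fun a f => by
        rw [RingHom.id_apply, ← MemLp.toLp_const_smul]
        refine (MemLp.toLp_eq_toLp_iff _ _).mpr ?_
        rw [← hsmul]; exact hcongr _ _ (Lp.coeFn_smul a f) }
  refine ⟨L.mkContinuous c fun f => ?_, fun f => (hmem f).coeFn_toLp⟩
  change ‖(hmem f).toLp (T f)‖ ≤ _
  rw [Lp.norm_toLp, Lp.norm_def, ← ENNReal.coe_toReal, ← ENNReal.toReal_mul]
  exact ENNReal.toReal_mono (ENNReal.mul_ne_top ENNReal.coe_ne_top (Lp.memLp f).2.ne)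
    (hb f (Lp.memLp f))

lemma exists_clm_mul {m : ℝ → ℂ} (hm : Continuous m) {c : ℝ} (hb : ∀ x, ‖m x‖ ≤ c) :
    ∃ S : Lp ℂ 2 (volume : Measure ℝ) →L[ℂ] Lp ℂ 2 (volume : Measure ℝ),
      ∀ f : Lp ℂ 2 (volume : Measure ℝ), S f =ᵐ[volume] fun x => m x * f x := by
  refine exists_clm_of_bound (fun f x => m x * f x) (fun f g => ?_) (fun a f => ?_)
    (fun f g h => ?_) (fun f hf => hm.aestronglyMeasurable.mul hf.1) (Real.toNNReal c)
    (fun f hf => ?_)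
  · funext x; simp [mul_add]
  · funext x; simp [mul_left_comm]
  · filter_upwards [h] with x hx; rw [hx]
  · exact eLpNorm_le_mul_eLpNorm_of_ae_le_mul (Eventually.of_forall fun x => by
      rw [norm_mul]; exact mul_le_mul_of_nonneg_right (hb x) (norm_nonneg _)) 2

lemma exists_clm_comp_mul {k : ℝ} (hk : k ≠ 0) :
    ∃ S : Lp ℂ 2 (volume : Measure ℝ) →L[ℂ] Lp ℂ 2 (volume : Measure ℝ),
      ∀ f : Lp ℂ 2 (volume : Measure ℝ), S f =ᵐ[volume] fun x => f (k * x) := by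
  have hq : Measure.QuasiMeasurePreserving (fun x : ℝ => k * x) volume volume := by
    refine ⟨measurable_const_mul k, ?_⟩
    rw [Real.map_volume_mul_left hk]
    exact Measure.smul_absolutelyContinuous
  have hne : ENNReal.ofReal |k⁻¹| ^ (1 / (2 : ℝ≥0∞)).toReal ≠ ⊤ := by
    refine ENNReal.rpow_ne_top_of_nonneg ENNReal.toReal_nonneg ENNReal.ofReal_ne_top
  refine exists_clm_of_bound (fun f x => f (k * x)) (fun f g => rfl) (fun a f => rfl)
    (fun f g h => hq.ae_eq h) (fun f hf => hf.1.comp_quasiMeasurePreserving hq)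
    (ENNReal.ofReal |k⁻¹| ^ (1 / (2 : ℝ≥0∞)).toReal).toNNReal
    (fun f hf => ?_)
  have h1 : eLpNorm (fun x => f (k * x)) 2 volume =
      eLpNorm f 2 (Measure.map (fun x => k * x) volume) :=
    (eLpNorm_map_measure (hf.1.mono_ac hq.2) (measurable_const_mul k).aemeasurable).symm
  rw [h1, Real.map_volume_mul_left hk, eLpNorm_smul_measure_of_ne_top (by simp),
    ENNReal.coe_toNNReal hne, smul_eq_mul]

/-- The `L²` Fourier transform of an integrable function is given by the Fourier integral. -/
lemma coeFn_fourier_toLp {f : ℝ → ℂ} (h1 : Integrable f) (h2 : MemLp f 2) :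
    (𝓕 (h2.toLp f) : Lp ℂ 2 (volume : Measure ℝ)) =ᵐ[volume] 𝓕 f := by
  refine ae_eq_of_integral_contDiff_smul_eq
    ((Lp.memLp (𝓕 (h2.toLp f) : Lp ℂ 2 (volume : Measure ℝ))).locallyIntegrable (by norm_num))
    ?_ fun g hg hgc => ?_
  · refine Continuous.locallyIntegrable ?_
    exact VectorFourier.fourierIntegral_continuous Real.continuous_fourierChar
      (by exact continuous_inner) h1
  · have hg₁ : HasCompactSupport (Complex.ofRealCLM ∘ g) := hgc.comp_left rfl
    have hg₂ : ContDiff ℝ ∞ (Complex.ofRealCLM ∘ g) := by fun_prop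
    set G : SchwartzMap ℝ ℂ := hg₁.toSchwartzMap hg₂ with hG
    have hGx : ∀ x, G x = g x := fun x => rfl
    -- Both functions are tested against g: the distributional definition on one side and Fubini for
    -- the integrable f on the other move the Fourier transform onto g.
    have e1 := congrArg (fun T => T G) (Lp.fourier_toTemperedDistribution_eq (h2.toLp f))
    simp only [TemperedDistribution.fourier_apply, Lp.toTemperedDistribution_apply] at e1
    have e2 : ∫ ξ, 𝓕 f ξ • G ξ = ∫ x, f x • 𝓕 (G : ℝ → ℂ) x := by
      have := VectorFourier.integral_fourierIntegral_smul_eq_flip (L := innerₗ ℝ)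
        Real.continuous_fourierChar continuous_inner h1 (G.integrable (μ := volume))
      simpa using! this
    have e3 : ∫ x, g x • (𝓕 (h2.toLp f) : Lp ℂ 2 (volume : Measure ℝ)) x =
        ∫ x, G x • (𝓕 (h2.toLp f) : Lp ℂ 2 (volume : Measure ℝ)) x := by
      simp [hGx]
    have e4 : ∫ x, g x • 𝓕 f x = ∫ x, 𝓕 f x • G x := by
      simp [hGx, mul_comm]
    rw [e3, ← e1, e4, e2]
    refine integral_congr_ae ?_
    filter_upwards [h2.coeFn_toLp] with x hx
    rw [hx, SchwartzMap.fourier_coe, smul_eq_mul, smul_eq_mul, mul_comm]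

/-- A rescaled Fourier transform as a bounded operator on `L²`. -/
lemma exists_clm_fourier {k : ℝ} (hk : k ≠ 0) :
    ∃ S : Lp ℂ 2 (volume : Measure ℝ) →L[ℂ] Lp ℂ 2 (volume : Measure ℝ),
      ∀ (f : ℝ → ℂ) (_ : Integrable f) (h2 : MemLp f 2),
        S (h2.toLp f) =ᵐ[volume] fun x => ∫ y : ℝ, Complex.exp (-(2 * Complex.I * k * y * x)) * f y := by
  -- The kernel e^{-2ikxy} is the Fourier kernel e^{-2πiyξ} at ξ = kx/π.
  obtain ⟨S, hS⟩ := exists_clm_comp_mul (k := k / Real.pi) (by positivity)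
  refine ⟨S ∘L (Lp.fourierTransformₗᵢ ℝ ℂ).toContinuousLinearEquiv, fun f h1 h2 => ?_⟩
  have e : (S ∘L (Lp.fourierTransformₗᵢ ℝ ℂ).toContinuousLinearEquiv) (h2.toLp f)
    = S (𝓕 (h2.toLp f) : Lp ℂ 2 (volume : Measure ℝ)) := rfl
  have hq : Measure.QuasiMeasurePreserving (fun x : ℝ => k / Real.pi * x) volume volume := by
    refine ⟨measurable_const_mul _, ?_⟩
    rw [Real.map_volume_mul_left (by positivity)]
    exact Measure.smul_absolutelyContinuous
  rw [e]
  refine (hS _).trans ((hq.ae_eq (coeFn_fourier_toLp h1 h2)).trans (Eventually.of_forall fun x => ?_))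
  change 𝓕 f (k / Real.pi * x) = _
  rw [Real.fourier_real_eq_integral_exp_smul]
  refine integral_congr_ae (Eventually.of_forall fun y => ?_)
  simp only [smul_eq_mul]
  congr 2
  push_cast
  have : (Real.pi : ℂ) ≠ 0 := by exact_mod_cast Real.pi_ne_zero
  field_simp

end TwoSoliton

/-! ### The normalization of the modes; synthesis and analysis operators -/

namespace TwoSoliton

open scoped FourierTransform ENNReal NNReal ContDiff

lemma memLp_mul_of_bound {m f : ℝ → ℂ} (hm : Continuous m) {c : ℝ} (hb : ∀ x, ‖m x‖ ≤ c)
    (hf : MemLp f 2) : MemLp (fun x => m x * f x) 2 :=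
  hf.of_le_mul (c := c) (hm.aestronglyMeasurable.mul hf.1) (Eventually.of_forall fun x => by
      rw [norm_mul]; exact mul_le_mul_of_nonneg_right (hb x) (norm_nonneg _))

lemma clm_mul_toLp {m f : ℝ → ℂ} (hm : Continuous m) {c : ℝ} (hb : ∀ x, ‖m x‖ ≤ c)
    {M : Lp ℂ 2 (volume : Measure ℝ) →L[ℂ] Lp ℂ 2 (volume : Measure ℝ)}
    (hM : ∀ f : Lp ℂ 2 (volume : Measure ℝ), M f =ᵐ[volume] fun x => m x * f x)
    (hf : MemLp f 2) : M (hf.toLp f) = (memLp_mul_of_bound hm hb hf).toLp _ := by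
  refine Lp.ext ((hM _).trans ?_)
  filter_upwards [hf.coeFn_toLp, (memLp_mul_of_bound hm hb hf).coeFn_toLp] with x h1 h2
  rw [h1, h2]

namespace Data

variable (D : Data)

open Asymptotics

/-- The normalization `(2 π (λ² + ρ₁²) (λ² + ρ₂²))^{-1/2}` of the continuum modes. -/
def normFactor (l : ℝ) : ℝ :=
  1 / Real.sqrt (2 * Real.pi * (l ^ 2 + D.ρ₁ ^ 2) * (l ^ 2 + D.ρ₂ ^ 2))

lemma symbol_pos (l : ℝ) : 0 < (l ^ 2 + D.ρ₁ ^ 2) * (l ^ 2 + D.ρ₂ ^ 2) := by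
  have := D.ρ₁_pos
  have := D.ρ₂_pos
  positivity

lemma normFactor_pos (l : ℝ) : 0 < D.normFactor l := by
  have := D.symbol_pos l
  refine one_div_pos.mpr (Real.sqrt_pos.mpr ?_)
  rw [mul_assoc]; exact mul_pos Real.two_pi_pos this

lemma normFactor_sq (l : ℝ) :
    D.normFactor l ^ 2 = 1 / (2 * Real.pi * ((l ^ 2 + D.ρ₁ ^ 2) * (l ^ 2 + D.ρ₂ ^ 2))) := by
  have := D.symbol_pos l
  rw [normFactor, div_pow, one_pow, Real.sq_sqrt, mul_assoc]
  rw [mul_assoc]; exact (mul_pos Real.two_pi_pos this).le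

lemma normFactor_neg (l : ℝ) : D.normFactor (-l) = D.normFactor l := by
  simp [normFactor]

lemma continuous_normFactor : Continuous D.normFactor := by
  refine continuous_const.div (by fun_prop) fun l => (one_div_pos.mp (D.normFactor_pos l)).ne'

/-- The polynomial part of a(x,λ) has degree 2 in λ, and the normalization decays like λ⁻², so
precisely the powers that occur stay bounded. -/
lemma pow_mul_normFactor_le (j : ℕ) (hj : j ≤ 2) (l : ℝ) :
    ‖((l : ℂ) ^ j * D.normFactor l)‖ ≤ 1 + D.normFactor 0 := by
  have hp := D.normFactor_pos l
  have h1 : |l| ^ j ≤ 1 + l ^ 2 := by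
    interval_cases j
    · simp; positivity
    · rw [pow_one]; nlinarith [sq_abs l, sq_nonneg (|l| - 1), abs_nonneg l]
    · rw [sq_abs]; linarith
  have h2 : D.normFactor l ≤ D.normFactor 0 := by
    refine one_div_le_one_div_of_le (one_div_pos.mp (D.normFactor_pos 0)) (Real.sqrt_le_sqrt ?_)
    have := D.ρ₁_pos
    have := D.ρ₂_pos
    simp only [ne_eq, OfNat.ofNat_ne_zero, not_false_eq_true, zero_pow, zero_add]
    gcongr <;> linarith [sq_nonneg l]
  have h3 : l ^ 2 * D.normFactor l ≤ 1 := by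
    rw [normFactor, mul_one_div]
    refine div_le_one_of_le₀ (Real.le_sqrt_of_sq_le ?_) (Real.sqrt_nonneg _)
    have h4 : (l ^ 2) ^ 2 ≤ (l ^ 2 + D.ρ₁ ^ 2) * (l ^ 2 + D.ρ₂ ^ 2) := by
      nlinarith [mul_nonneg (sq_nonneg l) (sq_nonneg D.ρ₁), mul_nonneg (sq_nonneg l) (sq_nonneg D.ρ₂),
        mul_nonneg (sq_nonneg D.ρ₁) (sq_nonneg D.ρ₂)]
    have := D.symbol_pos l
    nlinarith [Real.pi_gt_three]
  rw [norm_mul, norm_pow, Complex.norm_real, Complex.norm_real, Real.norm_eq_abs,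
    Real.norm_of_nonneg hp.le]
  nlinarith

/-- Needed to multiply Schwartz functions by the normalization, which is a constant times a product
of two factors (1 + (λ/ρₖ)²)^{-1/2}. -/
lemma hasTemperateGrowth_normFactor : D.normFactor.HasTemperateGrowth := by
  have key : ∀ r : ℝ, 0 < r → (fun l : ℝ => (1 + ‖l / r‖ ^ 2) ^ (-(1 / 2) : ℝ)).HasTemperateGrowth :=
    fun r hr => by
      have h1 : (fun l : ℝ => l / r).HasTemperateGrowth := by
        have : (fun l : ℝ => l / r) = fun l => l * r⁻¹ := by funext l; rw [div_eq_mul_inv]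
        rw [this]
        exact Function.HasTemperateGrowth.id'.mul (Function.HasTemperateGrowth.const _)
      exact (Function.hasTemperateGrowth_one_add_norm_sq_rpow ℝ (-(1 / 2))).comp h1
  have h := ((Function.HasTemperateGrowth.const (E := ℝ) (D.normFactor 0)).mul (key _ D.ρ₁_pos)).mul
    (key _ D.ρ₂_pos)
  refine (congrArg Function.HasTemperateGrowth (funext fun l => ?_)).mpr h
  have h1 := D.ρ₁_pos
  have h2 := D.ρ₂_pos
  have e : ∀ r : ℝ, 0 < r → (1 + ‖l / r‖ ^ 2) ^ (-(1 / 2) : ℝ) = 1 / Real.sqrt ((l ^ 2 + r ^ 2) / r ^ 2) := by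
    intro r hr
    rw [Real.rpow_neg (by positivity), ← Real.sqrt_eq_rpow, one_div, Real.norm_eq_abs, sq_abs]
    congr 2; field_simp; ring
  rw [Pi.mul_apply, Pi.mul_apply, e _ h1, e _ h2, normFactor, normFactor]
  rw [one_div_mul_one_div, one_div_mul_one_div, ← Real.sqrt_mul (by positivity), ← Real.sqrt_mul (by positivity)]
  congr 2
  field_simp
  ring

lemma contMode_even (x l : ℝ) :
    D.contMode .even x l = (D.a x l + D.a x (-l)) * D.normFactor l := by
  rw [contMode, normFactor]; push_cast; ring

lemma contMode_odd (x l : ℝ) :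
    D.contMode .odd x l = (D.a x l - D.a x (-l)) * D.normFactor l := by
  rw [contMode, normFactor]; push_cast; ring

lemma continuous_a0 : Continuous D.a0 := by
  have : D.a0 = fun x => D.a x 0 := by funext x; simp [a]
  rw [this]; exact D.continuous_a 0

lemma continuous_a1 : Continuous D.a1 := by
  -- At λ = 1 the polynomial factor is 1 + a⁽¹⁾ + a⁽⁰⁾, so continuity follows from that of the
  -- modes.
  have : D.a1 = fun x => D.a x 1 * Complex.exp (2 * Complex.I * x) - 1 - D.a0 x := by
    funext x
    have : Complex.exp (-(2 * Complex.I * x)) * Complex.exp (2 * Complex.I * x) = 1 := by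
      rw [← Complex.exp_add]; simp
    rw [a, mul_assoc]
    simp only [mul_one]
    rw [this]; ring
  rw [this]
  exact (((D.continuous_a 1).mul (by fun_prop)).sub continuous_const).sub D.continuous_a0

lemma continuous_pow_mul_normFactor (j : ℕ) :
    Continuous fun l : ℝ => (l : ℂ) ^ j * D.normFactor l :=
  (Complex.continuous_ofReal.pow j).mul (Complex.continuous_ofReal.comp D.continuous_normFactor)

/-- Since a(x,λ) = (λ² + a⁽¹⁾λ + a⁽⁰⁾)e^{-2iλx}, synthesis is a sum of three terms: multiply by λʲ
times the normalization, take the Fourier transform, multiply by the bounded coefficient.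
Boundedness on L² follows from Plancherel. -/
lemma exists_synthesis : ∃ S : Lp ℂ 2 (volume : Measure ℝ) →L[ℂ] Lp ℂ 2 (volume : Measure ℝ),
    ∀ (f : ℝ → ℂ) (_ : Integrable f) (h2 : MemLp f 2), S (h2.toLp f) =ᵐ[volume]
      fun x => ∫ l : ℝ, f l * (D.a x l * D.normFactor l) := by
  obtain ⟨T, hT⟩ := exists_clm_fourier (k := 1) one_ne_zero
  obtain ⟨c1, hc1⟩ := isBigO_top.mp D.isBigO_a1
  obtain ⟨c0, hc0⟩ := isBigO_top.mp D.isBigO_a0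
  simp only [norm_one, mul_one] at hc0 hc1
  have hm := D.continuous_pow_mul_normFactor
  have hmb := D.pow_mul_normFactor_le
  obtain ⟨M0, hM0⟩ := exists_clm_mul (hm 0) (hmb 0 (by norm_num))
  obtain ⟨M1, hM1⟩ := exists_clm_mul (hm 1) (hmb 1 (by norm_num))
  obtain ⟨M2, hM2⟩ := exists_clm_mul (hm 2) (hmb 2 (by norm_num))
  obtain ⟨A0, hA0⟩ := exists_clm_mul D.continuous_a0 hc0
  obtain ⟨A1, hA1⟩ := exists_clm_mul D.continuous_a1 hc1
  refine ⟨T ∘L M2 + A1 ∘L T ∘L M1 + A0 ∘L T ∘L M0, fun f h1 h2 => ?_⟩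
  have i : ∀ j ≤ 2, Integrable fun l : ℝ => (l : ℂ) ^ j * D.normFactor l * f l := fun j hj =>
    h1.bdd_mul (hm j).aestronglyMeasurable (Eventually.of_forall (hmb j hj))
  have e0 := hT _ (i 0 (by norm_num)) (memLp_mul_of_bound (hm 0) (hmb 0 (by norm_num)) h2)
  have e1 := hT _ (i 1 (by norm_num)) (memLp_mul_of_bound (hm 1) (hmb 1 (by norm_num)) h2)
  have e2 := hT _ (i 2 (by norm_num)) (memLp_mul_of_bound (hm 2) (hmb 2 (by norm_num)) h2)
  simp only [add_apply, ContinuousLinearMap.comp_apply,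
    clm_mul_toLp (hm 0) (hmb 0 (by norm_num)) hM0 h2,
    clm_mul_toLp (hm 1) (hmb 1 (by norm_num)) hM1 h2,
    clm_mul_toLp (hm 2) (hmb 2 (by norm_num)) hM2 h2]
  filter_upwards [e0, e1, e2, Lp.coeFn_add (T ((memLp_mul_of_bound (hm 2) (hmb 2 (by norm_num)) h2).toLp _)
    + A1 (T ((memLp_mul_of_bound (hm 1) (hmb 1 (by norm_num)) h2).toLp _)))
    (A0 (T ((memLp_mul_of_bound (hm 0) (hmb 0 (by norm_num)) h2).toLp _))),
    Lp.coeFn_add (T ((memLp_mul_of_bound (hm 2) (hmb 2 (by norm_num)) h2).toLp _))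
    (A1 (T ((memLp_mul_of_bound (hm 1) (hmb 1 (by norm_num)) h2).toLp _))), hA0 _, hA1 _]
    with x e0 e1 e2 s1 s2 t0 t1
  rw [s1, Pi.add_apply, s2, Pi.add_apply, t0, t1, e0, e1, e2]
  have ie : ∀ j ≤ 2, Integrable fun l : ℝ => Complex.exp (-(2 * Complex.I * ((1 : ℝ) : ℂ) * l * x)) *
      ((l : ℂ) ^ j * D.normFactor l * f l) := fun j hj =>
    (i j hj).bdd_mul (c := 1) (by fun_prop) (Eventually.of_forall fun l => by
      have := norm_cexp_mode l x
      rw [Complex.ofReal_one, mul_one]; exact this.le)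
  have i1 := (ie 1 (by norm_num)).const_mul (D.a1 x)
  have i2 := (ie 2 le_rfl).fun_add i1
  rw [← integral_const_mul, ← integral_const_mul, ← integral_add (ie 2 le_rfl) i1,
    ← integral_add i2 ((ie 0 (by norm_num)).const_mul _)]
  refine integral_congr_ae (Eventually.of_forall fun l => ?_)
  simp only [a, Complex.ofReal_one, mul_one]
  ring

/-- The same three-term decomposition in reverse order, with conjugated coefficients and the
opposite sign in the Fourier kernel. -/
lemma exists_analysis : ∃ C : Lp ℂ 2 (volume : Measure ℝ) →L[ℂ] Lp ℂ 2 (volume : Measure ℝ),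
    ∀ (f : ℝ → ℂ) (_ : Integrable f) (h2 : MemLp f 2), C (h2.toLp f) =ᵐ[volume]
      fun l => D.normFactor l * ∫ x : ℝ, starRingEnd ℂ (D.a x l) * f x := by
  obtain ⟨T, hT⟩ := exists_clm_fourier (k := -1) (by norm_num)
  obtain ⟨c1, hc1⟩ := isBigO_top.mp D.isBigO_a1
  obtain ⟨c0, hc0⟩ := isBigO_top.mp D.isBigO_a0
  simp only [norm_one, mul_one] at hc0 hc1
  have hm := D.continuous_pow_mul_normFactor
  have hmb := D.pow_mul_normFactor_le
  obtain ⟨M0, hM0⟩ := exists_clm_mul (hm 0) (hmb 0 (by norm_num))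
  obtain ⟨M1, hM1⟩ := exists_clm_mul (hm 1) (hmb 1 (by norm_num))
  obtain ⟨M2, hM2⟩ := exists_clm_mul (hm 2) (hmb 2 (by norm_num))
  have k0 : Continuous fun x => starRingEnd ℂ (D.a0 x) := Complex.continuous_conj.comp D.continuous_a0
  have k1 : Continuous fun x => starRingEnd ℂ (D.a1 x) := Complex.continuous_conj.comp D.continuous_a1
  have b0 : ∀ x, ‖starRingEnd ℂ (D.a0 x)‖ ≤ c0 := fun x => by rw [RCLike.norm_conj]; exact hc0 x
  have b1 : ∀ x, ‖starRingEnd ℂ (D.a1 x)‖ ≤ c1 := fun x => by rw [RCLike.norm_conj]; exact hc1 x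
  obtain ⟨A0, hA0⟩ := exists_clm_mul k0 b0
  obtain ⟨A1, hA1⟩ := exists_clm_mul k1 b1
  refine ⟨M2 ∘L T + M1 ∘L T ∘L A1 + M0 ∘L T ∘L A0, fun f h1 h2 => ?_⟩
  have i0 : Integrable fun x : ℝ => starRingEnd ℂ (D.a0 x) * f x :=
    h1.bdd_mul k0.aestronglyMeasurable (Eventually.of_forall b0)
  have i1 : Integrable fun x : ℝ => starRingEnd ℂ (D.a1 x) * f x :=
    h1.bdd_mul k1.aestronglyMeasurable (Eventually.of_forall b1)
  have e0 := hT _ i0 (memLp_mul_of_bound k0 b0 h2)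
  have e1 := hT _ i1 (memLp_mul_of_bound k1 b1 h2)
  have e2 := hT _ h1 h2
  simp only [add_apply, ContinuousLinearMap.comp_apply,
    clm_mul_toLp k0 b0 hA0 h2, clm_mul_toLp k1 b1 hA1 h2]
  filter_upwards [e0, e1, e2, Lp.coeFn_add (M2 (T (h2.toLp f))
    + M1 (T ((memLp_mul_of_bound k1 b1 h2).toLp _)))
    (M0 (T ((memLp_mul_of_bound k0 b0 h2).toLp _))),
    Lp.coeFn_add (M2 (T (h2.toLp f)))
    (M1 (T ((memLp_mul_of_bound k1 b1 h2).toLp _))), hM0 (T ((memLp_mul_of_bound k0 b0 h2).toLp _)),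
    hM1 (T ((memLp_mul_of_bound k1 b1 h2).toLp _)), hM2 (T (h2.toLp f))]
    with l e0 e1 e2 s1 s2 t0 t1 t2
  rw [s1, Pi.add_apply, s2, Pi.add_apply, t0, t1, t2, e0, e1, e2]
  have ie : ∀ g : ℝ → ℂ, Integrable g → Integrable fun x : ℝ =>
      Complex.exp (-(2 * Complex.I * ((-1 : ℝ) : ℂ) * x * l)) * g x := fun g hg =>
    hg.bdd_mul (c := 1) (by fun_prop) (Eventually.of_forall fun x => by
      have := norm_cexp_mode (-x) l
      refine le_of_eq (Eq.trans ?_ this)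
      congr 2; push_cast; ring)
  have ec : ∀ x : ℝ, starRingEnd ℂ (D.a x l) = ((l : ℂ) ^ 2 + starRingEnd ℂ (D.a1 x) * l
      + starRingEnd ℂ (D.a0 x)) * Complex.exp (-(2 * Complex.I * ((-1 : ℝ) : ℂ) * x * l)) := by
    intro x
    simp only [a, map_mul, map_add, map_pow, Complex.conj_ofReal, ← Complex.exp_conj, map_neg,
      Complex.conj_I, map_ofNat]
    congr 2; push_cast; ring
  have hsum : ∫ x : ℝ, starRingEnd ℂ (D.a x l) * f x
      = (l : ℂ) ^ 2 * (∫ x : ℝ, Complex.exp (-(2 * Complex.I * ((-1 : ℝ) : ℂ) * x * l)) * f x)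
        + l * (∫ x : ℝ, Complex.exp (-(2 * Complex.I * ((-1 : ℝ) : ℂ) * x * l)) *
            (starRingEnd ℂ (D.a1 x) * f x))
        + ∫ x : ℝ, Complex.exp (-(2 * Complex.I * ((-1 : ℝ) : ℂ) * x * l)) *
            (starRingEnd ℂ (D.a0 x) * f x) := by
    have j1 := (ie _ h1).const_mul ((l : ℂ) ^ 2)
    have j2 := (ie _ i1).const_mul (l : ℂ)
    have j3 := j1.fun_add j2
    rw [← integral_const_mul, ← integral_const_mul, ← integral_add j1 j2,
      ← integral_add j3 (ie _ i0)]
    refine integral_congr_ae (Eventually.of_forall fun x => ?_)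
    simp only [ec]; ring
  rw [hsum]; ring

end Data
end TwoSoliton

/-! ### Orthogonality relations, proved on Schwartz functions -/

namespace TwoSoliton

open scoped FourierTransform ENNReal NNReal ContDiff

/-- The Schwartz function `x ↦ ∫ e^{-2iλx} χ(λ) dλ`. -/
def modeFourier (χ : SchwartzMap ℝ ℂ) : SchwartzMap ℝ ℂ :=
  SchwartzMap.compCLMOfContinuousLinearEquiv ℂ
    (ContinuousLinearEquiv.unitsEquivAut ℝ (Units.mk0 (Real.pi⁻¹) (by positivity))) (𝓕 χ)

lemma modeFourier_eq_fourier (χ : SchwartzMap ℝ ℂ) (x : ℝ) :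
    modeFourier χ x = 𝓕 (χ : ℝ → ℂ) (x * Real.pi⁻¹) := by
  rw [← SchwartzMap.fourier_coe]; rfl

lemma modeFourier_apply (χ : SchwartzMap ℝ ℂ) (x : ℝ) :
    modeFourier χ x = ∫ l : ℝ, Complex.exp (-(2 * Complex.I * l * x)) * χ l := by
  rw [modeFourier_eq_fourier, Real.fourier_real_eq_integral_exp_smul]
  refine integral_congr_ae (Eventually.of_forall fun l => ?_)
  simp only [smul_eq_mul]
  congr 2
  push_cast
  have : (Real.pi : ℂ) ≠ 0 := by exact_mod_cast Real.pi_ne_zero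
  field_simp

/-- Fourier inversion; the factor π is the Jacobian of the scaling by π⁻¹ hidden in the kernel
e^{-2iλx}. -/
lemma integral_exp_mul_modeFourier (χ : SchwartzMap ℝ ℂ) (l : ℝ) :
    ∫ x : ℝ, Complex.exp (2 * Complex.I * l * x) * modeFourier χ x = Real.pi * χ l := by
  have h := Measure.integral_comp_mul_right
    (fun y : ℝ => Complex.exp (2 * Complex.I * l * (Real.pi * y)) * 𝓕 (χ : ℝ → ℂ) y) (Real.pi⁻¹)
  have e : ∀ x : ℝ, Complex.exp (2 * Complex.I * l * x) * modeFourier χ x =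
      Complex.exp (2 * Complex.I * l * (Real.pi * ((x * Real.pi⁻¹ : ℝ) : ℂ)))
        * 𝓕 (χ : ℝ → ℂ) (x * Real.pi⁻¹) := by
    intro x
    rw [modeFourier_eq_fourier]
    congr 2
    push_cast
    have : (Real.pi : ℂ) ≠ 0 := by exact_mod_cast Real.pi_ne_zero
    field_simp
  simp only [e]
  rw [h, inv_inv, abs_of_pos Real.pi_pos, Complex.real_smul]
  congr 1
  have h2 : 𝓕⁻ (𝓕 χ) l = χ l := by rw [FourierTransform.fourierInv_fourier_eq]
  rw [SchwartzMap.fourierInv_coe, SchwartzMap.fourier_coe, Real.fourierInv_eq'] at h2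
  rw [← h2]
  refine integral_congr_ae (Eventually.of_forall fun y => ?_)
  simp only [smul_eq_mul, RCLike.inner_apply, conj_trivial]
  congr 2
  push_cast
  ring

lemma integrable_pow_mul_schwartz (j : ℕ) (χ : SchwartzMap ℝ ℂ) :
    Integrable fun l : ℝ => (l : ℂ) ^ j * χ l := by
  have h : (fun l : ℝ => l ^ j).HasTemperateGrowth := by fun_prop
  have := (SchwartzMap.smulLeftCLM ℂ (fun l : ℝ => l ^ j) χ).integrable (μ := volume)
  refine this.congr (Eventually.of_forall fun l => ?_)
  rw [SchwartzMap.smulLeftCLM_apply_apply h, Complex.real_smul]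
  push_cast; rfl

lemma hasDerivAt_integral_cexp {f : ℝ → ℂ} (hf : Integrable f)
    (hf' : Integrable fun l : ℝ => (l : ℂ) * f l) (x : ℝ) :
    HasDerivAt (fun x : ℝ => ∫ l : ℝ, Complex.exp (-(2 * Complex.I * l * x)) * f l)
      (-(2 * Complex.I) * ∫ l : ℝ, Complex.exp (-(2 * Complex.I * l * x)) * (l * f l)) x := by
  have hb : ∀ (g : ℝ → ℂ) (x : ℝ), Integrable g → Integrable fun l : ℝ =>
      Complex.exp (-(2 * Complex.I * l * x)) * g l := fun g x hg =>
    hg.bdd_mul (c := 1) (Continuous.aestronglyMeasurable (by fun_prop)) (Eventually.of_forall fun l => (Data.norm_cexp_mode l x).le)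
  have := hasDerivAt_integral_of_dominated_loc_of_deriv_le (μ := volume) (s := Set.univ) (x₀ := x)
    (F := fun (x : ℝ) (l : ℝ) => Complex.exp (-(2 * Complex.I * l * x)) * f l)
    (F' := fun (x : ℝ) (l : ℝ) => -(2 * Complex.I) * (Complex.exp (-(2 * Complex.I * l * x)) * (l * f l)))
    (bound := fun l : ℝ => 2 * ‖(l : ℂ) * f l‖) univ_mem
    (Eventually.of_forall fun x => (hb f x hf).aestronglyMeasurable) (hb f x hf)
    ((hb _ x hf').const_mul _).aestronglyMeasurable
    (Eventually.of_forall fun l y _ => by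
      rw [norm_mul, norm_mul, Data.norm_cexp_mode, one_mul, norm_neg, norm_mul, Complex.norm_I]
      simp)
    (hf'.norm.const_mul 2)
    (Eventually.of_forall fun l y _ => by
      refine ((Data.hasDerivAt_cexp l y).mul_const (f l)).congr_deriv ?_
      ring)
  rw [integral_const_mul] at this
  exact this.2

namespace Data

variable (D : Data)

open Asymptotics

/-- P may be applied under the integral sign and turns each e^{-2iλx} into a(x,λ). Synthesis of a
Schwartz function is therefore P applied to a Schwartz function, to which the integration by parts
applies. -/
lemma darboux_modeFourier (χ : SchwartzMap ℝ ℂ) (x : ℝ) :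
    D.darboux (modeFourier χ) x = ∫ l : ℝ, χ l * D.a x l := by
  have i0 : Integrable fun l : ℝ => χ l := χ.integrable
  have i1 : Integrable fun l : ℝ => (l : ℂ) * χ l := by
    simpa using integrable_pow_mul_schwartz 1 χ
  have i2 : Integrable fun l : ℝ => (l : ℂ) * (l * χ l) := by
    refine (integrable_pow_mul_schwartz 2 χ).congr (Eventually.of_forall fun l => ?_)
    simp only; ring
  have e0 : (modeFourier χ : ℝ → ℂ) = fun x : ℝ =>
      ∫ l : ℝ, Complex.exp (-(2 * Complex.I * l * x)) * χ l := funext (modeFourier_apply χ)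
  have e1 : deriv (modeFourier χ) = fun x : ℝ =>
      -(2 * Complex.I) * ∫ l : ℝ, Complex.exp (-(2 * Complex.I * l * x)) * (l * χ l) := by
    rw [e0]; funext x; exact (hasDerivAt_integral_cexp i0 i1 x).deriv
  have e2 : deriv (deriv (modeFourier χ)) x =
      -(2 * Complex.I) * (-(2 * Complex.I) *
        ∫ l : ℝ, Complex.exp (-(2 * Complex.I * l * x)) * (l * (l * χ l))) := by
    rw [e1]
    exact ((hasDerivAt_integral_cexp i1 i2 x).const_mul (-(2 * Complex.I))).deriv
  have hb : ∀ g : ℝ → ℂ, Integrable g → Integrable fun l : ℝ =>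
      Complex.exp (-(2 * Complex.I * l * x)) * g l := fun g hg =>
    hg.bdd_mul (c := 1) (Continuous.aestronglyMeasurable (by fun_prop)) (Eventually.of_forall fun l => (norm_cexp_mode l x).le)
  have es : ∫ l : ℝ, χ l * D.a x l
      = (∫ l : ℝ, Complex.exp (-(2 * Complex.I * l * x)) * (l * (l * χ l)))
        + D.a1 x * (∫ l : ℝ, Complex.exp (-(2 * Complex.I * l * x)) * (l * χ l))
        + D.a0 x * ∫ l : ℝ, Complex.exp (-(2 * Complex.I * l * x)) * χ l := by
    have j2 := (hb _ i1).const_mul (D.a1 x)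
    have j3 := (hb _ i2).fun_add j2
    rw [← integral_const_mul, ← integral_const_mul, ← integral_add (hb _ i2) j2,
      ← integral_add j3 ((hb _ i0).const_mul _)]
    refine integral_congr_ae (Eventually.of_forall fun l => ?_)
    simp only [a]; ring
  rw [darboux, e2, e1, e0, es]
  linear_combination (-(∫ l : ℝ, Complex.exp (-(2 * Complex.I * l * x)) * (l * (l * χ l)))
    - D.a1 x * ∫ l : ℝ, Complex.exp (-(2 * Complex.I * l * x)) * (l * χ l)) * Complex.I_sq

lemma integrable_darboux (φ : SchwartzMap ℝ ℂ) : Integrable (D.darboux φ) := by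
  obtain ⟨c1, hc1⟩ := isBigO_top.mp D.isBigO_a1
  obtain ⟨c0, hc0⟩ := isBigO_top.mp D.isBigO_a0
  simp only [norm_one, mul_one] at hc0 hc1
  set ψ := SchwartzMap.derivCLM ℂ ℂ φ with hψ
  set χ := SchwartzMap.derivCLM ℂ ℂ ψ with hχ
  have e1 : deriv φ = ψ := by funext x; exact (SchwartzMap.derivCLM_apply ℂ φ x).symm
  have e2 : deriv (deriv φ) = χ := by
    rw [e1]; funext x; exact (SchwartzMap.derivCLM_apply ℂ ψ x).symm
  have := D.continuous_a1
  unfold darboux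
  rw [e2, e1]
  refine ((χ.integrable.neg.div_const 4).add ?_).add ?_
  · exact ψ.integrable.bdd_mul (c := ‖Complex.I / 2‖ * c1) (by fun_prop)
      (Eventually.of_forall fun x => by
        rw [norm_mul]; exact mul_le_mul_of_nonneg_left (hc1 x) (norm_nonneg _))
  · exact φ.integrable.bdd_mul (c := c0) D.continuous_a0.aestronglyMeasurable
      (Eventually.of_forall hc0)

/-- A Schwartz function divided by the symbol's square root. -/
def weighted (B : SchwartzMap ℝ ℂ) : SchwartzMap ℝ ℂ :=
  SchwartzMap.smulLeftCLM ℂ D.normFactor B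

lemma weighted_apply (B : SchwartzMap ℝ ℂ) (l : ℝ) : D.weighted B l = D.normFactor l * B l := by
  rw [weighted, SchwartzMap.smulLeftCLM_apply_apply D.hasTemperateGrowth_normFactor,
    Complex.real_smul]

/-- The synthesis operator `S B = ∫ B(λ) a(·,λ) n(λ) dλ` and the analysis operator
`C f = n(λ) ∫ conj a(x,λ) f(x) dx`, their orthogonality relation, and the orthogonality of the range
of `S` to the bound states. -/
theorem exists_synthesis_analysis :
    ∃ S C : Lp ℂ 2 (volume : Measure ℝ) →L[ℂ] Lp ℂ 2 (volume : Measure ℝ),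
      (∀ (f : ℝ → ℂ) (_ : Integrable f) (h2 : MemLp f 2), S (h2.toLp f) =ᵐ[volume]
        fun x => ∫ l : ℝ, f l * (D.a x l * D.normFactor l)) ∧
      (∀ (f : ℝ → ℂ) (_ : Integrable f) (h2 : MemLp f 2), C (h2.toLp f) =ᵐ[volume]
        fun l => D.normFactor l * ∫ x : ℝ, starRingEnd ℂ (D.a x l) * f x) ∧
      (∀ B, C (S B) = (1 / 2 : ℂ) • B) ∧
      ∀ p B, ∫ x, starRingEnd ℂ (D.boundMode p x) * S B x = 0 := by
  obtain ⟨S, hS⟩ := D.exists_synthesis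
  obtain ⟨C, hC⟩ := D.exists_analysis
  have hSB : ∀ B : SchwartzMap ℝ ℂ, S (B.toLp 2) =ᵐ[volume]
      D.darboux (modeFourier (D.weighted B)) := fun B => by
    refine (hS B (B.integrable (μ := volume)) (B.memLp 2 volume)).trans (Eventually.of_forall fun x => ?_)
    simp only [darboux_modeFourier, weighted_apply]
    refine integral_congr_ae (Eventually.of_forall fun l => ?_)
    simp only; ring
  refine ⟨S, C, hS, hC, fun B => ?_, fun p B => ?_⟩
  · refine DenseRange.induction_on (p := fun B => C (S B) = (1 / 2 : ℂ) • B)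
      (SchwartzMap.denseRange_toLpCLM (p := 2) ENNReal.ofNat_ne_top) B ?_ fun B => ?_
    · exact isClosed_eq (C.comp S).continuous (continuous_const_smul _)
    · have h2 : MemLp (D.darboux (modeFourier (D.weighted B))) 2 :=
        (memLp_congr_ae (hSB B)).mp (Lp.memLp _)
      have e : S (B.toLp 2) = h2.toLp _ := Lp.ext ((hSB B).trans h2.coeFn_toLp.symm)
      change C (S (B.toLp 2)) = (1 / 2 : ℂ) • B.toLp 2 volume
      rw [e]
      refine Lp.ext ((hC _ (D.integrable_darboux _) h2).trans ?_)
      filter_upwards [Lp.coeFn_smul (1 / 2 : ℂ) (B.toLp 2), B.coeFn_toLp 2] with l h3 h4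
      rw [h3, Pi.smul_apply, h4, integral_conj_a_mul_darboux]
      have e2 : ∀ x : ℝ, starRingEnd ℂ (D.symbol l * Complex.exp (-(2 * Complex.I * l * x)))
          * modeFourier (D.weighted B) x =
          D.symbol l * (Complex.exp (2 * Complex.I * l * x) * modeFourier (D.weighted B) x) := by
        intro x
        have : starRingEnd ℂ (D.symbol l) = D.symbol l := by
          simp [symbol, Complex.conj_ofReal]
        rw [map_mul, this, ← Complex.exp_conj, mul_assoc]
        congr 3
        simp only [map_neg, map_mul, Complex.conj_ofReal, Complex.conj_I, map_ofNat]
        ring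
      simp only [e2]
      rw [integral_const_mul, integral_exp_mul_modeFourier, weighted_apply]
      -- The symbol produced by P*P cancels against the squared normalization; the π of Fourier
      -- inversion over the remaining 2π leaves 1/2.
      have h5 : (D.normFactor l : ℂ) ^ 2 * (2 * Real.pi * D.symbol l) = 1 := by
        have h6 := D.normFactor_sq l
        have h7 := D.symbol_pos l
        rw [eq_div_iff (by positivity)] at h6
        rw [symbol]
        exact_mod_cast h6
      rw [smul_eq_mul]
      linear_combination (1 / 2 * B l) * h5
  · have hi : ∀ B : Lp ℂ 2 (volume : Measure ℝ), ∫ x, starRingEnd ℂ (D.boundMode p x) * S B x =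
        inner ℂ ((D.memLp_boundMode p).toLp _) (S B) := fun B => by
      rw [L2.inner_def]
      refine integral_congr_ae ?_
      filter_upwards [(D.memLp_boundMode p).coeFn_toLp] with x hx
      rw [hx, RCLike.inner_apply, mul_comm]
    refine DenseRange.induction_on
      (p := fun B => ∫ x, starRingEnd ℂ (D.boundMode p x) * S B x = 0)
      (SchwartzMap.denseRange_toLpCLM (p := 2) ENNReal.ofNat_ne_top) B ?_ fun B => ?_
    · simp only [hi]
      exact isClosed_eq (continuous_const.inner S.continuous) continuous_const
    · change ∫ x, starRingEnd ℂ (D.boundMode p x) * S (B.toLp 2) x = 0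
      obtain ⟨A, A', hA⟩ := D.exists_boundMode_eq p
      set φ := modeFourier (D.weighted B)
      have z1 := D.integral_conj_a_mul_darboux_eq_zero D.symbol_neg_I_mul_ρ₁ D.isBigO_envelope_ρ₁ φ
      have z2 := D.integral_conj_a_mul_darboux_eq_zero D.symbol_neg_I_mul_ρ₂ D.isBigO_envelope_ρ₂ φ
      have hint : ∀ l : ℂ, (fun x => D.a x l) =O[⊤] D.envelope →
          Integrable fun x => starRingEnd ℂ (D.a x l) * D.darboux φ x := fun l hl => by
        obtain ⟨c, hc⟩ := isBigO_top.mp (hl.trans D.isBigO_envelope_one)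
        refine (D.integrable_darboux φ).bdd_mul (c := c)
          (Complex.continuous_conj.comp (D.continuous_a l)).aestronglyMeasurable
          (Eventually.of_forall fun x => ?_)
        simpa using hc x
      calc ∫ x, starRingEnd ℂ (D.boundMode p x) * S (B.toLp 2) x
          = ∫ x, (starRingEnd ℂ A * (starRingEnd ℂ (D.a x (-(Complex.I * D.ρ₁))) * D.darboux φ x)
            + starRingEnd ℂ A' * (starRingEnd ℂ (D.a x (-(Complex.I * D.ρ₂))) * D.darboux φ x)) := by
            refine integral_congr_ae ?_
            filter_upwards [hSB B] with x hx
            rw [hx, hA, map_add, map_mul, map_mul]; ring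
        _ = 0 := by
            rw [integral_add ((hint _ D.isBigO_envelope_ρ₁.1).const_mul _)
              ((hint _ D.isBigO_envelope_ρ₂.1).const_mul _), integral_const_mul, integral_const_mul,
              z1, z2]
            simp

end Data
end TwoSoliton

/-! ### L² limits, parity extensions, and the transforms of the definitions as operators -/

namespace TwoSoliton

open scoped ENNReal NNReal

lemma tendsto_eLpNorm_two_of_dominated {α ι : Type*} [MeasurableSpace α] {ν : Measure α}
    {l : Filter ι} [l.IsCountablyGenerated]
    {F : ι → α → ℂ} {bound : α → ℝ} (hb : MemLp bound 2 ν)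
    (hm : ∀ᶠ i in l, AEStronglyMeasurable (F i) ν) (h : ∀ᶠ i in l, ∀ᵐ x ∂ν, ‖F i x‖ ≤ bound x)
    (hlim : ∀ᵐ x ∂ν, Tendsto (fun i => F i x) l (𝓝 0)) :
    Tendsto (fun i => eLpNorm (F i) 2 ν) l (𝓝 0) := by
  have h2 : Tendsto (fun i => ∫ x, ‖F i x‖ ^ (2 : ℝ) ∂ν) l (𝓝 (∫ _, 0 ∂ν)) := by
    refine tendsto_integral_filter_of_dominated_convergence (fun x => ‖bound x‖ ^ (2 : ℝ))
      (hm.mono fun i hi => (hi.norm.aemeasurable.pow_const 2).aestronglyMeasurable)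
      (h.mono fun i hi => ?_) ?_ ?_
    · filter_upwards [hi] with x hx
      rw [Real.norm_of_nonneg (by positivity)]
      exact Real.rpow_le_rpow (norm_nonneg _) (hx.trans (le_abs_self _)) zero_le_two
    · simpa using hb.integrable_norm_rpow two_ne_zero ENNReal.ofNat_ne_top
    · filter_upwards [hlim] with x hx
      have := (Real.continuous_rpow_const (q := 2) zero_le_two).continuousAt.tendsto.comp hx.norm
      simpa [Function.comp_def] using this
  have h3 : ∀ᶠ i in l, ENNReal.ofReal ((∫ x, ‖F i x‖ ^ (2 : ℝ) ∂ν) ^ (2 : ℝ)⁻¹)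
      = eLpNorm (F i) 2 ν := by
    filter_upwards [hm, h] with i hi1 hi2
    have : MemLp (F i) 2 ν := hb.of_le hi1 (hi2.mono fun x hx => hx.trans (le_abs_self _))
    rw [this.eLpNorm_eq_integral_rpow_norm two_ne_zero ENNReal.ofNat_ne_top]
    simp
  refine Tendsto.congr' h3 ?_
  have := (ENNReal.continuous_ofReal.comp
    (Real.continuous_rpow_const (q := (2 : ℝ)⁻¹) (by norm_num))).continuousAt.tendsto.comp h2
  simpa [Function.comp_def] using this

lemma tendsto_eLpNorm_indicator_Ioc {f : ℝ → ℂ} (hf : MemLp f 2) :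
    Tendsto (fun R : ℝ => eLpNorm ((Set.Ioc (-R) R).indicator f - f) 2 volume) atTop (𝓝 0) := by
  refine tendsto_eLpNorm_two_of_dominated (bound := fun x => ‖f x‖) hf.norm
    (Eventually.of_forall fun R => (hf.1.indicator measurableSet_Ioc).sub hf.1)
    (Eventually.of_forall fun R => Eventually.of_forall fun x => ?_)
    (Eventually.of_forall fun x => ?_)
  · by_cases hx : x ∈ Set.Ioc (-R) R <;> simp [hx]
  · refine tendsto_const_nhds.congr' ?_
    filter_upwards [eventually_gt_atTop |x|] with R hR
    have : x ∈ Set.Ioc (-R) R := ⟨(abs_lt.mp hR).1, (abs_lt.mp hR).2.le⟩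
    simp [this]

/-- The sign attached to a parity. -/
def Parity.sgn : Parity → ℂ
  | .even => 1
  | .odd => -1

lemma Parity.sgn_mul_self (p : Parity) : p.sgn * p.sgn = 1 := by cases p <;> simp [Parity.sgn]

lemma Parity.norm_sgn (p : Parity) : ‖p.sgn‖ = 1 := by cases p <;> simp [Parity.sgn]

/-- `f(λ) ± f(-λ)`. -/
def symm (p : Parity) (f : ℝ → ℂ) (l : ℝ) : ℂ := f l + p.sgn * f (-l)

lemma ae_comp_neg {f g : ℝ → ℂ} (h : f =ᵐ[volume] g) :
    (fun l => f (-l)) =ᵐ[volume] fun l => g (-l) :=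
  (Measure.measurePreserving_neg (volume : Measure ℝ)).quasiMeasurePreserving.ae_eq h

lemma symm_congr (p : Parity) {f g : ℝ → ℂ} (h : f =ᵐ[volume] g) :
    symm p f =ᵐ[volume] symm p g := by
  filter_upwards [h, ae_comp_neg h] with l h1 h2
  simp only [symm, h1, h2]

lemma eLpNorm_symm_le (p : Parity) {f : ℝ → ℂ} (hf : AEStronglyMeasurable f volume) :
    eLpNorm (symm p f) 2 volume ≤ 2 * eLpNorm f 2 volume := by
  have hn := Measure.measurePreserving_neg (volume : Measure ℝ)
  have h1 : AEStronglyMeasurable (f ∘ Neg.neg) volume := hf.comp_measurePreserving hn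
  have h2 : symm p f = f + p.sgn • (f ∘ Neg.neg) := by funext l; simp [symm]
  rw [h2]
  refine (eLpNorm_add_le hf (h1.const_smul _) (by norm_num)).trans ?_
  rw [eLpNorm_const_smul, eLpNorm_comp_measurePreserving hf hn, two_mul]
  have : ‖p.sgn‖ₑ = 1 := by rw [← ofReal_norm, p.norm_sgn]; simp
  rw [this, one_mul]

lemma memLp_symm (p : Parity) {f : ℝ → ℂ} (hf : MemLp f 2) : MemLp (symm p f) 2 := by
  refine ⟨?_, (eLpNorm_symm_le p hf.1).trans_lt (ENNReal.mul_lt_top (by simp) hf.2)⟩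
  exact hf.1.add ((hf.1.comp_measurePreserving
    (Measure.measurePreserving_neg (volume : Measure ℝ))).const_mul _)

lemma symm_sub (p : Parity) (f g : ℝ → ℂ) : symm p (f - g) = symm p f - symm p g := by
  funext l; simp only [symm, Pi.sub_apply]; ring

lemma tendsto_eLpNorm_symm (p : Parity) {ι : Type*} {l : Filter ι} {F : ι → ℝ → ℂ} {f : ℝ → ℂ}
    (hF : ∀ i, AEStronglyMeasurable (F i) volume) (hf : AEStronglyMeasurable f volume)
    (h : Tendsto (fun i => eLpNorm (F i - f) 2 volume) l (𝓝 0)) :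
    Tendsto (fun i => eLpNorm (symm p (F i) - symm p f) 2 volume) l (𝓝 0) := by
  refine tendsto_of_tendsto_of_tendsto_of_le_of_le tendsto_const_nhds
    (h := fun i => 2 * eLpNorm (F i - f) 2 volume) ?_ (fun i => bot_le) (fun i => ?_)
  · simpa using ENNReal.Tendsto.const_mul h (Or.inr (by simp : (2 : ℝ≥0∞) ≠ ⊤))
  · simp only; rw [← symm_sub]; exact eLpNorm_symm_le p ((hF i).sub hf)

/-- The even or odd extension of a function on the half-line. -/
def extend (p : Parity) (A : ℝ → ℂ) : ℝ → ℂ := symm p ((Set.Ioi 0).indicator A)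

lemma memLp_indicator_Ioi {A : ℝ → ℂ} (hA : MemLp A 2 (volume.restrict (Set.Ioi 0))) :
    MemLp ((Set.Ioi 0).indicator A) 2 := (memLp_indicator_iff_restrict measurableSet_Ioi).mpr hA

lemma memLp_extend (p : Parity) {A : ℝ → ℂ} (hA : MemLp A 2 (volume.restrict (Set.Ioi 0))) :
    MemLp (extend p A) 2 := memLp_symm p (memLp_indicator_Ioi hA)

lemma extend_congr (p : Parity) {A B : ℝ → ℂ} (h : A =ᵐ[volume.restrict (Set.Ioi 0)] B) :
    extend p A =ᵐ[volume] extend p B :=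
  symm_congr p ((ae_eq_restrict_iff_indicator_ae_eq measurableSet_Ioi).mp h)

lemma extend_of_pos (p : Parity) (A : ℝ → ℂ) {l : ℝ} (hl : 0 < l) : extend p A l = A l := by
  have : ¬ (0 < -l) := by linarith
  simp [extend, symm, hl, hl.le]

lemma extend_neg_of_pos (p : Parity) (A : ℝ → ℂ) {l : ℝ} (hl : 0 < l) :
    extend p A (-l) = p.sgn * A l := by
  simp [extend, symm, hl, hl.le]

/-- Uniqueness of L² limits, which makes the coefficient and the mode sum of the definitions
determined up to null sets. -/
lemma ae_eq_of_tendsto_eLpNorm {α ι : Type*} [MeasurableSpace α] {ν : Measure α} {l : Filter ι}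
    [l.NeBot] {F : ι → α → ℂ} {f g : α → ℂ} (hF : ∀ᶠ i in l, AEStronglyMeasurable (F i) ν)
    (hf : AEStronglyMeasurable f ν) (hg : AEStronglyMeasurable g ν)
    (h1 : Tendsto (fun i => eLpNorm (F i - f) 2 ν) l (𝓝 0))
    (h2 : Tendsto (fun i => eLpNorm (F i - g) 2 ν) l (𝓝 0)) : f =ᵐ[ν] g := by
  have h3 : eLpNorm (f - g) 2 ν ≤ 0 := by
    refine ge_of_tendsto (by simpa using h1.add h2) (hF.mono fun i hi => ?_)
    have e : f - g = (F i - g) - (F i - f) := by abel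
    rw [e, add_comm]
    exact eLpNorm_sub_le (hi.sub hg) (hi.sub hf) (by norm_num)
  have h4 := (eLpNorm_eq_zero_iff (hf.sub hg) two_ne_zero).mp (le_antisymm h3 bot_le)
  filter_upwards [h4] with x hx
  exact sub_eq_zero.mp hx

namespace Data

variable (D : Data)

/-- The synthesis operator `B ↦ ∫ B(λ) a(·,λ) n(λ) dλ` on `L²`. -/
def synthesis : Lp ℂ 2 (volume : Measure ℝ) →L[ℂ] Lp ℂ 2 (volume : Measure ℝ) :=
  D.exists_synthesis_analysis.choose

/-- The analysis operator `f ↦ n(λ) ∫ conj a(x,λ) f(x) dx` on `L²`. -/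
def analysis : Lp ℂ 2 (volume : Measure ℝ) →L[ℂ] Lp ℂ 2 (volume : Measure ℝ) :=
  D.exists_synthesis_analysis.choose_spec.choose

lemma synthesis_toLp {f : ℝ → ℂ} (h1 : Integrable f) (h2 : MemLp f 2) :
    D.synthesis (h2.toLp f) =ᵐ[volume] fun x => ∫ l : ℝ, f l * (D.a x l * D.normFactor l) :=
  D.exists_synthesis_analysis.choose_spec.choose_spec.1 f h1 h2

lemma analysis_toLp {f : ℝ → ℂ} (h1 : Integrable f) (h2 : MemLp f 2) :
    D.analysis (h2.toLp f) =ᵐ[volume]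
      fun l => D.normFactor l * ∫ x : ℝ, starRingEnd ℂ (D.a x l) * f x :=
  D.exists_synthesis_analysis.choose_spec.choose_spec.2.1 f h1 h2

lemma analysis_synthesis (B : Lp ℂ 2 (volume : Measure ℝ)) :
    D.analysis (D.synthesis B) = (1 / 2 : ℂ) • B :=
  D.exists_synthesis_analysis.choose_spec.choose_spec.2.2.1 B

lemma boundCoeff_synthesis (p : Parity) (B : Lp ℂ 2 (volume : Measure ℝ)) :
    D.boundCoeff p (D.synthesis B) = 0 :=
  D.exists_synthesis_analysis.choose_spec.choose_spec.2.2.2 p B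

lemma contMode_eq (p : Parity) (x l : ℝ) :
    D.contMode p x l = (D.a x l + p.sgn * D.a x ((-l : ℝ) : ℂ)) * D.normFactor l := by
  cases p
  · rw [contMode_even, Parity.sgn, one_mul, Complex.ofReal_neg]
  · rw [contMode_odd, Parity.sgn, Complex.ofReal_neg]; ring

/-- `⟨Ψ_d(·,λ), f⟩` for `f ∈ L²`. -/
def modeCoeff (p : Parity) {f : ℝ → ℂ} (hf : MemLp f 2) : ℝ → ℂ :=
  symm p (D.analysis (hf.toLp f))

/-- `∫₀^∞ A(λ) Ψ_d(·,λ) dλ` for `A ∈ L²(0,∞)`. -/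
def modeSum (p : Parity) {A : ℝ → ℂ} (hA : MemLp A 2 (volume.restrict (Set.Ioi 0))) : ℝ → ℂ :=
  D.synthesis ((memLp_extend p hA).toLp _)

lemma memLp_modeSum (p : Parity) {A : ℝ → ℂ} (hA : MemLp A 2 (volume.restrict (Set.Ioi 0))) :
    MemLp (D.modeSum p hA) 2 := Lp.memLp _

lemma memLp_modeCoeff (p : Parity) {f : ℝ → ℂ} (hf : MemLp f 2) : MemLp (D.modeCoeff p hf) 2 :=
  memLp_symm p (Lp.memLp _)

lemma integrable_indicator_Ioc {f : ℝ → ℂ} (hf : MemLp f 2) (R : ℝ) :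
    Integrable ((Set.Ioc (-R) R).indicator f) := by
  rw [integrable_indicator_iff measurableSet_Ioc]
  have : IsFiniteMeasure (volume.restrict (Set.Ioc (-R) R)) :=
    ⟨by simp⟩
  exact (hf.restrict _).integrable (by norm_num)

/-- The normalization is even in λ, so pairing with the even or odd mode is symmetrizing the pairing
with a(·,λ). -/
lemma integral_conj_contMode_mul (p : Parity) (f : ℝ → ℂ) (hf : Integrable f) (l : ℝ) :
    ∫ x, starRingEnd ℂ (D.contMode p x l) * f x =
      symm p (fun l => D.normFactor l * ∫ x : ℝ, starRingEnd ℂ (D.a x l) * f x) l := by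
  have hi : ∀ l : ℝ, Integrable fun x => starRingEnd ℂ (D.a x l) * f x := fun l => by
    obtain ⟨c, hc⟩ := Asymptotics.isBigO_top.mp (D.isBigO_a l)
    refine hf.bdd_mul (c := c) (Complex.continuous_conj.comp (D.continuous_a l)).aestronglyMeasurable
      (Eventually.of_forall fun x => ?_)
    simpa using hc x
  have hs : starRingEnd ℂ p.sgn = p.sgn := by cases p <;> simp [Parity.sgn]
  simp only [symm]
  rw [normFactor_neg, ← integral_const_mul, ← integral_const_mul, ← integral_const_mul,
    ← integral_add ((hi l).const_mul _) (((hi (-l)).const_mul _).const_mul _)]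
  refine integral_congr_ae (Eventually.of_forall fun x => ?_)
  simp only [contMode_eq, map_mul, map_add, hs, Complex.conj_ofReal]
  ring

/-- The truncations of f to (-R,R] are integrable and converge to f in L², so continuity of the
analysis operator transports the limit. The measurability clause is what uniqueness of the limit
requires. -/
lemma isModeCoeff_modeCoeff (p : Parity) {f : ℝ → ℂ} (hf : MemLp f 2) :
    D.IsModeCoeff p f (D.modeCoeff p hf) ∧ ∀ᶠ R : ℝ in atTop, AEStronglyMeasurable
      (fun l => ∫ x in (-R)..R, starRingEnd ℂ (D.contMode p x l) * f x)
        (volume.restrict (Set.Ioi 0)) := by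
  set F : ℝ → ℝ → ℂ := fun R => (Set.Ioc (-R) R).indicator f with hF
  have hFm : ∀ R, MemLp (F R) 2 := fun R => hf.indicator measurableSet_Ioc
  have hFi : ∀ R, Integrable (F R) := integrable_indicator_Ioc hf
  have ht : Tendsto (fun R => D.analysis ((hFm R).toLp _)) atTop (𝓝 (D.analysis (hf.toLp f))) := by
    refine D.analysis.continuous.continuousAt.tendsto.comp ?_
    rw [Lp.tendsto_Lp_iff_tendsto_eLpNorm'' _ hFm _ hf]
    exact tendsto_eLpNorm_indicator_Ioc hf
  rw [Lp.tendsto_Lp_iff_tendsto_eLpNorm'] at ht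
  have ht2 := tendsto_eLpNorm_symm p (fun R => (Lp.memLp (D.analysis ((hFm R).toLp _))).1)
    (Lp.memLp (D.analysis (hf.toLp f))).1 ht
  have he : ∀ R : ℝ, 0 ≤ R → symm p (D.analysis ((hFm R).toLp _)) =ᵐ[volume]
      fun l => ∫ x in (-R)..R, starRingEnd ℂ (D.contMode p x l) * f x := fun R hR => by
    refine (symm_congr p (D.analysis_toLp (hFi R) (hFm R))).trans (Eventually.of_forall fun l => ?_)
    rw [← integral_conj_contMode_mul _ _ _ (hFi R)]
    simp only
    rw [intervalIntegral.integral_of_le (by linarith),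
      ← integral_indicator measurableSet_Ioc]
    refine integral_congr_ae (Eventually.of_forall fun x => ?_)
    simp only [hF, Set.indicator_apply]
    split_ifs <;> simp
  refine ⟨⟨hf, (D.memLp_modeCoeff p hf).restrict _, ?_⟩, ?_⟩
  · refine tendsto_of_tendsto_of_tendsto_of_le_of_le' tendsto_const_nhds ht2
      (Eventually.of_forall fun R => bot_le) ?_
    filter_upwards [eventually_ge_atTop 0] with R hR
    refine (eLpNorm_mono_measure _ Measure.restrict_le_self).trans (eLpNorm_congr_ae ?_).le
    filter_upwards [he R hR] with l hl
    rw [← hl]; rfl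
  · filter_upwards [eventually_ge_atTop 0] with R hR
    exact ((memLp_symm p (Lp.memLp (D.analysis ((hFm R).toLp _)))).1.congr (he R hR)).restrict

/-- From here on, the limits in the definitions are replaced by almost everywhere equality with the
value of a bounded operator; `isModeSum_iff` does the same for mode sums. -/
lemma isModeCoeff_iff (p : Parity) {f A : ℝ → ℂ} (hf : MemLp f 2) :
    D.IsModeCoeff p f A ↔ A =ᵐ[volume.restrict (Set.Ioi 0)] D.modeCoeff p hf := by
  obtain ⟨h1, h2⟩ := D.isModeCoeff_modeCoeff p hf
  constructor
  · rintro ⟨-, hA, hlim⟩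
    exact ae_eq_of_tendsto_eLpNorm h2 hA.1 h1.2.1.1 hlim h1.2.2
  · intro h
    refine ⟨hf, (memLp_congr_ae h).mpr h1.2.1, h1.2.2.congr fun R => eLpNorm_congr_ae ?_⟩
    filter_upwards [h] with l hl
    rw [hl]

/-- Integrating A against the parity mode over (0,R) equals integrating the extension of A against
a(x,λ) times the normalization over (-R,R), by the substitution λ → -λ. This reduces the half-line
sum to `synthesis`. -/
lemma isModeSum_modeSum (p : Parity) {A : ℝ → ℂ} (hA : MemLp A 2 (volume.restrict (Set.Ioi 0))) :
    D.IsModeSum p A (D.modeSum p hA) ∧ ∀ᶠ R : ℝ in atTop, AEStronglyMeasurable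
      (fun x => ∫ l in (0 : ℝ)..R, A l * D.contMode p x l) volume := by
  have hA' := memLp_indicator_Ioi hA
  set F : ℝ → ℝ → ℂ := fun R => (Set.Ioc (-R) R).indicator ((Set.Ioi 0).indicator A) with hF
  have hFm : ∀ R, MemLp (F R) 2 := fun R => hA'.indicator measurableSet_Ioc
  have hFi : ∀ R, Integrable (F R) := integrable_indicator_Ioc hA'
  have ht : Tendsto (fun R => D.synthesis ((memLp_symm p (hFm R)).toLp _)) atTop
      (𝓝 (D.synthesis ((memLp_extend p hA).toLp _))) := by
    refine D.synthesis.continuous.continuousAt.tendsto.comp ?_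
    rw [Lp.tendsto_Lp_iff_tendsto_eLpNorm'' _ (fun R => memLp_symm p (hFm R)) _ (memLp_extend p hA)]
    exact tendsto_eLpNorm_symm p (fun R => (hFm R).1) hA'.1 (tendsto_eLpNorm_indicator_Ioc hA')
  rw [Lp.tendsto_Lp_iff_tendsto_eLpNorm'] at ht
  have he : ∀ R : ℝ, 0 ≤ R → D.synthesis ((memLp_symm p (hFm R)).toLp _) =ᵐ[volume]
      fun x => ∫ l in (0 : ℝ)..R, A l * D.contMode p x l := fun R hR => by
    have hneg : Integrable fun l => F R (-l) := (hFi R).comp_neg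
    have hsi : Integrable (symm p (F R)) := (hFi R).add (hneg.const_mul _)
    refine (D.synthesis_toLp hsi (memLp_symm p (hFm R))).trans (Eventually.of_forall fun x => ?_)
    have hbd : ∃ c, ∀ l : ℝ, ‖D.a x l * D.normFactor l‖ ≤ c := by
      refine ⟨(1 + ‖D.a1 x‖ + ‖D.a0 x‖) * (1 + D.normFactor 0), fun l => ?_⟩
      have b := D.pow_mul_normFactor_le
      have e : D.a x l * D.normFactor l = ((l : ℂ) ^ 2 * D.normFactor l
          + D.a1 x * ((l : ℂ) ^ 1 * D.normFactor l) + D.a0 x * ((l : ℂ) ^ 0 * D.normFactor l))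
          * Complex.exp (-(2 * Complex.I * l * x)) := by rw [a]; ring
      rw [e, norm_mul, norm_cexp_mode, mul_one]
      refine (norm_add₃_le).trans ?_
      rw [norm_mul (D.a1 x), norm_mul (D.a0 x), add_mul, add_mul, one_mul]
      gcongr
      · exact b 2 (by norm_num) l
      · exact b 1 (by norm_num) l
      · exact b 0 (by norm_num) l
    obtain ⟨c, hc⟩ := hbd
    have hcont : Continuous fun l : ℝ => D.a x l * D.normFactor l := by
      have := D.continuous_normFactor
      unfold a; fun_prop
    have i1 : Integrable fun l => F R l * (D.a x l * D.normFactor l) :=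
      (hFi R).mul_bdd hcont.aestronglyMeasurable (Eventually.of_forall hc)
    have i2 : Integrable fun l => F R (-l) * (D.a x l * D.normFactor l) :=
      hneg.mul_bdd hcont.aestronglyMeasurable (Eventually.of_forall hc)
    have i3 : Integrable fun l : ℝ => F R l * (D.a x ((-l : ℝ) : ℂ) * D.normFactor (-l)) :=
      (hFi R).mul_bdd (hcont.comp continuous_neg).aestronglyMeasurable
        (Eventually.of_forall fun l => hc (-l))
    have e1 : ∀ l : ℝ, symm p (F R) l * (D.a x l * D.normFactor l) =
        F R l * (D.a x l * D.normFactor l) + p.sgn * (F R (-l) * (D.a x l * D.normFactor l)) := by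
      intro l; simp only [symm]; ring
    have e2 : ∫ l, F R (-l) * (D.a x l * D.normFactor l) =
        ∫ l : ℝ, F R l * (D.a x ((-l : ℝ) : ℂ) * D.normFactor (-l)) := by
      rw [← integral_neg_eq_self]; simp
    simp only [e1]
    rw [integral_add i1 (i2.const_mul _), integral_const_mul, e2, ← integral_const_mul,
      ← integral_add i1 (i3.const_mul _), intervalIntegral.integral_of_le hR,
      ← integral_indicator measurableSet_Ioc]
    refine integral_congr_ae (Eventually.of_forall fun l => ?_)
    have hind : F R l = (Set.Ioc 0 R).indicator A l := by
      simp only [hF, Set.indicator_apply, Set.mem_Ioc, Set.mem_Ioi]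
      by_cases h1 : 0 < l
      · have : -R < l := by linarith
        simp [h1, this]
      · simp [h1]
    simp only [hind, contMode_eq, normFactor_neg, Set.indicator_apply]
    split_ifs <;> ring
  refine ⟨⟨hA, D.memLp_modeSum p hA, ?_⟩, ?_⟩
  · refine ht.congr' ?_
    filter_upwards [eventually_ge_atTop 0] with R hR
    refine eLpNorm_congr_ae ?_
    filter_upwards [he R hR] with l hl
    rw [← hl]; rfl
  · filter_upwards [eventually_ge_atTop 0] with R hR
    exact (Lp.memLp (D.synthesis ((memLp_symm p (hFm R)).toLp _))).1.congr (he R hR)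

lemma isModeSum_iff (p : Parity) {A g : ℝ → ℂ} (hA : MemLp A 2 (volume.restrict (Set.Ioi 0))) :
    D.IsModeSum p A g ↔ g =ᵐ[volume] D.modeSum p hA := by
  obtain ⟨h1, h2⟩ := D.isModeSum_modeSum p hA
  constructor
  · rintro ⟨-, hg, hlim⟩
    exact ae_eq_of_tendsto_eLpNorm h2 hg.1 h1.2.1.1 hlim h1.2.2
  · intro h
    refine ⟨hA, (memLp_congr_ae h).mpr h1.2.1, h1.2.2.congr fun R => eLpNorm_congr_ae ?_⟩
    filter_upwards [h] with l hl
    rw [hl]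

end Data
end TwoSoliton

/-! ### Calculus on the continuous subspaces and uniqueness for the resolvent equation -/

namespace TwoSoliton

open scoped ENNReal NNReal

lemma Parity.sgn_mul_of_ne {p q : Parity} (h : p ≠ q) : p.sgn * q.sgn = -1 := by
  cases p <;> cases q <;> simp_all [Parity.sgn]

namespace Data

variable (D : Data)

lemma modeCoeff_congr (p : Parity) {f g : ℝ → ℂ} (hf : MemLp f 2) (hg : MemLp g 2)
    (h : f =ᵐ[volume] g) : D.modeCoeff p hf = D.modeCoeff p hg := by
  rw [modeCoeff, modeCoeff, (MemLp.toLp_eq_toLp_iff hf hg).mpr h]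

/-- Analysis after synthesis halves the extension, and symmetrization then doubles it for equal
parities and cancels it for opposite ones. -/
lemma modeCoeff_modeSum (p q : Parity) {A : ℝ → ℂ}
    (hA : MemLp A 2 (volume.restrict (Set.Ioi 0))) :
    D.modeCoeff p (D.memLp_modeSum q hA) =ᵐ[volume.restrict (Set.Ioi 0)]
      fun l => (1 + p.sgn * q.sgn) / 2 * A l := by
  have e : (D.memLp_modeSum q hA).toLp _ = D.synthesis ((memLp_extend q hA).toLp _) :=
    Lp.toLp_coeFn _ _
  have h1 : (D.analysis ((D.memLp_modeSum q hA).toLp _) : ℝ → ℂ) =ᵐ[volume]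
      fun l => 1 / 2 * extend q A l := by
    rw [e, analysis_synthesis]
    filter_upwards [Lp.coeFn_smul (1 / 2 : ℂ) ((memLp_extend q hA).toLp _),
      (memLp_extend q hA).coeFn_toLp] with l h2 h3
    rw [h2, Pi.smul_apply, h3, smul_eq_mul]
  filter_upwards [ae_restrict_of_ae (symm_congr p h1), ae_restrict_mem measurableSet_Ioi]
    with l h2 hl
  rw [modeCoeff, h2, symm, extend_of_pos q A hl, extend_neg_of_pos q A hl]
  ring

lemma modeSum_congr (p : Parity) {A B : ℝ → ℂ} (hA : MemLp A 2 (volume.restrict (Set.Ioi 0)))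
    (hB : MemLp B 2 (volume.restrict (Set.Ioi 0))) (h : A =ᵐ[volume.restrict (Set.Ioi 0)] B) :
    D.modeSum p hA = D.modeSum p hB := by
  rw [modeSum, modeSum, (MemLp.toLp_eq_toLp_iff (memLp_extend p hA) (memLp_extend p hB)).mpr
    (extend_congr p h)]

lemma modeSum_sub (p : Parity) {A B : ℝ → ℂ} (hA : MemLp A 2 (volume.restrict (Set.Ioi 0)))
    (hB : MemLp B 2 (volume.restrict (Set.Ioi 0))) :
    D.modeSum p (hA.sub hB) =ᵐ[volume] D.modeSum p hA - D.modeSum p hB := by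
  have e : (memLp_extend p (hA.sub hB)).toLp _ =
      (memLp_extend p hA).toLp _ - (memLp_extend p hB).toLp _ := by
    rw [← MemLp.toLp_sub]
    refine (MemLp.toLp_eq_toLp_iff _ _).mpr (Eventually.of_forall fun l => ?_)
    simp only [extend, symm, Pi.sub_apply, Set.indicator_apply]
    split_ifs <;> ring
  rw [modeSum, e, map_sub]
  exact Lp.coeFn_sub _ _

lemma modeSum_const_mul (p : Parity) (c : ℂ) {A : ℝ → ℂ}
    (hA : MemLp A 2 (volume.restrict (Set.Ioi 0))) :
    D.modeSum p (hA.const_mul c) =ᵐ[volume] fun x => c * D.modeSum p hA x := by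
  have e : (memLp_extend p (hA.const_mul c)).toLp _ = c • (memLp_extend p hA).toLp _ := by
    rw [← MemLp.toLp_const_smul]
    refine (MemLp.toLp_eq_toLp_iff _ _).mpr (Eventually.of_forall fun l => ?_)
    simp only [extend, symm, Pi.smul_apply, Set.indicator_apply, smul_eq_mul]
    split_ifs <;> ring
  rw [modeSum, e, map_smul]
  exact Lp.coeFn_smul _ _

lemma modeSum_eq_zero (p : Parity) {A : ℝ → ℂ} (hA : MemLp A 2 (volume.restrict (Set.Ioi 0)))
    (h : A =ᵐ[volume.restrict (Set.Ioi 0)] 0) : D.modeSum p hA =ᵐ[volume] 0 := by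
  have h1 := D.modeSum_sub p hA hA
  rw [D.modeSum_congr p (hA.sub hA) hA (by filter_upwards [h] with l hl; simp [hl])] at h1
  simpa using h1

lemma modeCoeff_sub (p : Parity) {f g : ℝ → ℂ} (hf : MemLp f 2) (hg : MemLp g 2) :
    D.modeCoeff p (hf.sub hg) =ᵐ[volume] D.modeCoeff p hf - D.modeCoeff p hg := by
  rw [modeCoeff, MemLp.toLp_sub hf hg, map_sub]
  exact (symm_congr p (Lp.coeFn_sub _ _)).trans (by rw [symm_sub]; rfl)

lemma modeCoeff_add (p : Parity) {f g : ℝ → ℂ} (hf : MemLp f 2) (hg : MemLp g 2) :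
    D.modeCoeff p (hf.add hg) =ᵐ[volume] D.modeCoeff p hf + D.modeCoeff p hg := by
  rw [modeCoeff, MemLp.toLp_add hf hg, map_add]
  refine (symm_congr p (Lp.coeFn_add _ _)).trans (Eventually.of_forall fun l => ?_)
  simp only [symm, modeCoeff, Pi.add_apply]; ring

lemma modeCoeff_const_mul (p : Parity) (c : ℂ) {f : ℝ → ℂ} (hf : MemLp f 2) :
    D.modeCoeff p (hf.const_mul c) =ᵐ[volume] fun l => c * D.modeCoeff p hf l := by
  have e : (hf.const_mul c).toLp _ = c • hf.toLp f := by
    rw [← MemLp.toLp_const_smul]; rfl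
  rw [modeCoeff, e, map_smul]
  refine (symm_congr p (Lp.coeFn_smul _ _)).trans (Eventually.of_forall fun l => ?_)
  simp only [symm, modeCoeff, Pi.smul_apply, smul_eq_mul]; ring

lemma boundCoeff_congr (p : Parity) {f g : ℝ → ℂ} (h : f =ᵐ[volume] g) :
    D.boundCoeff p f = D.boundCoeff p g :=
  integral_congr_ae (by filter_upwards [h] with x hx; rw [hx])

lemma boundCoeff_modeSum (p q : Parity) {A : ℝ → ℂ}
    (hA : MemLp A 2 (volume.restrict (Set.Ioi 0))) : D.boundCoeff p (D.modeSum q hA) = 0 :=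
  D.boundCoeff_synthesis p _

lemma integrable_conj_mul {f g : ℝ → ℂ} (hf : MemLp f 2) (hg : MemLp g 2) :
    Integrable fun x => starRingEnd ℂ (f x) * g x := by
  have hf' : MemLp (fun x => starRingEnd ℂ (f x)) 2 := hf.star
  exact hf'.integrable_mul hg

lemma isContPart_of_ae_eq_modeSum (p : Parity) {m f A : ℝ → ℂ}
    (hA : MemLp A 2 (volume.restrict (Set.Ioi 0)))
    (hm : MemLp (fun l => m l * A l) 2 (volume.restrict (Set.Ioi 0)))
    (hf : f =ᵐ[volume] D.modeSum p hA) : D.IsContPart p m f (D.modeSum p hm) := by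
  have hf2 : MemLp f 2 := (memLp_congr_ae hf).mpr (D.memLp_modeSum p hA)
  refine ⟨A, (D.isModeCoeff_iff p hf2).mpr ?_, (D.isModeSum_modeSum p hm).1⟩
  rw [D.modeCoeff_congr p hf2 (D.memLp_modeSum p hA) hf]
  filter_upwards [D.modeCoeff_modeSum p p hA] with l hl
  rw [hl, p.sgn_mul_self]; ring

lemma isContPart_of_ae_eq_modeSum_of_ne {p q : Parity} (hpq : q ≠ p) {m f A : ℝ → ℂ}
    (hA : MemLp A 2 (volume.restrict (Set.Ioi 0)))
    (hf : f =ᵐ[volume] D.modeSum p hA) : D.IsContPart q m f 0 := by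
  have hf2 : MemLp f 2 := (memLp_congr_ae hf).mpr (D.memLp_modeSum p hA)
  have h0 : MemLp (fun l : ℝ => m l * 0) 2 (volume.restrict (Set.Ioi 0)) := by simp
  refine ⟨fun _ => 0, (D.isModeCoeff_iff q hf2).mpr ?_, (D.isModeSum_iff q h0).mpr ?_⟩
  · rw [D.modeCoeff_congr q hf2 (D.memLp_modeSum p hA) hf]
    filter_upwards [D.modeCoeff_modeSum q p hA] with l hl
    rw [hl, Parity.sgn_mul_of_ne hpq]; ring
  · exact (D.modeSum_eq_zero q h0 (Eventually.of_forall fun l => mul_zero _)).symm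

/-- On mode sums of one parity the bound-state terms and the other parity vanish, so diagonal
operators act by multiplying the coefficient. -/
lemma isDiagonal_of_ae_eq_modeSum (p : Parity) (mb : ℂ) {m f g A : ℝ → ℂ}
    (hA : MemLp A 2 (volume.restrict (Set.Ioi 0)))
    (hm : MemLp (fun l => m l * A l) 2 (volume.restrict (Set.Ioi 0)))
    (hf : f =ᵐ[volume] D.modeSum p hA) (hg : g =ᵐ[volume] D.modeSum p hm) :
    D.IsDiagonal mb m f g := by
  have hb : ∀ q, D.boundCoeff q f = 0 := fun q => by
    rw [D.boundCoeff_congr q hf, boundCoeff_modeSum]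
  have h1 := D.isContPart_of_ae_eq_modeSum p hA hm hf
  cases p
  · refine ⟨_, _, h1, D.isContPart_of_ae_eq_modeSum_of_ne (by simp) hA hf, ?_⟩
    filter_upwards [hg] with x hx
    simp [hb, hx]
  · refine ⟨_, _, D.isContPart_of_ae_eq_modeSum_of_ne (by simp) hA hf, h1, ?_⟩
    filter_upwards [hg] with x hx
    simp [hb, hx]

/-- The resolvent equation has at most one solution off the real axis. -/
lemma solvesResolvent_unique {z : ℂ} (hz : z.im ≠ 0) {h u u' : ℝ → ℂ}
    (hu : D.SolvesResolvent z h u) (hu' : D.SolvesResolvent z h u') : u' =ᵐ[volume] u := by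
  obtain ⟨w, ⟨ge, go, ⟨Ae, hAe, hge⟩, ⟨Ao, hAo, hgo⟩, hw⟩, hwz⟩ := hu
  obtain ⟨w', ⟨ge', go', ⟨Ae', hAe', hge'⟩, ⟨Ao', hAo', hgo'⟩, hw'⟩, hwz'⟩ := hu'
  have hu2 := hAe.1
  have hu2' := hAe'.1
  have hU := hu2'.sub hu2
  have ae := (D.isModeCoeff_iff _ hu2).mp hAe
  have ao := (D.isModeCoeff_iff _ hu2).mp hAo
  have ae' := (D.isModeCoeff_iff _ hu2').mp hAe'
  have ao' := (D.isModeCoeff_iff _ hu2').mp hAo'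
  have se := (D.isModeSum_iff _ hge.1).mp hge
  have so := (D.isModeSum_iff _ hgo.1).mp hgo
  have se' := (D.isModeSum_iff _ hge'.1).mp hge'
  have so' := (D.isModeSum_iff _ hgo'.1).mp hgo'
  set Ge := D.modeSum .even (hge'.1.sub hge.1) with hGe
  set Go := D.modeSum .odd (hgo'.1.sub hgo.1) with hGo
  have hGe2 : MemLp Ge 2 := D.memLp_modeSum _ _
  have hGo2 : MemLp Go 2 := D.memLp_modeSum _ _
  set ce := D.boundCoeff .even u' - D.boundCoeff .even u with hce
  set co := D.boundCoeff .odd u' - D.boundCoeff .odd u with hco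
  set V : ℝ → ℂ := fun x => ce * D.boundMode .even x + co * D.boundMode .odd x with hV
  have hV2 : MemLp V 2 :=
    ((D.memLp_boundMode .even).const_mul ce).add ((D.memLp_boundMode .odd).const_mul co)
  -- Difference of the two resolvent equations; the right side is B(u' - u), split into its bound
  -- part -2βV and its two continuous parts.
  have key : ∀ᵐ x : ℝ, z * (u' x - u x) = -2 * D.β * V x + Ge x + Go x := by
    filter_upwards [hw, hw', hwz, hwz', se, so, se', so', D.modeSum_sub .even hge'.1 hge.1,
      D.modeSum_sub .odd hgo'.1 hgo.1] with x h1 h2 h3 h4 h5 h6 h7 h8 h9 h10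
    rw [hGe, hGo, h9, h10, Pi.sub_apply, Pi.sub_apply, ← h5, ← h6, ← h7, ← h8]
    simp only [hV, hce, hco]
    linear_combination h3 - h4 + h2 - h1
  have bU : ∀ q, ∫ x, starRingEnd ℂ (D.boundMode q x) * (u' x - u x) =
      D.boundCoeff q u' - D.boundCoeff q u := fun q => by
    rw [boundCoeff, boundCoeff, ← integral_sub (integrable_conj_mul (D.memLp_boundMode q) hu2')
      (integrable_conj_mul (D.memLp_boundMode q) hu2)]
    simp only [mul_sub]
  have conjV : ∀ f : ℝ → ℂ, MemLp f 2 → ∫ x, starRingEnd ℂ (V x) * f x =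
      starRingEnd ℂ ce * (∫ x, starRingEnd ℂ (D.boundMode .even x) * f x)
      + starRingEnd ℂ co * ∫ x, starRingEnd ℂ (D.boundMode .odd x) * f x := fun f hf => by
    rw [← integral_const_mul, ← integral_const_mul,
      ← integral_add ((integrable_conj_mul (D.memLp_boundMode _) hf).const_mul _)
        ((integrable_conj_mul (D.memLp_boundMode _) hf).const_mul _)]
    refine integral_congr_ae (Eventually.of_forall fun x => ?_)
    simp only [hV, map_add, map_mul]; ring
  have bG : ∀ q : Parity, ∀ {A : ℝ → ℂ} (hA : MemLp A 2 (volume.restrict (Set.Ioi 0))),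
      ∫ x, starRingEnd ℂ (V x) * D.modeSum q hA x = 0 := fun q A hA => by
    rw [conjV _ (D.memLp_modeSum _ _)]
    have h1 := D.boundCoeff_modeSum .even q hA
    have h2 := D.boundCoeff_modeSum .odd q hA
    rw [boundCoeff] at h1 h2
    rw [h1, h2]; simp
  -- Pairing with V removes the continuous parts. The right side is real and z is not, so both bound
  -- coefficients vanish; neither normalization nor mutual orthogonality of the bound states is
  -- used.
  have e1 : z * ((‖ce‖ ^ 2 + ‖co‖ ^ 2 : ℝ) : ℂ) = -2 * D.β * ((∫ x, ‖V x‖ ^ 2 : ℝ) : ℂ) := by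
    have l1 : ∫ x, starRingEnd ℂ (V x) * (z * (u' x - u x)) =
        z * ((‖ce‖ ^ 2 + ‖co‖ ^ 2 : ℝ) : ℂ) := by
      have : ∀ x, starRingEnd ℂ (V x) * (z * (u' x - u x)) =
          z * (starRingEnd ℂ (V x) * (u' x - u x)) := fun x => by ring
      simp only [this]
      rw [integral_const_mul, conjV (fun x => u' x - u x) hU, bU, bU, ← hce, ← hco]
      congr 1
      rw [Complex.conj_mul', Complex.conj_mul']
      push_cast; rfl
    have iV := (integrable_conj_mul hV2 hV2).const_mul (-2 * D.β : ℂ)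
    have iE := integrable_conj_mul hV2 hGe2
    have iO := integrable_conj_mul hV2 hGo2
    rw [← l1, ← integral_complex_ofReal]
    calc ∫ x, starRingEnd ℂ (V x) * (z * (u' x - u x))
        = ∫ x, (-2 * D.β * (starRingEnd ℂ (V x) * V x) + starRingEnd ℂ (V x) * Ge x
            + starRingEnd ℂ (V x) * Go x) := by
          refine integral_congr_ae ?_
          filter_upwards [key] with x hx
          rw [hx]; ring
      _ = -2 * D.β * ∫ x, starRingEnd ℂ (V x) * V x := by
          rw [integral_add (iV.fun_add iE) iO, integral_add iV iE, hGe, hGo, bG, bG,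
            integral_const_mul]
          ring
      _ = _ := by
          congr 1
          refine integral_congr_ae (Eventually.of_forall fun x => ?_)
          simp only
          rw [Complex.conj_mul']; push_cast; rfl
  have e2 : ‖ce‖ ^ 2 + ‖co‖ ^ 2 = 0 := by
    have := congrArg Complex.im e1
    rw [Complex.im_mul_ofReal] at this
    have h3 : (-2 * (D.β : ℂ) * ((∫ x, ‖V x‖ ^ 2 : ℝ) : ℂ)).im = 0 := by
      have : (-2 * (D.β : ℂ) * ((∫ x, ‖V x‖ ^ 2 : ℝ) : ℂ)) =
        ((-2 * D.β * ∫ x, ‖V x‖ ^ 2 : ℝ) : ℂ) := by push_cast; rfl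
      rw [this, Complex.ofReal_im]
    rw [h3] at this
    exact (mul_eq_zero.mp this).resolve_left hz
  have ce0 : ce = 0 := by
    rw [← norm_eq_zero, ← sq_eq_zero_iff]; nlinarith [sq_nonneg ‖ce‖, sq_nonneg ‖co‖]
  have co0 : co = 0 := by
    rw [← norm_eq_zero, ← sq_eq_zero_iff]; nlinarith [sq_nonneg ‖ce‖, sq_nonneg ‖co‖]
  have key2 : ∀ᵐ x : ℝ, z * (u' - u) x = (Ge + Go) x := by
    filter_upwards [key] with x hx
    rw [Pi.sub_apply, hx]; simp [hV, ce0, co0]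
  have coeff : ∀ q, (fun l => z * (D.modeCoeff q hu2' l - D.modeCoeff q hu2 l)) =ᵐ[volume]
      D.modeCoeff q hGe2 + D.modeCoeff q hGo2 := fun q => by
    have h1 := D.modeCoeff_congr q (hU.const_mul z) (hGe2.add hGo2) key2
    have h2 := D.modeCoeff_const_mul q z hU
    rw [h1] at h2
    filter_upwards [h2, D.modeCoeff_sub q hu2' hu2, D.modeCoeff_add q hGe2 hGo2] with l h3 h4 h5
    rw [Pi.sub_apply] at h4
    rw [← h5, h3, h4]
  have zne : ∀ l : ℝ, z - 2 * (l : ℂ) ^ 2 ≠ 0 := fun l h0 => by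
    have h1 := congrArg Complex.im h0
    rw [Complex.sub_im, show (2 * (l : ℂ) ^ 2) = ((2 * l ^ 2 : ℝ) : ℂ) by push_cast; rfl,
      Complex.ofReal_im, Complex.zero_im, sub_zero] at h1
    exact hz h1
  -- Taking even coefficients of z(u' - u) = Ge + Go gives (z - 2λ²) times the difference of
  -- coefficients equal to 0, and z - 2λ² never vanishes. The odd part is identical, so z(u' - u) =
  -- 0.
  have Ge0 : Ge =ᵐ[volume] 0 := by
    refine D.modeSum_eq_zero _ _ ?_
    filter_upwards [ae_restrict_of_ae (coeff .even), D.modeCoeff_modeSum .even .even (hge'.1.sub hge.1),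
      D.modeCoeff_modeSum .even .odd (hgo'.1.sub hgo.1), ae, ae'] with l h1 h2 h3 h4 h5
    rw [Pi.add_apply, h2, h3, Parity.sgn_mul_self, Parity.sgn_mul_of_ne (by simp)] at h1
    simp only [Pi.sub_apply, h4, h5, Pi.zero_apply] at h1 ⊢
    have h6 : (z - 2 * (l : ℂ) ^ 2) * (D.modeCoeff .even hu2' l - D.modeCoeff .even hu2 l) = 0 := by
      linear_combination h1
    have h7 := (mul_eq_zero.mp h6).resolve_left (zne l)
    linear_combination 2 * (l : ℂ) ^ 2 * h7
  have Go0 : Go =ᵐ[volume] 0 := by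
    refine D.modeSum_eq_zero _ _ ?_
    filter_upwards [ae_restrict_of_ae (coeff .odd), D.modeCoeff_modeSum .odd .odd (hgo'.1.sub hgo.1),
      D.modeCoeff_modeSum .odd .even (hge'.1.sub hge.1), ao, ao'] with l h1 h2 h3 h4 h5
    rw [Pi.add_apply, h2, h3, Parity.sgn_mul_self, Parity.sgn_mul_of_ne (by simp)] at h1
    simp only [Pi.sub_apply, h4, h5, Pi.zero_apply] at h1 ⊢
    have h6 : (z - 2 * (l : ℂ) ^ 2) * (D.modeCoeff .odd hu2' l - D.modeCoeff .odd hu2 l) = 0 := by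
      linear_combination h1
    have h7 := (mul_eq_zero.mp h6).resolve_left (zne l)
    linear_combination 2 * (l : ℂ) ^ 2 * h7
  filter_upwards [key2, Ge0, Go0] with x h1 h2 h3
  rw [Pi.add_apply, h2, h3] at h1
  have hz0 : z ≠ 0 := fun h0 => hz (by rw [h0, Complex.zero_im])
  have := (mul_eq_zero.mp (h1.trans (by simp))).resolve_left hz0
  exact sub_eq_zero.mp this

end Data
end TwoSoliton

/-! ### Oscillatory integrals on the half-line, uniformly up to real frequency -/

namespace TwoSoliton

lemma norm_cexp_two_mul_I_le {ω : ℂ} (hω : 0 ≤ ω.im) {s : ℝ} (hs : 0 ≤ s) :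
    ‖Complex.exp (2 * Complex.I * ω * s)‖ ≤ 1 := by
  rw [Complex.norm_exp]
  refine Real.exp_le_one_iff.mpr ?_
  have : (2 * Complex.I * ω * s).re = -(2 * ω.im * s) := by simp
  rw [this]
  have := mul_nonneg hω hs
  linarith

lemma integral_Ioi_add_rpow {α ρ : ℝ} (hα : 0 < α) (hρ : 0 < ρ) :
    ∫ s in Set.Ioi (0 : ℝ), (ρ + s) ^ (-α - 1) = ρ ^ (-α) / α := by
  have hd : ∀ s ∈ Set.Ici (0 : ℝ),
      HasDerivAt (fun s : ℝ => -(ρ + s) ^ (-α) / α) ((ρ + s) ^ (-α - 1)) s := fun s hs => by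
    have h0 : ρ + s ≠ 0 := (add_pos_of_pos_of_nonneg hρ hs).ne'
    have h1 := (((hasDerivAt_id s).const_add ρ).rpow_const (p := -α) (Or.inl h0)).fun_neg.div_const α
    convert! h1 using 1
    simp only [id]; field_simp
  have ht : Tendsto (fun s : ℝ => -(ρ + s) ^ (-α) / α) atTop (𝓝 0) := by
    have := ((tendsto_rpow_neg_atTop hα).comp (tendsto_atTop_add_const_left _ ρ tendsto_id)).neg.div_const α
    simpa using this
  rw [integral_Ioi_of_hasDerivAt_of_nonneg' hd (fun s hs => ?_) ht]
  · simp; ring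
  · exact Real.rpow_nonneg (add_pos_of_pos_of_nonneg hρ (le_of_lt hs)).le _

lemma integrableOn_Ioi_add_rpow {α ρ : ℝ} (hα : 0 < α) (hρ : 0 < ρ) :
    IntegrableOn (fun s : ℝ => (ρ + s) ^ (-α - 1)) (Set.Ioi 0) := by
  have := integrableOn_add_rpow_Ioi_of_lt (a := -α - 1) (c := 0) (m := ρ) (by linarith)
    (by linarith)
  simpa only [add_comm] using this

lemma integrableOn_rpow_neg_half (c : ℝ) :
    IntegrableOn (fun s : ℝ => c * s ^ (-(1 / 2) : ℝ)) (Set.Ioc 0 1) := by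
  have := (intervalIntegral.intervalIntegrable_rpow' (a := 0) (b := 1)
    (r := -(1 / 2)) (by norm_num)).const_mul c
  rwa [intervalIntegrable_iff_integrableOn_Ioc_of_le zero_le_one] at this


lemma integral_rpow_neg_half :
    ∫ s in Set.Ioc (0 : ℝ) 1, s ^ (-(1 / 2) : ℝ) = 2 := by
  rw [← intervalIntegral.integral_of_le zero_le_one, integral_rpow (by norm_num)]
  norm_num

/-- Amplitudes on the half-line with derivative `F'`, an integrable singularity at `0` and decay of
order `α` at infinity. -/
structure IsAmplitude (α A : ℝ) (F F' : ℝ → ℂ) : Prop where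
  measurable : Measurable F
  measurable_deriv : Measurable F'
  hasDerivAt : ∀ τ, 0 < τ → HasDerivAt F (F' τ) τ
  bound_zero : ∀ τ, 0 < τ → ‖F τ‖ ≤ A * τ ^ (-(1 / 2) : ℝ)
  bound : ∀ τ, 1 ≤ τ → ‖F τ‖ ≤ A * τ ^ (-α)
  bound_deriv : ∀ τ, 1 ≤ τ → ‖F' τ‖ ≤ A * τ ^ (-α - 1)

/-- The integral of `exp (2iωs) F (r + s)` over the half-line, integrated by parts on
`(1, ∞)`, so that it makes sense for real nonzero `ω`. -/
def oscIntegral (r : ℝ) (F F' : ℝ → ℂ) (ω : ℂ) : ℂ :=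
  (∫ s in Set.Ioc (0 : ℝ) 1, Complex.exp (2 * Complex.I * ω * s) * F (r + s))
    - Complex.exp (2 * Complex.I * ω) / (2 * Complex.I * ω) *
      (F (r + 1) + ∫ s in Set.Ioi (0 : ℝ), Complex.exp (2 * Complex.I * ω * s) * F' (r + 1 + s))

namespace IsAmplitude

variable {α A : ℝ} {F F' : ℝ → ℂ}

lemma nonneg (h : IsAmplitude α A F F') : 0 ≤ A := by
  have := h.bound 1 le_rfl
  simp only [Real.one_rpow, mul_one] at this
  exact (norm_nonneg _).trans this

/-- If r + s ≤ 1 then 1 + r ≤ 2, and the singular bound costs 2^α; otherwise r + s ≥ (1 + r)/2 and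
the decay bound applies, with s^{-1/2} ≥ 1 inserted for free. One bound thus has both the
singularity in s and the decay in r. -/
lemma norm_near (h : IsAmplitude α A F F') {r s : ℝ} (hα : 0 < α) (hr : 0 ≤ r) (hs : s ∈ Set.Ioc (0 : ℝ) 1) :
    ‖F (r + s)‖ ≤ A * 2 ^ α * (1 + r) ^ (-α) * s ^ (-(1 / 2) : ℝ) := by
  have hA := h.nonneg
  have hs0 : 0 < s := hs.1
  have h2 : (2 : ℝ) ^ α * 2 ^ (-α) = 1 := by rw [← Real.rpow_add two_pos]; simp
  rcases le_total (r + s) 1 with h1 | h1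
  · refine (h.bound_zero _ (by linarith)).trans ?_
    have e1 : (r + s) ^ (-(1 / 2) : ℝ) ≤ s ^ (-(1 / 2) : ℝ) :=
      Real.rpow_le_rpow_of_nonpos hs0 (by linarith) (by norm_num)
    have e2 : (2 : ℝ) ^ (-α) ≤ (1 + r) ^ (-α) :=
      Real.rpow_le_rpow_of_nonpos (by linarith) (by linarith) (by linarith)
    calc A * (r + s) ^ (-(1 / 2) : ℝ) ≤ A * (2 ^ α * 2 ^ (-α)) * s ^ (-(1 / 2) : ℝ) := by
          rw [h2, mul_one]; gcongr
      _ ≤ A * (2 ^ α * (1 + r) ^ (-α)) * s ^ (-(1 / 2) : ℝ) := by gcongr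
      _ = _ := by ring
  · refine (h.bound _ h1).trans ?_
    have e1 : (r + s) ^ (-α) ≤ ((1 + r) / 2) ^ (-α) :=
      Real.rpow_le_rpow_of_nonpos (by linarith) (by linarith) (by linarith)
    have e2 : ((1 + r) / 2) ^ (-α) = 2 ^ α * (1 + r) ^ (-α) := by
      rw [Real.div_rpow (by linarith) two_pos.le, Real.rpow_neg two_pos.le, div_inv_eq_mul,
        mul_comm]
    have e3 : 1 ≤ s ^ (-(1 / 2) : ℝ) :=
      Real.one_le_rpow_of_pos_of_le_one_of_nonpos hs0 hs.2 (by norm_num)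
    calc A * (r + s) ^ (-α) ≤ A * (2 ^ α * (1 + r) ^ (-α)) * 1 := by rw [← e2, mul_one]; gcongr
      _ ≤ A * (2 ^ α * (1 + r) ^ (-α)) * s ^ (-(1 / 2) : ℝ) := by gcongr
      _ = _ := by ring


lemma norm_near_cexp (h : IsAmplitude α A F F') {r s : ℝ} {ω : ℂ} (hω : 0 ≤ ω.im) (hα : 0 < α) (hr : 0 ≤ r)
    (hs : s ∈ Set.Ioc (0 : ℝ) 1) :
    ‖Complex.exp (2 * Complex.I * ω * s) * F (r + s)‖ ≤
      A * 2 ^ α * (1 + r) ^ (-α) * s ^ (-(1 / 2) : ℝ) := by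
  rw [norm_mul]
  refine (mul_le_mul (norm_cexp_two_mul_I_le hω hs.1.le) (h.norm_near hα hr hs)
    (norm_nonneg _) zero_le_one).trans (one_mul _).le

lemma norm_far_cexp (h : IsAmplitude α A F F') {r s : ℝ} {ω : ℂ} (hω : 0 ≤ ω.im) (hr : 0 ≤ r) (hs : 0 < s) :
    ‖Complex.exp (2 * Complex.I * ω * s) * F' (r + 1 + s)‖ ≤ A * (r + 1 + s) ^ (-α - 1) := by
  rw [norm_mul]
  refine (mul_le_mul (norm_cexp_two_mul_I_le hω hs.le) (h.bound_deriv _ (by linarith))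
    (norm_nonneg _) zero_le_one).trans (one_mul _).le

lemma integrableOn_near (h : IsAmplitude α A F F') {r : ℝ} {ω : ℂ} (hω : 0 ≤ ω.im) (hα : 0 < α) (hr : 0 ≤ r) :
    IntegrableOn (fun s : ℝ => Complex.exp (2 * Complex.I * ω * s) * F (r + s)) (Set.Ioc 0 1) := by
  refine (integrableOn_rpow_neg_half _).mono' ?_
    ((ae_restrict_iff' measurableSet_Ioc).mpr (Eventually.of_forall fun s hs =>
      h.norm_near_cexp hω hα hr hs))
  have := h.measurable.comp (measurable_const_add r)
  exact (((by fun_prop : Continuous fun s : ℝ => Complex.exp (2 * Complex.I * ω * s)).measurable).mul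
    this).aestronglyMeasurable

lemma integrableOn_far (h : IsAmplitude α A F F') {r : ℝ} {ω : ℂ} (hω : 0 ≤ ω.im) (hα : 0 < α) (hr : 0 ≤ r) :
    IntegrableOn (fun s : ℝ => Complex.exp (2 * Complex.I * ω * s) * F' (r + 1 + s))
      (Set.Ioi 0) := by
  refine ((integrableOn_Ioi_add_rpow hα (by linarith : 0 < r + 1)).const_mul A).mono' ?_
    ((ae_restrict_iff' measurableSet_Ioi).mpr (Eventually.of_forall fun s hs =>
      h.norm_far_cexp hω hr hs))
  have := h.measurable_deriv.comp (measurable_const_add (r + 1))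
  exact (((by fun_prop : Continuous fun s : ℝ => Complex.exp (2 * Complex.I * ω * s)).measurable).mul
    this).aestronglyMeasurable

/-- The 2·2^α is the near part, since s^{-1/2} has integral 2 over (0,1]. The 1 + 1/α comes from the
boundary term and from the integral of (1 + r + s)^{-α-1}, divided by |2iω| ≥ 2m. No dependence on
Im ω remains. -/
lemma norm_oscIntegral_le (h : IsAmplitude α A F F') {r m : ℝ} {ω : ℂ} (hω : 0 ≤ ω.im) (hα : 0 < α) (hr : 0 ≤ r) (hm : 0 < m)
    (hmω : m ≤ ‖ω‖) :
    ‖oscIntegral r F F' ω‖ ≤ (2 * 2 ^ α + (1 + 1 / α) / (2 * m)) * (A * (1 + r) ^ (-α)) := by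
  have hA := h.nonneg
  have b1 : ‖∫ s in Set.Ioc (0 : ℝ) 1, Complex.exp (2 * Complex.I * ω * s) * F (r + s)‖ ≤
      A * 2 ^ α * (1 + r) ^ (-α) * 2 := by
    have e2 := integral_const_mul (μ := volume.restrict (Set.Ioc (0 : ℝ) 1))
      (A * 2 ^ α * (1 + r) ^ (-α)) fun s : ℝ => s ^ (-(1 / 2) : ℝ)
    rw [integral_rpow_neg_half] at e2
    rw [← e2]
    exact norm_integral_le_of_norm_le (integrableOn_rpow_neg_half _)
      ((ae_restrict_iff' measurableSet_Ioc).mpr (Eventually.of_forall fun s hs =>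
        h.norm_near_cexp hω hα hr hs))
  have b2 : ‖∫ s in Set.Ioi (0 : ℝ), Complex.exp (2 * Complex.I * ω * s) * F' (r + 1 + s)‖ ≤
      A * ((r + 1) ^ (-α) / α) := by
    rw [← integral_Ioi_add_rpow hα (by linarith), ← integral_const_mul]
    exact norm_integral_le_of_norm_le
      ((integrableOn_Ioi_add_rpow hα (by linarith : 0 < r + 1)).const_mul A)
      ((ae_restrict_iff' measurableSet_Ioi).mpr (Eventually.of_forall fun s hs =>
      h.norm_far_cexp hω hr hs))
  have b3 := h.bound (r + 1) (by linarith)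
  have b4 : ‖Complex.exp (2 * Complex.I * ω) / (2 * Complex.I * ω)‖ ≤ 1 / (2 * m) := by
    have := norm_cexp_two_mul_I_le hω zero_le_one
    rw [Complex.ofReal_one, mul_one] at this
    rw [norm_div]
    have e : ‖2 * Complex.I * ω‖ = 2 * ‖ω‖ := by simp
    rw [e]
    gcongr
  rw [oscIntegral]
  have hp : 0 ≤ (1 + r) ^ (-α) := Real.rpow_nonneg (by linarith) _
  rw [add_comm r 1] at b2 b3
  refine (norm_sub_le _ _).trans ?_
  rw [norm_mul, add_comm r 1]
  calc _ ≤ A * 2 ^ α * (1 + r) ^ (-α) * 2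
        + 1 / (2 * m) * (A * (1 + r) ^ (-α) + A * ((1 + r) ^ (-α) / α)) := by
        gcongr
        exact (norm_add_le _ _).trans (add_le_add b3 b2)
    _ = _ := by field_simp

/-- For Im ω ≥ 0 the exponential has modulus at most 1, so both integrands have majorants
independent of δ; μ ≠ 0 keeps the division by 2iω continuous. -/
lemma tendsto_oscIntegral (h : IsAmplitude α A F F') {r μ : ℝ} (hα : 0 < α) (hr : 0 ≤ r) (hμ : μ ≠ 0) :
    Tendsto (fun δ : ℝ => oscIntegral r F F' (μ + Complex.I * δ)) (𝓝[>] 0)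
      (𝓝 (oscIntegral r F F' μ)) := by
  have im : ∀ δ : ℝ, (μ + Complex.I * δ).im = δ := fun δ => by simp
  have c0 : Tendsto (fun δ : ℝ => (μ + Complex.I * δ : ℂ)) (𝓝[>] 0) (𝓝 μ) := by
    have : Continuous fun δ : ℝ => (μ + Complex.I * δ : ℂ) := by fun_prop
    simpa using (this.tendsto 0).mono_left nhdsWithin_le_nhds
  have ce : ∀ s : ℝ, Tendsto (fun δ : ℝ => Complex.exp (2 * Complex.I * (μ + Complex.I * δ) * s))
      (𝓝[>] 0) (𝓝 (Complex.exp (2 * Complex.I * μ * s))) := fun s =>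
    (Complex.continuous_exp.tendsto _).comp ((c0.const_mul _).mul_const _)
  have hpos : ∀ᶠ δ : ℝ in 𝓝[>] 0, 0 ≤ (μ + Complex.I * δ : ℂ).im := by
    filter_upwards [self_mem_nhdsWithin] with δ hδ
    rw [im]; exact le_of_lt hδ
  have m1 : ∀ ω : ℂ, Measurable fun s : ℝ => Complex.exp (2 * Complex.I * ω * s) := fun ω =>
    (by fun_prop : Continuous fun s : ℝ => Complex.exp (2 * Complex.I * ω * s)).measurable
  have t1 : Tendsto (fun δ : ℝ => ∫ s in Set.Ioc (0 : ℝ) 1,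
      Complex.exp (2 * Complex.I * (μ + Complex.I * δ) * s) * F (r + s)) (𝓝[>] 0)
      (𝓝 (∫ s in Set.Ioc (0 : ℝ) 1, Complex.exp (2 * Complex.I * μ * s) * F (r + s))) := by
    refine tendsto_integral_filter_of_dominated_convergence
      (fun s => A * 2 ^ α * (1 + r) ^ (-α) * s ^ (-(1 / 2) : ℝ))
      (Eventually.of_forall fun δ =>
        ((m1 _).mul (h.measurable.comp (measurable_const_add r))).aestronglyMeasurable)
      ?_ (integrableOn_rpow_neg_half _) (Eventually.of_forall fun s => (ce s).mul_const _)
    filter_upwards [hpos] with δ hδ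
    exact (ae_restrict_iff' measurableSet_Ioc).mpr (Eventually.of_forall fun s hs =>
        h.norm_near_cexp hδ hα hr hs)
  have t2 : Tendsto (fun δ : ℝ => ∫ s in Set.Ioi (0 : ℝ),
      Complex.exp (2 * Complex.I * (μ + Complex.I * δ) * s) * F' (r + 1 + s)) (𝓝[>] 0)
      (𝓝 (∫ s in Set.Ioi (0 : ℝ), Complex.exp (2 * Complex.I * μ * s) * F' (r + 1 + s))) := by
    refine tendsto_integral_filter_of_dominated_convergence
      (fun s => A * (r + 1 + s) ^ (-α - 1))
      (Eventually.of_forall fun δ =>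
        ((m1 _).mul (h.measurable_deriv.comp (measurable_const_add (r + 1)))).aestronglyMeasurable)
      ?_ ((integrableOn_Ioi_add_rpow hα (by linarith : 0 < r + 1)).const_mul A)
      (Eventually.of_forall fun s => (ce s).mul_const _)
    filter_upwards [hpos] with δ hδ
    exact (ae_restrict_iff' measurableSet_Ioi).mpr (Eventually.of_forall fun s hs =>
        h.norm_far_cexp hδ hr hs)
  have c1 := ce 1
  simp only [Complex.ofReal_one, mul_one] at c1
  have hne : (2 * Complex.I * μ : ℂ) ≠ 0 := by simp [hμ]
  exact t1.sub ((c1.div (c0.const_mul _) hne).mul (t2.const_add _))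

lemma integrableOn_Ioi_one (h : IsAmplitude α A F F') {r : ℝ} {ω : ℂ} (hω : 0 < ω.im) (hα : 0 < α) (hr : 0 ≤ r) :
    IntegrableOn (fun s : ℝ => Complex.exp (2 * Complex.I * ω * s) * F (r + s)) (Set.Ioi 1) := by
  have hA := h.nonneg
  have hi : IntegrableOn (fun s : ℝ => A * Real.exp (-(2 * ω.im) * s)) (Set.Ioi 1) :=
    (integrableOn_exp_mul_Ioi (by linarith) 1).const_mul A
  refine hi.mono' ?_
    ((ae_restrict_iff' measurableSet_Ioi).mpr (Eventually.of_forall fun s hs => ?_))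
  · exact (((by fun_prop : Continuous fun s : ℝ =>
      Complex.exp (2 * Complex.I * ω * s)).measurable).mul
      (h.measurable.comp (measurable_const_add r))).aestronglyMeasurable
  · have hs' : 1 < s := hs
    have e : (2 * Complex.I * ω * s).re = -(2 * ω.im) * s := by simp
    rw [norm_mul, Complex.norm_exp, e, mul_comm]
    gcongr
    refine (h.bound _ (by linarith)).trans ?_
    have : (r + s) ^ (-α) ≤ 1 := Real.rpow_le_one_of_one_le_of_nonpos (by linarith) (by linarith)
    nlinarith

/-- For Im ω > 0 the original integral converges absolutely, and integration by parts on (1,∞) has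
no contribution from infinity. This links the kernel to the expression that survives δ → 0. -/
lemma integral_eq_oscIntegral (h : IsAmplitude α A F F') {r : ℝ} {ω : ℂ} (hω : 0 < ω.im) (hα : 0 < α) (hr : 0 ≤ r) :
    ∫ s in Set.Ioi (0 : ℝ), Complex.exp (2 * Complex.I * ω * s) * F (r + s) =
      oscIntegral r F F' ω := by
  have hA := h.nonneg
  have hω0 : 2 * Complex.I * ω ≠ 0 := by
    have : ω ≠ 0 := fun h0 => by simp [h0] at hω
    simp [this]
  have i1 := h.integrableOn_Ioi_one hω hα hr
  have i0 := h.integrableOn_near hω.le hα hr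
  rw [← Set.Ioc_union_Ioi_eq_Ioi (zero_le_one' ℝ), setIntegral_union
    (Set.Ioc_disjoint_Ioi le_rfl) measurableSet_Ioi i0 i1, oscIntegral, sub_eq_add_neg]
  congr 1
  have shift : ∀ φ : ℝ → ℂ, ∫ s in Set.Ioi (1 : ℝ), φ s = ∫ s in Set.Ioi (0 : ℝ), φ (s + 1) := by
    intro φ
    have := (measurePreserving_add_right volume (1 : ℝ)).setIntegral_preimage_emb
      (measurableEmbedding_addRight 1) φ (Set.Ioi 1)
    rw [← this]; simp
  have i1' : IntegrableOn (fun s : ℝ => Complex.exp (2 * Complex.I * ω * (s + 1 : ℝ)) *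
      F (r + (s + 1))) (Set.Ioi 0) := by
    have := (measurePreserving_add_right volume (1 : ℝ)).integrableOn_comp_preimage
      (measurableEmbedding_addRight 1) (f := fun s : ℝ => Complex.exp (2 * Complex.I * ω * s) *
        F (r + s)) (s := Set.Ioi 1)
    rw [← this] at i1
    simpa [Function.comp_def] using i1
  rw [shift]
  have i2 := h.integrableOn_far hω.le hα hr
  have dF : ∀ s ∈ Set.Ici (0 : ℝ), HasDerivAt (fun s : ℝ => F (r + (s + 1))) (F' (r + 1 + s)) s :=
    fun s hs => by
      have hs' : 0 ≤ s := hs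
      have h1 := (h.hasDerivAt (r + (s + 1)) (by linarith)).scomp s
        (((hasDerivAt_id s).add_const 1).const_add r)
      simp only [one_smul] at h1
      rw [show r + 1 + s = r + (s + 1) by ring]
      exact h1
  have dE : ∀ s : ℝ, HasDerivAt (fun s : ℝ => Complex.exp (2 * Complex.I * ω * (s + 1 : ℝ)) /
      (2 * Complex.I * ω)) (Complex.exp (2 * Complex.I * ω * (s + 1 : ℝ))) s := fun s => by
    have h1 := ((((hasDerivAt_id s).add_const 1).ofReal_comp).const_mul
      (2 * Complex.I * ω)).cexp.div_const (2 * Complex.I * ω)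
    convert! h1 using 1
    simp only [id, Complex.ofReal_one, mul_one]
    rw [mul_div_assoc, div_self hω0, mul_one]
  -- The antiderivative of the exponential is taken as e^{2iω(s+1)}/(2iω) after shifting s by 1; its
  -- value at s = 0 gives the boundary term.
  have key := integral_Ioi_mul_deriv_eq_deriv_mul (a := 0) (a' := F (r + 1) *
    (Complex.exp (2 * Complex.I * ω) / (2 * Complex.I * ω))) (b' := 0)
    (fun s hs => dF s (Set.mem_Ici_of_Ioi hs)) (fun s _ => dE s) ?_ ?_ ?_ ?_
  · simp only [mul_comm (F _)] at key
    rw [key, zero_sub, mul_add, neg_add, ← sub_eq_add_neg]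
    congr 1
    rw [← integral_const_mul]
    refine integral_congr_ae (Eventually.of_forall fun s => ?_)
    simp only
    push_cast
    rw [mul_add, Complex.exp_add]
    field_simp
  · convert! i1' using 2
    exact mul_comm _ _
  · refine (i2.const_mul (Complex.exp (2 * Complex.I * ω) / (2 * Complex.I * ω))).congr
      (Eventually.of_forall fun s => ?_)
    simp only [Pi.mul_apply]
    push_cast
    rw [mul_add, Complex.exp_add]
    field_simp
  · have := ((dF 0 (by simp)).continuousAt.mul (dE 0).continuousAt).tendsto
    simp only [Pi.mul_apply, zero_add, Complex.ofReal_one, mul_one] at this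
    exact this.mono_left nhdsWithin_le_nhds
  · refine squeeze_zero_norm' (a := fun s : ℝ => A * Real.exp (-(2 * ω.im) * (s + 1)) /
      ‖2 * Complex.I * ω‖) ?_ ?_
    · filter_upwards [eventually_ge_atTop 0] with s hs
      have e : (2 * Complex.I * ω * (s + 1 : ℝ)).re = -(2 * ω.im) * (s + 1) := by
        rw [Complex.re_mul_ofReal]; simp
      rw [Pi.mul_apply, norm_mul, norm_div, Complex.norm_exp, e, mul_div_assoc]
      gcongr
      refine (h.bound _ (by linarith)).trans ?_
      have : (r + (s + 1)) ^ (-α) ≤ 1 :=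
        Real.rpow_le_one_of_one_le_of_nonpos (by linarith) (by linarith)
      nlinarith
    · have t1 : Tendsto (fun s : ℝ => -(2 * ω.im) * (s + 1)) atTop atBot :=
        (tendsto_atTop_add_const_right _ 1 tendsto_id).const_mul_atTop_of_neg (by linarith)
      have := ((Real.tendsto_exp_atBot.comp t1).const_mul A).div_const ‖2 * Complex.I * ω‖
      simpa using this

end IsAmplitude

end TwoSoliton

/-! ### The free Schrödinger amplitude and the resolvent symbol -/

namespace TwoSoliton

/-- The phase `exp (i z² / (2τ))` of the free Schrödinger kernel. -/
def freePhase (z τ : ℝ) : ℂ := Complex.exp (((z ^ 2 / (2 * τ) : ℝ) : ℂ) * Complex.I)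

lemma norm_freePhase (z τ : ℝ) : ‖freePhase z τ‖ = 1 := Complex.norm_exp_ofReal_mul_I _

/-- The free Schrödinger kernel, up to a constant. -/
def freeAmp (z τ : ℝ) : ℂ := ((τ ^ (-(1 / 2) : ℝ) : ℝ) : ℂ) * freePhase z τ

def freeAmpDeriv (z τ : ℝ) : ℂ :=
  ((-(1 / 2) * τ ^ (-(3 / 2) : ℝ) : ℝ) : ℂ) * freePhase z τ
    - Complex.I * ((z ^ 2 / 2 * τ ^ (-(5 / 2) : ℝ) : ℝ) : ℂ) * freePhase z τ

lemma measurable_freePhase (z : ℝ) : Measurable (freePhase z) := by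
  unfold freePhase; fun_prop

lemma measurable_freeAmp (z : ℝ) : Measurable (freeAmp z) := by
  have := measurable_freePhase z
  unfold freeAmp; fun_prop

lemma measurable_freeAmpDeriv (z : ℝ) : Measurable (freeAmpDeriv z) := by
  have := measurable_freePhase z
  unfold freeAmpDeriv; fun_prop

lemma hasDerivAt_freeAmp (z : ℝ) {τ : ℝ} (hτ : 0 < τ) :
    HasDerivAt (freeAmp z) (freeAmpDeriv z τ) τ := by
  have h1 : HasDerivAt (fun τ : ℝ => ((τ ^ (-(1 / 2) : ℝ) : ℝ) : ℂ))
      ((-(1 / 2) * τ ^ (-(3 / 2) : ℝ) : ℝ) : ℂ) τ := by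
    have := (Real.hasDerivAt_rpow_const (x := τ) (p := -(1 / 2)) (Or.inl hτ.ne')).ofReal_comp
    convert! this using 3
    norm_num
  have h2 : HasDerivAt (fun τ : ℝ => z ^ 2 / (2 * τ)) (-(z ^ 2 / (2 * τ ^ 2))) τ := by
    have := (((hasDerivAt_id τ).const_mul 2).fun_inv (by simpa using hτ.ne')).const_mul (z ^ 2)
    convert! this using 1
    simp only [id]; field_simp
  have h3 : HasDerivAt (freePhase z)
      (freePhase z τ * (((-(z ^ 2 / (2 * τ ^ 2)) : ℝ) : ℂ) * Complex.I)) τ :=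
    (h2.ofReal_comp.mul_const Complex.I).cexp
  refine (h1.mul h3).congr_deriv ?_
  have e : τ ^ (-(5 / 2) : ℝ) = τ ^ (-(1 / 2) : ℝ) * (τ ^ 2)⁻¹ := by
    rw [← Real.rpow_natCast, ← Real.rpow_neg hτ.le, ← Real.rpow_add hτ]; norm_num
  rw [freeAmpDeriv, e]
  push_cast
  field_simp
  ring

lemma norm_freePhase_sub_le (z : ℝ) {τ : ℝ} (hτ : 0 < τ) :
    ‖freePhase z τ - 1‖ ≤ z ^ 2 / 2 * τ ^ (-1 : ℝ) := by
  have := Real.norm_exp_I_mul_ofReal_sub_one_le (x := z ^ 2 / (2 * τ))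
  rw [mul_comm] at this
  refine this.trans (le_of_eq ?_)
  rw [Real.norm_of_nonneg (by positivity), Real.rpow_neg_one]
  field_simp

lemma freePhase_zero (τ : ℝ) : freePhase 0 τ = 1 := by simp [freePhase]

/-- Differentiating the phase gives z²/2 · τ^{-5/2}, which for τ ≥ 1 is within the τ^{-3/2} scale;
this is where the growth in z enters. -/
lemma isAmplitude_freeAmp (z : ℝ) :
    IsAmplitude (1 / 2) (1 + z ^ 2) (freeAmp z) (freeAmpDeriv z) := by
  have b : ∀ τ : ℝ, 0 < τ → ‖freeAmp z τ‖ ≤ (1 + z ^ 2) * τ ^ (-(1 / 2) : ℝ) := fun τ hτ => by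
    have := Real.rpow_nonneg hτ.le (-(1 / 2))
    rw [freeAmp, norm_mul, norm_freePhase, mul_one, Complex.norm_of_nonneg this]
    nlinarith [mul_nonneg this (sq_nonneg z)]
  refine ⟨measurable_freeAmp z, measurable_freeAmpDeriv z, fun τ => hasDerivAt_freeAmp z, b,
    fun τ hτ => b τ (by linarith), fun τ hτ => ?_⟩
  have hτ0 : 0 < τ := by linarith
  have h3 := Real.rpow_nonneg hτ0.le (-(3 / 2))
  have h5 := Real.rpow_nonneg hτ0.le (-(5 / 2))
  have h53 : τ ^ (-(5 / 2) : ℝ) ≤ τ ^ (-(3 / 2) : ℝ) :=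
    Real.rpow_le_rpow_of_exponent_le hτ (by norm_num)
  rw [show -(1 / 2) - 1 = (-(3 / 2) : ℝ) by norm_num, freeAmpDeriv]
  refine (norm_sub_le _ _).trans ?_
  simp only [norm_mul, norm_freePhase, Complex.norm_I, mul_one, one_mul, Complex.norm_real,
    norm_neg, Real.norm_of_nonneg h3, Real.norm_of_nonneg h5, Complex.ofReal_mul]
  rw [Real.norm_of_nonneg (by positivity : 0 ≤ z ^ 2 / 2),
    Real.norm_of_nonneg (by norm_num : (0 : ℝ) ≤ 1 / 2)]
  nlinarith [mul_nonneg h3 (sq_nonneg z), mul_le_mul_of_nonneg_left h53 (sq_nonneg z)]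

/-- The inequality |e^{iy} - 1| ≤ |y| at y = z²/(2τ) gains a factor τ⁻¹ at the price of z², both for
the amplitude and its derivative. Near τ = 0 the trivial bound 2 on the difference of phases is
used. -/
lemma isAmplitude_freeAmp_sub (z : ℝ) :
    IsAmplitude (3 / 2) (2 * (1 + z ^ 2)) (fun τ => freeAmp z τ - freeAmp 0 τ)
      (fun τ => freeAmpDeriv z τ - freeAmpDeriv 0 τ) := by
  have e : ∀ τ, freeAmp z τ - freeAmp 0 τ =
      ((τ ^ (-(1 / 2) : ℝ) : ℝ) : ℂ) * (freePhase z τ - 1) := fun τ => by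
    rw [freeAmp, freeAmp, freePhase_zero]; ring
  refine ⟨(measurable_freeAmp z).sub (measurable_freeAmp 0),
    (measurable_freeAmpDeriv z).sub (measurable_freeAmpDeriv 0),
    fun τ hτ => (hasDerivAt_freeAmp z hτ).sub (hasDerivAt_freeAmp 0 hτ), fun τ hτ => ?_,
    fun τ hτ => ?_, fun τ hτ => ?_⟩
  · have := Real.rpow_nonneg hτ.le (-(1 / 2))
    have h2 : ‖freePhase z τ - 1‖ ≤ 2 := by
      refine (norm_sub_le _ _).trans ?_
      rw [norm_freePhase, norm_one]; norm_num
    rw [e, norm_mul, Complex.norm_of_nonneg this, mul_comm]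
    gcongr
    nlinarith [sq_nonneg z]
  · have hτ0 : 0 < τ := by linarith
    have h1 := Real.rpow_nonneg hτ0.le (-(1 / 2))
    have h3 := Real.rpow_nonneg hτ0.le (-(3 / 2))
    have e3 : τ ^ (-(1 / 2) : ℝ) * τ ^ (-1 : ℝ) = τ ^ (-(3 / 2) : ℝ) := by
      rw [← Real.rpow_add hτ0]; norm_num
    rw [e, norm_mul, Complex.norm_of_nonneg h1]
    calc _ ≤ τ ^ (-(1 / 2) : ℝ) * (z ^ 2 / 2 * τ ^ (-1 : ℝ)) := by
          gcongr; exact norm_freePhase_sub_le z hτ0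
      _ = z ^ 2 / 2 * τ ^ (-(3 / 2) : ℝ) := by rw [← e3]; ring
      _ ≤ _ := by gcongr; nlinarith [sq_nonneg z]
  · have hτ0 : 0 < τ := by linarith
    have h3 := Real.rpow_nonneg hτ0.le (-(3 / 2))
    have h5 := Real.rpow_nonneg hτ0.le (-(5 / 2))
    have e5 : τ ^ (-(3 / 2) : ℝ) * τ ^ (-1 : ℝ) = τ ^ (-(5 / 2) : ℝ) := by
      rw [← Real.rpow_add hτ0]; norm_num
    have ed : freeAmpDeriv z τ - freeAmpDeriv 0 τ =
        ((-(1 / 2) * τ ^ (-(3 / 2) : ℝ) : ℝ) : ℂ) * (freePhase z τ - 1)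
          - Complex.I * ((z ^ 2 / 2 * τ ^ (-(5 / 2) : ℝ) : ℝ) : ℂ) * freePhase z τ := by
      rw [freeAmpDeriv, freeAmpDeriv, freePhase_zero]; push_cast; ring
    rw [ed, show -(3 / 2) - 1 = (-(5 / 2) : ℝ) by norm_num]
    refine (norm_sub_le _ _).trans ?_
    simp only [norm_mul, norm_freePhase, Complex.norm_I, mul_one, one_mul, Complex.norm_real,
      norm_neg, Real.norm_of_nonneg h3, Real.norm_of_nonneg h5, Complex.ofReal_mul]
    rw [Real.norm_of_nonneg (by positivity : 0 ≤ z ^ 2 / 2),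
      Real.norm_of_nonneg (by norm_num : (0 : ℝ) ≤ 1 / 2)]
    have := mul_le_mul_of_nonneg_left (norm_freePhase_sub_le z hτ0) h3
    have e6 : τ ^ (-(3 / 2) : ℝ) * (z ^ 2 / 2 * τ ^ (-1 : ℝ)) = z ^ 2 / 2 * τ ^ (-(5 / 2) : ℝ) := by
      rw [← e5]; ring
    rw [e6] at this
    nlinarith [mul_nonneg h5 (sq_nonneg z)]

/-- The spectral multiplier of `(B - 2μ - 2iκδ)⁻¹ exp (-iκrB)` on the continuous subspace. -/
def resolventSymbol (μ κ r δ l : ℝ) : ℂ :=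
  (2 * (l : ℂ) ^ 2 - (2 * μ + 2 * Complex.I * κ * δ))⁻¹ *
    Complex.exp (-(2 * Complex.I * (l : ℂ) ^ 2 * (κ * r : ℝ)))

/-- The Fourier transform of `resolventSymbol`. -/
def freeKernel (μ κ r δ z : ℝ) : ℂ :=
  ∫ l : ℝ, resolventSymbol μ κ r δ l * Complex.exp (2 * Complex.I * l * z)

section Symbol

variable {μ κ r δ : ℝ}

lemma norm_cexp_two_mul_I_mul (l z : ℝ) : ‖Complex.exp (2 * Complex.I * l * z)‖ = 1 := by
  rw [show 2 * Complex.I * l * z = ((2 * l * z : ℝ) : ℂ) * Complex.I by push_cast; ring]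
  exact Complex.norm_exp_ofReal_mul_I _

lemma norm_cexp_evolution (l t : ℝ) : ‖Complex.exp (-(2 * Complex.I * (l : ℂ) ^ 2 * t))‖ = 1 := by
  rw [show -(2 * Complex.I * (l : ℂ) ^ 2 * t) = ((-(2 * l ^ 2 * t) : ℝ) : ℂ) * Complex.I by
    push_cast; ring]
  exact Complex.norm_exp_ofReal_mul_I _

lemma resolvent_ne_zero (hκ : κ = 1 ∨ κ = -1) (hδ : 0 < δ) (l : ℝ) :
    2 * (l : ℂ) ^ 2 - (2 * μ + 2 * Complex.I * κ * δ) ≠ 0 := fun h0 => by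
  have h1 := congrArg Complex.im h0
  have e : (2 * (l : ℂ) ^ 2 - (2 * μ + 2 * Complex.I * κ * δ)).im = -(2 * κ * δ) := by
    simp [pow_two]
  rw [e, Complex.zero_im] at h1
  rcases hκ with rfl | rfl <;> linarith

/-- Let w be the complex number inverted in the symbol. Its real part gives l² ≤ |w|/2 + |μ|, its
imaginary part |w| ≥ 2δ; the second converts 1 + |μ| into a multiple of |w|. The bound degenerates
as δ → 0 and only serves integrability at fixed δ. -/
lemma norm_resolventSymbol_le (hκ : κ = 1 ∨ κ = -1) (hδ : 0 < δ) (l : ℝ) :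
    ‖resolventSymbol μ κ r δ l‖ ≤ (1 / 2 + (1 + |μ|) / (2 * δ)) * (1 + l ^ 2)⁻¹ := by
  rw [resolventSymbol, norm_mul, norm_cexp_evolution, mul_one, norm_inv]
  set w : ℂ := 2 * (l : ℂ) ^ 2 - (2 * μ + 2 * Complex.I * κ * δ) with hw
  have hre : w.re = 2 * l ^ 2 - 2 * μ := by simp [hw, pow_two]
  have him : w.im = -(2 * κ * δ) := by simp [hw, pow_two]
  have h1 := Complex.abs_re_le_norm w
  have h2 := Complex.abs_im_le_norm w
  rw [hre] at h1
  have h2' : 2 * δ ≤ ‖w‖ := by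
    rw [him] at h2
    refine le_trans ?_ h2
    rcases hκ with rfl | rfl
    · rw [abs_neg]; exact (by linarith : 2 * δ ≤ 2 * 1 * δ).trans (le_abs_self _)
    · exact (by linarith : 2 * δ ≤ -(2 * -1 * δ)).trans (le_abs_self _)
  have hpos : 0 < ‖w‖ := by linarith
  have h3 : 1 + |μ| ≤ (1 + |μ|) / (2 * δ) * ‖w‖ := by
    rw [div_mul_eq_mul_div, le_div_iff₀ (by linarith)]
    have := abs_nonneg μ
    gcongr
  rw [← div_eq_mul_inv, le_div_iff₀ (by positivity), inv_mul_le_iff₀ hpos]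
  have := le_abs_self (2 * l ^ 2 - 2 * μ)
  have := le_abs_self μ
  linarith

lemma continuous_resolventSymbol (hκ : κ = 1 ∨ κ = -1) (hδ : 0 < δ) :
    Continuous (resolventSymbol μ κ r δ) := by
  unfold resolventSymbol
  refine Continuous.mul (Continuous.inv₀ (by fun_prop) (resolvent_ne_zero hκ hδ)) (by fun_prop)

lemma integrable_resolventSymbol (hκ : κ = 1 ∨ κ = -1) (hδ : 0 < δ) :
    Integrable (resolventSymbol μ κ r δ) :=
  (integrable_inv_one_add_sq.const_mul _).mono'
    (continuous_resolventSymbol hκ hδ).aestronglyMeasurable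
    (Eventually.of_forall (norm_resolventSymbol_le hκ hδ))

lemma resolventSymbol_neg (l : ℝ) : resolventSymbol μ κ r δ (-l) = resolventSymbol μ κ r δ l := by
  simp [resolventSymbol]

lemma norm_freeKernel_le (z : ℝ) :
    ‖freeKernel μ κ r δ z‖ ≤ ∫ l : ℝ, ‖resolventSymbol μ κ r δ l‖ := by
  refine (norm_integral_le_integral_norm _).trans (le_of_eq ?_)
  simp only [norm_mul, norm_cexp_two_mul_I_mul, mul_one]

lemma continuous_freeKernel (hκ : κ = 1 ∨ κ = -1) (hδ : 0 < δ) :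
    Continuous (freeKernel μ κ r δ) := by
  have hc := continuous_resolventSymbol (μ := μ) (r := r) hκ hδ
  refine continuous_of_dominated (bound := fun l => ‖resolventSymbol μ κ r δ l‖) (fun z => ?_)
    (fun z => Eventually.of_forall fun l => ?_) (integrable_resolventSymbol hκ hδ).norm
    (Eventually.of_forall fun l => by fun_prop)
  · exact (hc.mul (by fun_prop)).aestronglyMeasurable
  · rw [norm_mul, norm_cexp_two_mul_I_mul, mul_one]

/-- Conjugation reverses the sign of κ in both factors of the symbol, which is even in λ; the
substitution λ → -λ repairs the exponential. Hence only κ = 1 needs analysis. -/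
lemma freeKernel_neg_one (z : ℝ) :
    freeKernel μ (-1) r δ z = starRingEnd ℂ (freeKernel μ 1 r δ z) := by
  rw [freeKernel, freeKernel, ← integral_conj,
    ← integral_neg_eq_self (fun l : ℝ => starRingEnd ℂ (resolventSymbol μ 1 r δ l *
      Complex.exp (2 * Complex.I * l * z)))]
  refine integral_congr_ae (Eventually.of_forall fun l => ?_)
  have c2 : starRingEnd ℂ 2 = 2 := map_ofNat _ 2
  simp only [resolventSymbol_neg]
  rw [map_mul]
  congr 1
  · simp only [resolventSymbol, map_mul, map_inv₀, map_sub, ← Complex.exp_conj]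
    congr 2
    · simp [c2]
    · simp [c2]
  · rw [← Complex.exp_conj]
    congr 1
    simp [c2]

end Symbol

end TwoSoliton

/-! ### The free kernel as a time integral, and its decay -/

namespace TwoSoliton

lemma IsAmplitude.mono {α A B : ℝ} {F F' : ℝ → ℂ} (h : IsAmplitude α A F F') (hAB : A ≤ B) :
    IsAmplitude α B F F' where
  measurable := h.measurable
  measurable_deriv := h.measurable_deriv
  hasDerivAt := h.hasDerivAt
  bound_zero τ hτ := (h.bound_zero τ hτ).trans (by gcongr)
  bound τ hτ := (h.bound τ hτ).trans (by gcongr)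
  bound_deriv τ hτ := (h.bound_deriv τ hτ).trans (by gcongr)

lemma IsAmplitude.integrableOn {α A r : ℝ} {F F' : ℝ → ℂ} (h : IsAmplitude α A F F') {ω : ℂ}
    (hω : 0 < ω.im) (hα : 0 < α) (hr : 0 ≤ r) :
    IntegrableOn (fun s : ℝ => Complex.exp (2 * Complex.I * ω * s) * F (r + s)) (Set.Ioi 0) := by
  rw [← Set.Ioc_union_Ioi_eq_Ioi (zero_le_one' ℝ)]
  exact (h.integrableOn_near hω.le hα hr).union (h.integrableOn_Ioi_one hω hα hr)

/-- The Fourier transform of `exp (-(ε + 2iτ) l²)`. -/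
def gaussAmp (ε z τ : ℝ) : ℂ :=
  (Real.pi / (ε + 2 * Complex.I * τ) : ℂ) ^ (1 / 2 : ℂ) *
    Complex.exp (-(z : ℂ) ^ 2 / (ε + 2 * Complex.I * τ))

/-- `(π / 2i)^{1/2}`. -/
def gaussConst : ℂ := (Real.pi / (2 * Complex.I) : ℂ) ^ (1 / 2 : ℂ)

/-- The positive factor τ⁻¹ can be pulled out of the principal square root without crossing the
branch cut. -/
lemma gaussAmp_zero (z : ℝ) {τ : ℝ} (hτ : 0 < τ) : gaussAmp 0 z τ = gaussConst * freeAmp z τ := by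
  have hne : (Real.pi / (2 * Complex.I) : ℂ) ≠ 0 := by simp [Real.pi_ne_zero]
  have hτ' : (τ : ℂ) ≠ 0 := by exact_mod_cast hτ.ne'
  have e1 : (Real.pi / ((0 : ℝ) + 2 * Complex.I * τ) : ℂ) =
      ((τ⁻¹ : ℝ) : ℂ) * (Real.pi / (2 * Complex.I)) := by
    push_cast; rw [zero_add]; field_simp
  rw [gaussAmp, freeAmp, freePhase, gaussConst, e1, Complex.cpow_def_of_ne_zero
    (mul_ne_zero (by exact_mod_cast (inv_pos.mpr hτ).ne') hne), Complex.cpow_def_of_ne_zero hne,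
    Complex.log_ofReal_mul (inv_pos.mpr hτ) hne, add_mul, Complex.exp_add,
    Real.rpow_def_of_pos hτ, Real.log_inv]
  have e2 : (-(z : ℂ) ^ 2 / ((0 : ℝ) + 2 * Complex.I * τ) : ℂ) =
      ((z ^ 2 / (2 * τ) : ℝ) : ℂ) * Complex.I := by
    push_cast
    rw [zero_add]
    field_simp
    rw [Complex.I_sq]; ring
  rw [e2]
  push_cast
  ring_nf

lemma tendsto_gaussAmp (z : ℝ) {τ : ℝ} (hτ : 0 < τ) :
    Tendsto (fun ε => gaussAmp ε z τ) (𝓝[>] 0) (𝓝 (gaussAmp 0 z τ)) := by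
  refine Tendsto.mono_left (ContinuousAt.tendsto (x := (0 : ℝ)) ?_) nhdsWithin_le_nhds
  have hτ' : (τ : ℂ) ≠ 0 := by exact_mod_cast hτ.ne'
  have hb : ((0 : ℝ) + 2 * Complex.I * τ : ℂ) ≠ 0 := by simp [hτ']
  have c1 : ContinuousAt (fun ε : ℝ => (ε + 2 * Complex.I * τ : ℂ)) 0 :=
    Continuous.continuousAt (by fun_prop)
  refine ContinuousAt.mul (ContinuousAt.cpow (ContinuousAt.div continuousAt_const c1 hb)
    continuousAt_const ?_) ((ContinuousAt.div continuousAt_const c1 hb).cexp)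
  have e : (Real.pi / ((0 : ℝ) + 2 * Complex.I * τ) : ℂ) =
      ((-(Real.pi / (2 * τ)) : ℝ) : ℂ) * Complex.I := by
    push_cast; rw [zero_add]; field_simp; rw [Complex.I_sq]; ring
  rw [e, Complex.mem_slitPlane_iff]
  right
  rw [Complex.im_ofReal_mul, Complex.I_im, mul_one]
  -- At ε = 0 the base of the power lies on the negative imaginary axis, off the cut.
  exact neg_ne_zero.mpr (div_pos Real.pi_pos (by linarith)).ne'

lemma norm_gaussAmp_le {ε : ℝ} (hε : 0 < ε) (z : ℝ) {τ : ℝ} (hτ : 0 < τ) :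
    ‖gaussAmp ε z τ‖ ≤ (Real.pi / 2) ^ (1 / 2 : ℝ) * τ ^ (-(1 / 2) : ℝ) := by
  set b : ℂ := ε + 2 * Complex.I * τ with hb
  have hre : b.re = ε := by simp [hb]
  have him : b.im = 2 * τ := by simp [hb]
  have h1 : 2 * τ ≤ ‖b‖ := by
    have := Complex.abs_im_le_norm b
    rw [him] at this
    exact (le_abs_self _).trans this
  have h2 : ‖Complex.exp (-(z : ℂ) ^ 2 / b)‖ ≤ 1 := by
    rw [Complex.norm_exp]
    refine Real.exp_le_one_iff.mpr ?_
    have e : (-(z : ℂ) ^ 2 / b) = ((-z ^ 2 : ℝ) : ℂ) * b⁻¹ := by push_cast; ring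
    rw [e, Complex.re_ofReal_mul, Complex.inv_re, hre]
    have : 0 ≤ ε / Complex.normSq b := div_nonneg hε.le (Complex.normSq_nonneg _)
    nlinarith [mul_nonneg (sq_nonneg z) this]
  have h3 : ‖(Real.pi / b : ℂ) ^ (1 / 2 : ℂ)‖ ≤ (Real.pi / 2) ^ (1 / 2 : ℝ) * τ ^ (-(1 / 2) : ℝ) := by
    rw [show (1 / 2 : ℂ) = ((1 / 2 : ℝ) : ℂ) by push_cast; rfl, Complex.norm_cpow_real, norm_div,
      Complex.norm_of_nonneg Real.pi_pos.le, Real.rpow_neg hτ.le, ← Real.inv_rpow hτ.le,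
      ← Real.mul_rpow (by positivity) (by positivity)]
    refine Real.rpow_le_rpow (by positivity) ?_ (by norm_num)
    rw [← div_eq_mul_inv, div_div]
    gcongr
  rw [gaussAmp, norm_mul]
  calc _ ≤ ((Real.pi / 2) ^ (1 / 2 : ℝ) * τ ^ (-(1 / 2) : ℝ)) * 1 := by gcongr
    _ = _ := mul_one _

lemma measurable_gaussAmp (ε z : ℝ) : Measurable (gaussAmp ε z) := by
  unfold gaussAmp; fun_prop

section Symbol

variable {μ r δ : ℝ}

/-- Converges because δ > 0 damps the exponential. The factor e^{-2iλ²s} continues the evolution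
e^{-2iλ²r} forward in time, so r and s enter only through r + s. -/
lemma inv_eq_integral (hδ : 0 < δ) (l : ℝ) :
    (2 * (l : ℂ) ^ 2 - (2 * μ + 2 * Complex.I * (1 : ℝ) * δ))⁻¹ =
      Complex.I * ∫ s in Set.Ioi (0 : ℝ),
        Complex.exp ((-(2 * Complex.I * ((l : ℂ) ^ 2 - (μ + Complex.I * δ)))) * s) := by
  have hne := resolvent_ne_zero (μ := μ) (Or.inl rfl) hδ l
  rw [integral_exp_mul_complex_Ioi (by simp [pow_two, hδ])]
  have e : (-(2 * Complex.I * ((l : ℂ) ^ 2 - (μ + Complex.I * δ)))) =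
    -(Complex.I * (2 * (l : ℂ) ^ 2 - (2 * μ + 2 * Complex.I * (1 : ℝ) * δ))) := by
    push_cast; ring
  rw [e]
  simp only [Complex.ofReal_zero, mul_zero, Complex.exp_zero]
  field_simp

/-- Without the Gaussian the double integrand has modulus e^{-2δs}, not integrable in λ, and Fubini
fails; with it the inner integral is an explicit Gaussian transform. -/
lemma integral_gaussian_mul_resolventSymbol (hδ : 0 < δ) {ε : ℝ} (hε : 0 < ε) (z : ℝ) :
    ∫ l : ℝ, Complex.exp (-((ε * l ^ 2 : ℝ) : ℂ)) *
        (resolventSymbol μ 1 r δ l * Complex.exp (2 * Complex.I * l * z)) =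
      Complex.I * ∫ s in Set.Ioi (0 : ℝ),
        Complex.exp (2 * Complex.I * (μ + Complex.I * δ) * s) * gaussAmp ε z (r + s) := by
  set Φ : ℝ → ℝ → ℂ := fun l s => Complex.exp (-((ε * l ^ 2 : ℝ) : ℂ)) *
    Complex.exp (2 * Complex.I * (μ + Complex.I * δ) * s) *
    Complex.exp (2 * Complex.I * l * z) * Complex.exp (-(2 * Complex.I * (l : ℂ) ^ 2 * (r + s : ℝ)))
    with hΦ
  have hint : Integrable (Function.uncurry Φ) (volume.prod (volume.restrict (Set.Ioi (0 : ℝ)))) := by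
    have i1 : Integrable fun l : ℝ => Real.exp (-ε * l ^ 2) := integrable_exp_neg_mul_sq hε
    have i2 : IntegrableOn (fun s : ℝ => Real.exp (-(2 * δ) * s)) (Set.Ioi 0) :=
      integrableOn_exp_mul_Ioi (by linarith) 0
    refine (i1.mul_prod i2).mono' ?_ (Eventually.of_forall fun q => le_of_eq ?_)
    · exact Continuous.aestronglyMeasurable (by simp only [Φ, Function.uncurry_def]; fun_prop)
    · simp only [Φ, Function.uncurry, norm_mul]
      rw [norm_cexp_two_mul_I_mul, norm_cexp_evolution, mul_one, mul_one, Complex.norm_exp,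
        Complex.norm_exp, Complex.neg_re, Complex.ofReal_re, neg_mul]
      congr 2
      simp
  have h1 : ∀ l : ℝ, Complex.exp (-((ε * l ^ 2 : ℝ) : ℂ)) *
      (resolventSymbol μ 1 r δ l * Complex.exp (2 * Complex.I * l * z)) =
      Complex.I * ∫ s in Set.Ioi (0 : ℝ), Φ l s := fun l => by
    rw [resolventSymbol, inv_eq_integral hδ]
    rw [show ∀ a b c d : ℂ, a * (Complex.I * b * c * d) = Complex.I * ((a * c * d) * b) by
      intros; ring, ← integral_const_mul]
    congr 1
    refine integral_congr_ae (Eventually.of_forall fun s => ?_)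
    simp only [Φ, ← Complex.exp_add]
    congr 1
    push_cast; ring
  simp only [h1]
  rw [integral_const_mul, integral_integral_swap hint]
  congr 1
  refine integral_congr_ae (Eventually.of_forall fun s => ?_)
  have hb : 0 < (ε + 2 * Complex.I * (r + s : ℝ) : ℂ).re := by simpa using hε
  -- The kernel e^{2iλz} has frequency 2z, hence the quotient (2z)²/4 = z² in the exponent.
  have h2 := fourierIntegral_gaussian hb (2 * z)
  simp only [gaussAmp]
  rw [show -(z : ℂ) ^ 2 / (ε + 2 * Complex.I * (r + s : ℝ)) =
    -(2 * z : ℂ) ^ 2 / (4 * (ε + 2 * Complex.I * (r + s : ℝ))) by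
      rw [mul_pow, ← mul_neg, show (2 : ℂ) ^ 2 = 4 by norm_num, mul_div_mul_left _ _ (by norm_num)],
    ← h2, ← integral_const_mul]
  refine integral_congr_ae (Eventually.of_forall fun l => ?_)
  simp only [Φ, ← Complex.exp_add]
  congr 1
  push_cast; ring

/-- Both sides of the regularized identity pass to the limit ε → 0 by dominated convergence. -/
lemma freeKernel_eq_integral (hr : 0 ≤ r) (hδ : 0 < δ) (z : ℝ) :
    freeKernel μ 1 r δ z = Complex.I * gaussConst * ∫ s in Set.Ioi (0 : ℝ),
        Complex.exp (2 * Complex.I * (μ + Complex.I * δ) * s) * freeAmp z (r + s) := by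
  have hc := continuous_resolventSymbol (μ := μ) (r := r) (Or.inl rfl) hδ
  have t1 : Tendsto (fun ε : ℝ => ∫ l : ℝ, Complex.exp (-((ε * l ^ 2 : ℝ) : ℂ)) *
        (resolventSymbol μ 1 r δ l * Complex.exp (2 * Complex.I * l * z))) (𝓝[>] 0)
      (𝓝 (freeKernel μ 1 r δ z)) := by
    refine tendsto_integral_filter_of_dominated_convergence (fun l => ‖resolventSymbol μ 1 r δ l‖)
      (Eventually.of_forall fun ε => ?_) ?_ (integrable_resolventSymbol (Or.inl rfl) hδ).norm
      (Eventually.of_forall fun l => ?_)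
    · exact Continuous.aestronglyMeasurable (by fun_prop)
    · filter_upwards [self_mem_nhdsWithin] with ε hε
      refine Eventually.of_forall fun l => ?_
      rw [norm_mul, norm_mul, norm_cexp_two_mul_I_mul, mul_one, Complex.norm_exp]
      refine mul_le_of_le_one_left (norm_nonneg _) (Real.exp_le_one_iff.mpr ?_)
      have : 0 ≤ ε * l ^ 2 := mul_nonneg (le_of_lt hε) (sq_nonneg _)
      rw [Complex.neg_re, Complex.ofReal_re]; linarith
    · have : Continuous fun ε : ℝ => Complex.exp (-((ε * l ^ 2 : ℝ) : ℂ)) *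
        (resolventSymbol μ 1 r δ l * Complex.exp (2 * Complex.I * l * z)) := by fun_prop
      simpa using (this.tendsto 0).mono_left nhdsWithin_le_nhds
  have t2 : Tendsto (fun ε : ℝ => Complex.I * ∫ s in Set.Ioi (0 : ℝ),
        Complex.exp (2 * Complex.I * (μ + Complex.I * δ) * s) * gaussAmp ε z (r + s)) (𝓝[>] 0)
      (𝓝 (Complex.I * ∫ s in Set.Ioi (0 : ℝ),
        Complex.exp (2 * Complex.I * (μ + Complex.I * δ) * s) * gaussAmp 0 z (r + s))) := by
    -- Majorant uniform in ε: the Gaussian amplitude is at most a constant times (r+s)^{-1/2} ≤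
    -- s^{-1/2}, and δ supplies the exponential decay.
    have iB : IntegrableOn (fun s : ℝ => s ^ (-(1 / 2) : ℝ) * Real.exp (-(2 * δ) * s ^ (1 : ℝ)))
        (Set.Ioi 0) :=
      integrableOn_rpow_mul_exp_neg_mul_rpow (by norm_num) one_pos (by linarith)
    refine Tendsto.const_mul _ (tendsto_integral_filter_of_dominated_convergence
      (fun s : ℝ => (Real.pi / 2) ^ (1 / 2 : ℝ) *
        (s ^ (-(1 / 2) : ℝ) * Real.exp (-(2 * δ) * s ^ (1 : ℝ))))
      (Eventually.of_forall fun ε => ?_) ?_ (iB.const_mul _) ?_)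
    · exact (((by fun_prop : Continuous fun s : ℝ =>
        Complex.exp (2 * Complex.I * (μ + Complex.I * δ) * s)).measurable).mul
        ((measurable_gaussAmp ε z).comp (measurable_const_add r))).aestronglyMeasurable
    · filter_upwards [self_mem_nhdsWithin] with ε hε
      refine (ae_restrict_iff' measurableSet_Ioi).mpr (Eventually.of_forall fun s hs => ?_)
      have hs' : 0 < s := hs
      have e : (2 * Complex.I * (μ + Complex.I * δ) * s).re = -(2 * δ) * s := by simp
      rw [norm_mul, Complex.norm_exp, e, Real.rpow_one, mul_comm, ← mul_assoc]
      gcongr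
      refine (norm_gaussAmp_le hε z (by linarith)).trans ?_
      gcongr ?_ * ?_
      exact Real.rpow_le_rpow_of_nonpos hs' (by linarith) (by norm_num)
    · refine (ae_restrict_iff' measurableSet_Ioi).mpr (Eventually.of_forall fun s hs => ?_)
      exact (tendsto_gaussAmp z (add_pos_of_nonneg_of_pos hr hs)).const_mul _
  have t3 := tendsto_nhds_unique t1 (t2.congr' (by
    filter_upwards [self_mem_nhdsWithin] with ε hε
    exact (integral_gaussian_mul_resolventSymbol hδ hε z).symm))
  rw [t3, mul_assoc Complex.I gaussConst, ← integral_const_mul gaussConst]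
  congr 1
  refine setIntegral_congr_fun measurableSet_Ioi fun s hs => ?_
  rw [gaussAmp_zero z (add_pos_of_nonneg_of_pos hr hs)]
  ring

/-- The part of the free kernel that enters in each symmetry class: in the odd case its value at
the origin drops out. -/
def parityKernel (p : Parity) (μ κ r δ z : ℝ) : ℂ :=
  match p with
  | .even => freeKernel μ κ r δ z
  | .odd => freeKernel μ κ r δ z - freeKernel μ κ r δ 0

lemma continuous_parityKernel (p : Parity) {κ : ℝ} (hκ : κ = 1 ∨ κ = -1) (hδ : 0 < δ) :
    Continuous (parityKernel p μ κ r δ) := by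
  have := continuous_freeKernel (μ := μ) (r := r) hκ hδ
  cases p
  · exact this
  · exact this.sub continuous_const

/-- The amplitudes depend on z alone, not on μ, r or δ; this gives the uniformity of the later
bounds. -/
lemma parityKernel_eq_oscIntegral (p : Parity) : ∃ F F' : ℝ → ℝ → ℂ,
    (∀ z, IsAmplitude (rate p) (2 * (1 + z ^ 2)) (F z) (F' z)) ∧
    ∀ μ r δ z : ℝ, 0 ≤ r → 0 < δ → parityKernel p μ 1 r δ z =
      Complex.I * gaussConst * oscIntegral r (F z) (F' z) (μ + Complex.I * δ) := by
  have im : ∀ μ δ : ℝ, (μ + Complex.I * δ : ℂ).im = δ := fun μ δ => by simp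
  have main : ∀ μ r δ z : ℝ, 0 ≤ r → 0 < δ → freeKernel μ 1 r δ z =
      Complex.I * gaussConst * oscIntegral r (freeAmp z) (freeAmpDeriv z) (μ + Complex.I * δ) :=
    fun μ r δ z hr hδ => by
      rw [freeKernel_eq_integral hr hδ, (isAmplitude_freeAmp z).integral_eq_oscIntegral
        (by rw [im]; exact hδ) (by norm_num) hr]
  cases p
  · exact ⟨freeAmp, freeAmpDeriv, fun z => (isAmplitude_freeAmp z).mono (by nlinarith [sq_nonneg z]),
      main⟩
  · refine ⟨_, _, isAmplitude_freeAmp_sub, fun μ r δ z hr hδ => ?_⟩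
    rw [← (isAmplitude_freeAmp_sub z).integral_eq_oscIntegral (by rw [im]; exact hδ)
      (by norm_num) hr, parityKernel, freeKernel_eq_integral hr hδ, freeKernel_eq_integral hr hδ,
      ← mul_sub, ← integral_sub
        ((isAmplitude_freeAmp z).integrableOn (by rw [im]; exact hδ) (by norm_num) hr)
        ((isAmplitude_freeAmp 0).integrableOn (by rw [im]; exact hδ) (by norm_num) hr)]
    simp only [mul_sub]

lemma rate_pos (p : Parity) : 0 < rate p := by cases p <;> norm_num [rate]

/-- Uniform decay and the limiting absorption principle for the free kernels. -/
lemma exists_parityKernel_bound (p : Parity) {m : ℝ} (hm : 0 < m) : ∃ C : ℝ, 0 ≤ C ∧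
    ∀ μ : ℝ, m ≤ |μ| → ∀ κ : ℝ, (κ = 1 ∨ κ = -1) → ∀ r : ℝ, 0 ≤ r →
      (∀ δ z : ℝ, 0 < δ → ‖parityKernel p μ κ r δ z‖ ≤ C * (1 + r) ^ (-rate p) * (1 + z ^ 2)) ∧
      ∃ H : ℝ → ℂ, ∀ z, Tendsto (fun δ => parityKernel p μ κ r δ z) (𝓝[>] 0) (𝓝 (H z)) := by
  obtain ⟨F, F', hF, hK⟩ := parityKernel_eq_oscIntegral p
  -- The constant of `norm_oscIntegral_le`; the last factor 2 is that of the amplitude size 2(1 +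
  -- z²).
  refine ⟨‖gaussConst‖ * ((2 * 2 ^ rate p + (1 + 1 / rate p) / (2 * m)) * 2), ?_,
    fun μ hμ κ hκ r hr => ?_⟩
  · have := rate_pos p
    positivity
  have hμ0 : μ ≠ 0 := fun h0 => by rw [h0, abs_zero] at hμ; linarith
  have key : (∀ δ z : ℝ, 0 < δ → ‖parityKernel p μ 1 r δ z‖ ≤
        ‖gaussConst‖ * ((2 * 2 ^ rate p + (1 + 1 / rate p) / (2 * m)) * 2) *
          (1 + r) ^ (-rate p) * (1 + z ^ 2)) ∧
      ∃ H : ℝ → ℂ, ∀ z, Tendsto (fun δ => parityKernel p μ 1 r δ z) (𝓝[>] 0) (𝓝 (H z)) := by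
    refine ⟨fun δ z hδ => ?_, fun z => Complex.I * gaussConst * oscIntegral r (F z) (F' z) μ,
      fun z => ?_⟩
    · have hω : m ≤ ‖(μ + Complex.I * δ : ℂ)‖ := by
        have := Complex.abs_re_le_norm (μ + Complex.I * δ : ℂ)
        simp only [Complex.add_re, Complex.ofReal_re, Complex.mul_re, Complex.I_re, Complex.I_im,
          Complex.ofReal_im, zero_mul, mul_zero, sub_zero, add_zero] at this
        exact hμ.trans this
      have := (hF z).norm_oscIntegral_le (ω := μ + Complex.I * δ) (by simp [hδ.le]) (rate_pos p) hr
        hm hω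
      rw [hK μ r δ z hr hδ, norm_mul, norm_mul, Complex.norm_I, one_mul]
      refine (mul_le_mul_of_nonneg_left this (norm_nonneg _)).trans (le_of_eq ?_)
      ring
    · refine (((hF z).tendsto_oscIntegral (rate_pos p) hr hμ0).const_mul _).congr' ?_
      filter_upwards [self_mem_nhdsWithin] with δ hδ
      exact (hK μ r δ z hr hδ).symm
  rcases hκ with rfl | rfl
  · exact key
  · have hconj : ∀ δ z, parityKernel p μ (-1) r δ z = starRingEnd ℂ (parityKernel p μ 1 r δ z) :=
      fun δ z => by
        cases p <;> simp [parityKernel, freeKernel_neg_one]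
    obtain ⟨k1, H, k2⟩ := key
    refine ⟨fun δ z hδ => ?_, fun z => starRingEnd ℂ (H z), fun z => ?_⟩
    · rw [hconj, Complex.norm_conj]; exact k1 δ z hδ
    · simp only [hconj]
      exact (Complex.continuous_conj.tendsto _).comp (k2 z)

end Symbol

end TwoSoliton

/-! ### Division by a linear factor in λ as an exponential average in z -/

namespace TwoSoliton

/-- The averages `2 ∫₀^∞ e^{-2ρs} Φ(z + σs) ds`, which are dual to division by `ρ - iσλ`. -/
def shiftAverage (ρ σ : ℝ) (Φ : ℝ → ℂ) (z : ℝ) : ℂ :=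
  2 * ∫ s in Set.Ioi (0 : ℝ), (Real.exp (-(2 * ρ) * s) : ℂ) * Φ (z + σ * s)

lemma norm_inv_sub_le {ρ : ℝ} (hρ : 0 < ρ) (σ l : ℝ) : ‖(ρ - Complex.I * σ * l)⁻¹‖ ≤ ρ⁻¹ := by
  rw [norm_inv]
  have := Complex.abs_re_le_norm (ρ - Complex.I * σ * l)
  have e : (ρ - Complex.I * σ * l).re = ρ := by simp
  rw [e, abs_of_pos hρ] at this
  gcongr

lemma sub_I_mul_ne_zero {ρ : ℝ} (hρ : 0 < ρ) (σ l : ℝ) : (ρ - Complex.I * σ * l) ≠ 0 := fun h => by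
  have e : (ρ - Complex.I * σ * l).re = ρ := by simp
  rw [h, Complex.zero_re] at e
  exact hρ.ne e

section Fourier

variable {m : ℝ → ℂ}

lemma integrable_fourier_div (hm : Integrable m) {ρ : ℝ} (hρ : 0 < ρ) (σ z : ℝ) :
    Integrable fun l : ℝ => m l * Complex.exp (2 * Complex.I * l * z) *
      (ρ - Complex.I * σ * l)⁻¹ := by
  refine (hm.norm.mul_const ρ⁻¹).mono' ?_ (Eventually.of_forall fun l => ?_)
  · have c : Continuous fun l : ℝ => (ρ - Complex.I * σ * l)⁻¹ :=
      Continuous.inv₀ (by fun_prop) (sub_I_mul_ne_zero hρ σ)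
    exact (hm.1.mul (Continuous.aestronglyMeasurable (by fun_prop))).mul c.aestronglyMeasurable
  · rw [norm_mul, norm_mul, norm_cexp_two_mul_I_mul, mul_one]
    gcongr
    exact norm_inv_sub_le hρ σ l

/-- Write (ρ - iσλ)⁻¹ = 2∫₀^∞ e^{-2(ρ - iσλ)s} ds: the factor e^{2iσλs} translates z by σs, and
Fubini exchanges the integrals. -/
lemma integral_fourier_div (hm : Integrable m) {ρ : ℝ} (hρ : 0 < ρ) (σ z : ℝ) :
    ∫ l : ℝ, m l * Complex.exp (2 * Complex.I * l * z) * (ρ - Complex.I * σ * l)⁻¹ =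
      shiftAverage ρ σ (fun z => ∫ l : ℝ, m l * Complex.exp (2 * Complex.I * l * z)) z := by
  set Ψ : ℝ → ℝ → ℂ := fun l s => m l * (Real.exp (-(2 * ρ) * s) : ℂ) *
    Complex.exp (2 * Complex.I * l * (z + σ * s : ℝ)) with hΨ
  have hint : Integrable (Function.uncurry Ψ) (volume.prod (volume.restrict (Set.Ioi (0 : ℝ)))) := by
    have i2 : IntegrableOn (fun s : ℝ => (Real.exp (-(2 * ρ) * s) : ℂ)) (Set.Ioi 0) :=
      (integrableOn_exp_mul_Ioi (by linarith) 0).ofReal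
    have i3 := hm.mul_prod i2
    refine i3.mono (i3.1.mul (Continuous.aestronglyMeasurable (by fun_prop)))
      (Eventually.of_forall fun q => le_of_eq ?_)
    simp only [Ψ, Function.uncurry, norm_mul]
    rw [norm_cexp_two_mul_I_mul, mul_one]
  have h1 : ∀ l : ℝ, m l * Complex.exp (2 * Complex.I * l * z) * (ρ - Complex.I * σ * l)⁻¹ =
      2 * ∫ s in Set.Ioi (0 : ℝ), Ψ l s := fun l => by
    have hne := sub_I_mul_ne_zero hρ σ l
    have h2 := integral_exp_mul_complex_Ioi (a := -(2 * (ρ - Complex.I * σ * l)))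
      (by simpa using hρ) 0
    have h3 : (ρ - Complex.I * σ * l)⁻¹ = 2 * ∫ s in Set.Ioi (0 : ℝ),
        Complex.exp (-(2 * (ρ - Complex.I * σ * l)) * s) := by
      rw [h2]; simp only [Complex.ofReal_zero, mul_zero, Complex.exp_zero]; field_simp
    rw [h3, mul_left_comm, ← integral_const_mul]
    congr 1
    refine integral_congr_ae (Eventually.of_forall fun s => ?_)
    simp only [Ψ]
    rw [mul_assoc (m l), mul_assoc (m l), Complex.ofReal_exp, ← Complex.exp_add, ← Complex.exp_add]
    congr 2
    push_cast; ring
  simp only [h1]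
  rw [integral_const_mul, integral_integral_swap hint, shiftAverage]
  congr 1
  refine integral_congr_ae (Eventually.of_forall fun s => ?_)
  simp only [Ψ]
  rw [← integral_const_mul]
  refine integral_congr_ae (Eventually.of_forall fun l => ?_)
  simp only
  ring

end Fourier

lemma integrableOn_exp_mul_one_add_sq {ρ : ℝ} (hρ : 0 < ρ) :
    IntegrableOn (fun s : ℝ => Real.exp (-(2 * ρ) * s) * (1 + s ^ 2)) (Set.Ioi 0) := by
  have h0 := integrableOn_exp_mul_Ioi (a := -(2 * ρ)) (by linarith) 0
  have h2 := integrableOn_rpow_mul_exp_neg_mul_rpow (s := 2) (p := 1) (b := 2 * ρ) (by norm_num)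
    one_pos (by linarith)
  refine (h0.add h2).congr (Eventually.of_forall fun s => ?_)
  simp only [Real.rpow_one, Real.rpow_two, Pi.add_apply]
  ring

lemma norm_shift_le {B ρ σ : ℝ} (hσ : |σ| = 1) {Φ : ℝ → ℂ}
    (hΦ : ∀ z, ‖Φ z‖ ≤ B * (1 + z ^ 2)) (z s : ℝ) :
    ‖(Real.exp (-(2 * ρ) * s) : ℂ) * Φ (z + σ * s)‖ ≤
      2 * B * (1 + z ^ 2) * (Real.exp (-(2 * ρ) * s) * (1 + s ^ 2)) := by
  have hB : 0 ≤ B := by simpa using (norm_nonneg _).trans (hΦ 0)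
  have hσ2 : σ ^ 2 = 1 := by rw [← sq_abs, hσ, one_pow]
  rw [norm_mul, Complex.norm_of_nonneg (Real.exp_pos _).le]
  -- Quadratic growth is stable under translation: the growth in s separates and is absorbed by the
  -- exponential.
  have h1 : 1 + (z + σ * s) ^ 2 ≤ 2 * ((1 + z ^ 2) * (1 + s ^ 2)) := by
    have : (σ * s) ^ 2 = s ^ 2 := by rw [mul_pow, hσ2, one_mul]
    nlinarith [sq_nonneg (z - σ * s), sq_nonneg (z * s)]
  calc _ ≤ Real.exp (-(2 * ρ) * s) * (B * (2 * ((1 + z ^ 2) * (1 + s ^ 2)))) := by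
        gcongr
        exact (hΦ _).trans (by gcongr)
    _ = _ := by ring

lemma norm_shiftAverage_le {ρ : ℝ} (hρ : 0 < ρ) : ∃ c : ℝ, 0 ≤ c ∧ ∀ σ : ℝ, |σ| = 1 →
    ∀ (B : ℝ) (Φ : ℝ → ℂ), (∀ z, ‖Φ z‖ ≤ B * (1 + z ^ 2)) →
      ∀ z, ‖shiftAverage ρ σ Φ z‖ ≤ c * B * (1 + z ^ 2) := by
  refine ⟨4 * ∫ s in Set.Ioi (0 : ℝ), Real.exp (-(2 * ρ) * s) * (1 + s ^ 2),
    mul_nonneg (by norm_num) (integral_nonneg fun s => by positivity), fun σ hσ B Φ hΦ z => ?_⟩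
  have h := norm_integral_le_of_norm_le ((integrableOn_exp_mul_one_add_sq hρ).const_mul
    (2 * B * (1 + z ^ 2))) (Eventually.of_forall (norm_shift_le hσ hΦ z))
  rw [integral_const_mul] at h
  rw [shiftAverage, norm_mul, Complex.norm_two]
  refine (mul_le_mul_of_nonneg_left h two_pos.le).trans (le_of_eq ?_)
  ring

lemma tendsto_shiftAverage {ι : Type*} {L : Filter ι} [L.IsCountablyGenerated] {ρ σ B : ℝ}
    (hρ : 0 < ρ) (hσ : |σ| = 1) {Φ : ι → ℝ → ℂ} {Φ₀ : ℝ → ℂ} (hc : ∀ᶠ i in L, Continuous (Φ i))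
    (hΦ : ∀ᶠ i in L, ∀ z, ‖Φ i z‖ ≤ B * (1 + z ^ 2))
    (hlim : ∀ z, Tendsto (fun i => Φ i z) L (𝓝 (Φ₀ z))) (z : ℝ) :
    Tendsto (fun i => shiftAverage ρ σ (Φ i) z) L (𝓝 (shiftAverage ρ σ Φ₀ z)) := by
  refine Tendsto.const_mul _ (tendsto_integral_filter_of_dominated_convergence _ ?_ ?_
    ((integrableOn_exp_mul_one_add_sq hρ).const_mul (2 * B * (1 + z ^ 2))) ?_)
  · filter_upwards [hc] with i hi
    exact Continuous.aestronglyMeasurable (by fun_prop)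
  · filter_upwards [hΦ] with i hi
    exact Eventually.of_forall (norm_shift_le hσ hi z)
  · exact Eventually.of_forall fun s => (hlim _).const_mul _

/-- A constant averages to itself times ρ⁻¹, the value of (ρ - iσλ)⁻¹ at λ = 0. -/
lemma shiftAverage_sub_const {ρ : ℝ} (hρ : 0 < ρ) (σ : ℝ) {Φ : ℝ → ℂ} (hc : Continuous Φ) {B : ℝ}
    (hB : ∀ z, ‖Φ z‖ ≤ B) (c : ℂ) (z : ℝ) :
    shiftAverage ρ σ (fun z => Φ z - c) z = shiftAverage ρ σ Φ z - c * (ρ : ℂ)⁻¹ := by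
  have i2 : IntegrableOn (fun s : ℝ => (Real.exp (-(2 * ρ) * s) : ℂ)) (Set.Ioi 0) :=
    (integrableOn_exp_mul_Ioi (by linarith) 0).ofReal
  have i3 : IntegrableOn (fun s : ℝ => (Real.exp (-(2 * ρ) * s) : ℂ) * Φ (z + σ * s))
      (Set.Ioi 0) := by
    refine (i2.norm.mul_const B).mono' (Continuous.aestronglyMeasurable (by fun_prop))
      (Eventually.of_forall fun s => ?_)
    rw [norm_mul]
    gcongr
    exact hB _
  have e : ∫ s in Set.Ioi (0 : ℝ), (Real.exp (-(2 * ρ) * s) : ℂ) = (2 * ρ : ℂ)⁻¹ := by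
    rw [integral_complex_ofReal, integral_exp_mul_Ioi (by linarith)]
    push_cast
    simp
  simp only [shiftAverage, mul_sub]
  rw [integral_sub i3 (i2.mul_const c), integral_mul_const, e, mul_sub, mul_inv]
  ring

end TwoSoliton

/-! ### Partial fractions and the dressed resolvent kernel -/

namespace TwoSoliton

open Asymptotics

namespace Data

variable (D : Data)

lemma denom_comp_neg (x : ℝ) : D.denom (-x) = D.denom x := by
  simp [denom]

lemma a0_neg (x : ℝ) : D.a0 (-x) = D.a0 x := by
  simp [a0, denom_comp_neg]

lemma a1_neg (x : ℝ) : D.a1 (-x) = -D.a1 x := by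
  simp only [a1, denom_comp_neg, mul_neg, Real.sinh_neg, Real.cosh_neg]
  push_cast; ring

/-- Reflection in x is reflection in λ, so the second half of a parity mode only replaces y by -y in
the kernel. -/
lemma a_neg (x : ℝ) (l : ℂ) : D.a (-x) l = D.a x (-l) := by
  rw [a, a, a0_neg, a1_neg]
  push_cast
  ring_nf

/-- The moduli of the poles of `1 / ((λ² + ρ₁²) (λ² + ρ₂²))`. -/
def poleRadius : Fin 4 → ℝ := ![D.ρ₁, D.ρ₁, D.ρ₂, D.ρ₂]

def poleSign : Fin 4 → ℝ := ![1, -1, 1, -1]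

/-- The partial fraction coefficients of
`(λ² + A₁λ + A₀) (λ² + B₁λ + B₀) / ((λ² + ρ₁²) (λ² + ρ₂²))`. -/
def residue (A₁ A₀ B₁ B₀ : ℂ) : Fin 4 → ℂ :=
  let q₃ := A₁ + B₁
  let q₂ := A₀ + B₀ + A₁ * B₁ - (D.ρ₁ ^ 2 + D.ρ₂ ^ 2)
  let q₁ := A₁ * B₀ + A₀ * B₁
  let q₀ := A₀ * B₀ - D.ρ₁ ^ 2 * D.ρ₂ ^ 2
  let d : ℂ := D.ρ₂ ^ 2 - D.ρ₁ ^ 2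
  ![((q₀ - q₂ * D.ρ₁ ^ 2) / D.ρ₁ - Complex.I * (q₁ - q₃ * D.ρ₁ ^ 2)) / (2 * d),
    ((q₀ - q₂ * D.ρ₁ ^ 2) / D.ρ₁ + Complex.I * (q₁ - q₃ * D.ρ₁ ^ 2)) / (2 * d),
    ((q₂ * D.ρ₂ ^ 2 - q₀) / D.ρ₂ - Complex.I * (q₃ * D.ρ₂ ^ 2 - q₁)) / (2 * d),
    ((q₂ * D.ρ₂ ^ 2 - q₀) / D.ρ₂ + Complex.I * (q₃ * D.ρ₂ ^ 2 - q₁)) / (2 * d)]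

lemma poleRadius_pos (j : Fin 4) : 0 < D.poleRadius j := by
  have := D.ρ₁_pos
  have := D.ρ₂_pos
  fin_cases j <;> simpa [poleRadius]

lemma abs_poleSign (j : Fin 4) : |poleSign j| = 1 := by
  fin_cases j <;> simp [poleSign]

/-- Numerator and symbol are both monic quartics in λ, so the quotient is 1 plus a proper fraction
with simple poles at ±iρ₁ and ±iρ₂; they are distinct because ρ₁ ≠ ρ₂. -/
lemma sum_residue (A₁ A₀ B₁ B₀ : ℂ) (l : ℝ) :
    (((l ^ 2 + D.ρ₁ ^ 2) * (l ^ 2 + D.ρ₂ ^ 2) : ℝ) : ℂ) * (1 + ∑ j, D.residue A₁ A₀ B₁ B₀ j *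
      (D.poleRadius j - Complex.I * poleSign j * l)⁻¹) =
      (l ^ 2 + A₁ * l + A₀) * (l ^ 2 + B₁ * l + B₀) := by
  have h1 : (D.ρ₁ : ℂ) ≠ 0 := by exact_mod_cast D.ρ₁_pos.ne'
  have h2 : (D.ρ₂ : ℂ) ≠ 0 := by exact_mod_cast D.ρ₂_pos.ne'
  have hd : (D.ρ₂ : ℂ) ^ 2 - D.ρ₁ ^ 2 ≠ 0 := by
    have := D.ρ₁_pos
    have := D.ρ₁_lt_ρ₂
    exact_mod_cast (by nlinarith : D.ρ₂ ^ 2 - D.ρ₁ ^ 2 ≠ 0)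
  have n1 := sub_I_mul_ne_zero D.ρ₁_pos 1 l
  have n2 := sub_I_mul_ne_zero D.ρ₁_pos (-1) l
  have n3 := sub_I_mul_ne_zero D.ρ₂_pos 1 l
  have n4 := sub_I_mul_ne_zero D.ρ₂_pos (-1) l
  have p1 : ((l : ℂ) ^ 2 + D.ρ₁ ^ 2) =
      (D.ρ₁ - Complex.I * (1 : ℝ) * l) * (D.ρ₁ - Complex.I * (-1 : ℝ) * l) := by
    push_cast; linear_combination ((l : ℂ) ^ 2) * Complex.I_sq
  have p2 : ((l : ℂ) ^ 2 + D.ρ₂ ^ 2) =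
      (D.ρ₂ - Complex.I * (1 : ℝ) * l) * (D.ρ₂ - Complex.I * (-1 : ℝ) * l) := by
    push_cast; linear_combination ((l : ℂ) ^ 2) * Complex.I_sq
  have s0 : ∀ P Q u v : ℂ, P ≠ 0 → Q ≠ 0 → P * Q * (u * P⁻¹ + v * Q⁻¹) = u * Q + v * P :=
    fun P Q u v hP hQ => by field_simp
  rw [Fin.sum_univ_four]
  simp only [poleRadius, poleSign, Matrix.cons_val]
  set R := D.residue A₁ A₀ B₁ B₀ with hR
  have t1 := s0 _ _ (R 0) (R 1) n1 n2
  have t2 := s0 _ _ (R 2) (R 3) n3 n4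
  rw [← p1] at t1
  rw [← p2] at t2
  have key : (((l ^ 2 + D.ρ₁ ^ 2) * (l ^ 2 + D.ρ₂ ^ 2) : ℝ) : ℂ)
      + ((l : ℂ) ^ 2 + D.ρ₂ ^ 2) * (R 0 * (D.ρ₁ - Complex.I * (-1 : ℝ) * l) +
        R 1 * (D.ρ₁ - Complex.I * (1 : ℝ) * l))
      + ((l : ℂ) ^ 2 + D.ρ₁ ^ 2) * (R 2 * (D.ρ₂ - Complex.I * (-1 : ℝ) * l) +
        R 3 * (D.ρ₂ - Complex.I * (1 : ℝ) * l)) =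
      (l ^ 2 + A₁ * l + A₀) * (l ^ 2 + B₁ * l + B₀) := by
    simp only [hR, residue, Matrix.cons_val]
    push_cast
    field_simp
    ring_nf
    simp only [Complex.I_sq]
    ring
  rw [← key, ← t1, ← t2]
  push_cast
  ring

/-- The residues are polynomial in the mode coefficients, which stay in a fixed ball. -/
lemma exists_residue_bound : ∃ G : ℝ, 0 ≤ G ∧ ∀ (x y : ℝ) (j : Fin 4),
    ‖D.residue (D.a1 x) (D.a0 x) (starRingEnd ℂ (D.a1 y)) (starRingEnd ℂ (D.a0 y)) j‖ ≤ G := by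
  obtain ⟨c1, h1⟩ := isBigO_top.mp D.isBigO_a1
  obtain ⟨c0, h0⟩ := isBigO_top.mp D.isBigO_a0
  simp only [norm_one, mul_one] at h1 h0
  set K := max c1 c0
  have hcont : ∀ j, Continuous fun q : ℂ × ℂ × ℂ × ℂ =>
      D.residue q.1 q.2.1 q.2.2.1 q.2.2.2 j := fun j => by
    fin_cases j <;> simp only [residue, div_eq_mul_inv] <;> simp <;> fun_prop
  have hb : ∀ j, ∃ C, ∀ q ∈ Metric.closedBall (0 : ℂ × ℂ × ℂ × ℂ) K,
      ‖D.residue q.1 q.2.1 q.2.2.1 q.2.2.2 j‖ ≤ C := fun j =>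
    (isCompact_closedBall _ _).exists_bound_of_continuousOn (hcont j).continuousOn
  choose C hC using hb
  refine ⟨∑ j, |C j|, Finset.sum_nonneg fun j _ => abs_nonneg _, fun x y j => ?_⟩
  refine ((hC j (D.a1 x, D.a0 x, starRingEnd ℂ (D.a1 y), starRingEnd ℂ (D.a0 y)) ?_).trans
    (le_abs_self _)).trans
    (Finset.single_le_sum (f := fun j => |C j|) (fun j _ => abs_nonneg _) (Finset.mem_univ j))
  rw [mem_closedBall_zero_iff]
  simp only [Prod.norm_def, Complex.norm_conj]
  have e1 : ∀ x, ‖D.a1 x‖ ≤ K := fun x => (h1 x).trans (le_max_left _ _)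
  have e0 : ∀ x, ‖D.a0 x‖ ≤ K := fun x => (h0 x).trans (le_max_right _ _)
  exact max_le (e1 x) (max_le (e0 x) (max_le (e1 y) (e0 y)))

/-- The action on convolution kernels of multiplication by
`a(x,λ) conj a(y,λ) / (2π (λ² + ρ₁²) (λ² + ρ₂²))` in the Fourier variable. -/
def dressing (Φ : ℝ → ℂ) (x y : ℝ) : ℂ :=
  (2 * Real.pi : ℂ)⁻¹ * (Φ (y - x) + ∑ j,
    D.residue (D.a1 x) (D.a0 x) (starRingEnd ℂ (D.a1 y)) (starRingEnd ℂ (D.a0 y)) j *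
      shiftAverage (D.poleRadius j) (poleSign j) Φ (y - x))

/-- All dependence on λ is now in a plane wave and four elementary fractions, while x and y enter
separately only through bounded residues. -/
lemma normFactor_sq_mul (x y l : ℝ) :
    (D.normFactor l : ℂ) ^ 2 * (D.a x l * starRingEnd ℂ (D.a y l)) =
      (2 * Real.pi : ℂ)⁻¹ * (Complex.exp (2 * Complex.I * l * (y - x : ℝ)) * (1 + ∑ j,
        D.residue (D.a1 x) (D.a0 x) (starRingEnd ℂ (D.a1 y)) (starRingEnd ℂ (D.a0 y)) j *
          (D.poleRadius j - Complex.I * poleSign j * l)⁻¹)) := by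
  have h := D.sum_residue (D.a1 x) (D.a0 x) (starRingEnd ℂ (D.a1 y)) (starRingEnd ℂ (D.a0 y)) l
  have hw : (((l ^ 2 + D.ρ₁ ^ 2) * (l ^ 2 + D.ρ₂ ^ 2) : ℝ) : ℂ) ≠ 0 := by
    exact_mod_cast (D.symbol_pos l).ne'
  have e1 : starRingEnd ℂ (D.a y l) = (l ^ 2 + starRingEnd ℂ (D.a1 y) * l + starRingEnd ℂ (D.a0 y))
      * Complex.exp (2 * Complex.I * l * y) := by
    have c2 : starRingEnd ℂ 2 = 2 := map_ofNat _ 2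
    simp only [a, map_mul, map_add, map_pow, Complex.conj_ofReal, ← Complex.exp_conj, map_neg,
      Complex.conj_I, c2]
    congr 2
    ring
  have e2 : Complex.exp (2 * Complex.I * l * (y - x : ℝ)) =
      Complex.exp (-(2 * Complex.I * l * x)) * Complex.exp (2 * Complex.I * l * y) := by
    rw [← Complex.exp_add]; congr 1; push_cast; ring
  have e3 : (D.normFactor l : ℂ) ^ 2 = (2 * Real.pi : ℂ)⁻¹ *
      (((l ^ 2 + D.ρ₁ ^ 2) * (l ^ 2 + D.ρ₂ ^ 2) : ℝ) : ℂ)⁻¹ := by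
    rw [← Complex.ofReal_pow, normFactor_sq]; push_cast; rw [one_div, mul_inv]
  rw [e1, e2, e3, a]
  set T := 1 + ∑ j, D.residue (D.a1 x) (D.a0 x) (starRingEnd ℂ (D.a1 y)) (starRingEnd ℂ (D.a0 y)) j *
          (D.poleRadius j - Complex.I * poleSign j * l)⁻¹
  set W := (((l ^ 2 + D.ρ₁ ^ 2) * (l ^ 2 + D.ρ₂ ^ 2) : ℝ) : ℂ)
  have h' : W⁻¹ * ((l ^ 2 + D.a1 x * l + D.a0 x) *
      (l ^ 2 + starRingEnd ℂ (D.a1 y) * l + starRingEnd ℂ (D.a0 y))) = T := by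
    rw [← h]; field_simp
  rw [← h']; ring

lemma mul_a_mul_conj_a_eq (c : ℂ) (x y l : ℝ) :
    c * ((D.normFactor l : ℂ) ^ 2 * (D.a x l * starRingEnd ℂ (D.a y l))) =
      (2 * Real.pi : ℂ)⁻¹ * (c * Complex.exp (2 * Complex.I * l * (y - x : ℝ)) + ∑ j,
        D.residue (D.a1 x) (D.a0 x) (starRingEnd ℂ (D.a1 y)) (starRingEnd ℂ (D.a0 y)) j *
          (c * Complex.exp (2 * Complex.I * l * (y - x : ℝ)) *
            (D.poleRadius j - Complex.I * poleSign j * l)⁻¹)) := by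
  rw [normFactor_sq_mul, mul_left_comm, mul_add, mul_one, mul_add, Finset.mul_sum, Finset.mul_sum]
  congr 2
  refine Finset.sum_congr rfl fun j _ => ?_
  ring

section Fourier

variable {m : ℝ → ℂ}

lemma integrable_fourier (hm : Integrable m) (z : ℝ) :
    Integrable fun l : ℝ => m l * Complex.exp (2 * Complex.I * l * z) :=
  hm.mono (hm.1.mul (Continuous.aestronglyMeasurable (by fun_prop)))
    (Eventually.of_forall fun l => by rw [norm_mul, norm_cexp_two_mul_I_mul, mul_one])

lemma integrable_mul_a_mul_conj_a (hm : Integrable m) (x y : ℝ) :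
    Integrable fun l : ℝ => m l * ((D.normFactor l : ℂ) ^ 2 *
      (D.a x l * starRingEnd ℂ (D.a y l))) := by
  simp only [mul_a_mul_conj_a_eq]
  exact ((integrable_fourier hm (y - x)).add (integrable_finsetSum _ fun j _ =>
    (integrable_fourier_div hm (D.poleRadius_pos j) (poleSign j) (y - x)).const_mul _)).const_mul _

lemma integral_mul_a_mul_conj_a (hm : Integrable m) (x y : ℝ) :
    ∫ l : ℝ, m l * ((D.normFactor l : ℂ) ^ 2 * (D.a x l * starRingEnd ℂ (D.a y l))) =
      D.dressing (fun z => ∫ l : ℝ, m l * Complex.exp (2 * Complex.I * l * z)) x y := by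
  have ij := fun j : Fin 4 => (integrable_fourier_div hm (D.poleRadius_pos j) (poleSign j)
    (y - x)).const_mul
      (D.residue (D.a1 x) (D.a0 x) (starRingEnd ℂ (D.a1 y)) (starRingEnd ℂ (D.a0 y)) j)
  simp only [mul_a_mul_conj_a_eq]
  rw [integral_const_mul, integral_add (integrable_fourier hm _)
    (integrable_finsetSum _ fun j _ => ij j), integral_finsetSum _ fun j _ => ij j, dressing]
  congr 2
  refine Finset.sum_congr rfl fun j _ => ?_
  rw [integral_const_mul, integral_fourier_div hm (D.poleRadius_pos j)]

end Fourier

/-- In `dressing Φ x y - dressing Φ x (-y)` the constants drop out. -/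
lemma dressing_sub_const {Φ : ℝ → ℂ} (hc : Continuous Φ) {B : ℝ} (hB : ∀ z, ‖Φ z‖ ≤ B) (c : ℂ)
    (x y : ℝ) : D.dressing (fun z => Φ z - c) x y = D.dressing Φ x y -
      c * ((D.normFactor 0 : ℂ) ^ 2 * (D.a0 x * starRingEnd ℂ (D.a0 y))) := by
  -- Dressing a constant evaluates the multiplier at λ = 0, which this case of the identity
  -- expresses through a⁽⁰⁾.
  have h := D.normFactor_sq_mul x y 0
  have e : ∀ x, D.a x ((0 : ℝ) : ℂ) = D.a0 x := fun x => by simp [a]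
  rw [e, e] at h
  simp only [Complex.ofReal_zero, mul_zero, zero_mul, Complex.exp_zero, one_mul, sub_zero] at h
  rw [h, dressing, dressing]
  simp only [shiftAverage_sub_const (D.poleRadius_pos _) _ hc hB, mul_sub, Finset.sum_sub_distrib,
    mul_add, Finset.mul_sum]
  have : ∀ u v w : ℂ, u * (v * (c * w)) = c * (u * (v * w)) := fun u v w => by ring
  simp only [this]
  ring

/-- Residues are bounded and the averages preserve growth of order 1 + z²; at z = y - x this is at
most 2(1 + x²)(1 + y²). -/
lemma exists_dressing_bound : ∃ C : ℝ, 0 ≤ C ∧ ∀ (B : ℝ) (Φ : ℝ → ℂ),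
    (∀ z, ‖Φ z‖ ≤ B * (1 + z ^ 2)) →
      ∀ x y, ‖D.dressing Φ x y‖ ≤ C * B * ((1 + x ^ 2) * (1 + y ^ 2)) := by
  obtain ⟨G, hG0, hG⟩ := D.exists_residue_bound
  choose c hc0 hc using fun j : Fin 4 => norm_shiftAverage_le (D.poleRadius_pos j)
  refine ⟨2 * (1 + ∑ j, G * c j), ?_, fun B Φ hΦ x y => ?_⟩
  · have := Finset.sum_nonneg fun j (_ : j ∈ Finset.univ) => mul_nonneg hG0 (hc0 j)
    linarith
  have hB : 0 ≤ B := by simpa using (norm_nonneg _).trans (hΦ 0)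
  have h1 : ‖(2 * Real.pi : ℂ)⁻¹‖ ≤ 1 := by
    rw [norm_inv, norm_mul, Complex.norm_two, Complex.norm_of_nonneg Real.pi_pos.le]
    refine inv_le_one_of_one_le₀ ?_
    have := Real.pi_gt_three
    linarith
  have h2 : 1 + (y - x) ^ 2 ≤ 2 * ((1 + x ^ 2) * (1 + y ^ 2)) := by
    nlinarith [sq_nonneg (x + y), sq_nonneg (x * y)]
  have hS := Finset.sum_nonneg fun j (_ : j ∈ Finset.univ) => mul_nonneg hG0 (hc0 j)
  rw [dressing, norm_mul]
  calc _ ≤ 1 * (B * (1 + (y - x) ^ 2) + ∑ j, G * (c j * B * (1 + (y - x) ^ 2))) := by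
        gcongr
        refine (norm_add_le _ _).trans (add_le_add (hΦ _) ((norm_sum_le _ _).trans
          (Finset.sum_le_sum fun j _ => ?_)))
        rw [norm_mul]
        exact mul_le_mul (hG x y j) (hc j _ (abs_poleSign j) B Φ hΦ _) (norm_nonneg _) hG0
    _ = (1 + ∑ j, G * c j) * B * (1 + (y - x) ^ 2) := by
        have : ∑ j, G * (c j * B * (1 + (y - x) ^ 2)) =
          (∑ j, G * c j) * (B * (1 + (y - x) ^ 2)) := by
          rw [Finset.sum_mul]; exact Finset.sum_congr rfl fun j _ => by ring
        rw [this]; ring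
    _ ≤ (1 + ∑ j, G * c j) * B * (2 * ((1 + x ^ 2) * (1 + y ^ 2))) := by gcongr
    _ = _ := by ring

lemma tendsto_dressing {ι : Type*} {L : Filter ι} [L.IsCountablyGenerated] {B : ℝ}
    {Φ : ι → ℝ → ℂ} {Φ₀ : ℝ → ℂ} (hc : ∀ᶠ i in L, Continuous (Φ i))
    (hΦ : ∀ᶠ i in L, ∀ z, ‖Φ i z‖ ≤ B * (1 + z ^ 2))
    (hlim : ∀ z, Tendsto (fun i => Φ i z) L (𝓝 (Φ₀ z))) (x y : ℝ) :
    Tendsto (fun i => D.dressing (Φ i) x y) L (𝓝 (D.dressing Φ₀ x y)) :=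
  ((hlim _).add (tendsto_finsetSum _ fun j _ => (tendsto_shiftAverage (D.poleRadius_pos j)
    (abs_poleSign j) hc hΦ hlim _).const_mul _)).const_mul _

/-- The integral kernel of `(B - 2μ - 2iκδ)⁻¹ exp (-iκrB) P_c`. -/
def resolventKernel (p : Parity) (μ κ r δ x y : ℝ) : ℂ :=
  ∫ l : ℝ, resolventSymbol μ κ r δ l * (D.normFactor l ^ 2 *
    (D.a x l * starRingEnd ℂ (D.a y l + p.sgn * D.a y ((-l : ℝ) : ℂ))))

/-- Expanding the parity mode gives dressings of the free kernel at y and at -y. -/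
lemma resolventKernel_eq (p : Parity) {κ δ : ℝ} (hκ : κ = 1 ∨ κ = -1) (hδ : 0 < δ)
    (μ r x y : ℝ) : D.resolventKernel p μ κ r δ x y =
      D.dressing (parityKernel p μ κ r δ) x y + p.sgn * D.dressing (parityKernel p μ κ r δ) x (-y) := by
  have hi := integrable_resolventSymbol (μ := μ) (r := r) hκ hδ
  have hconj : starRingEnd ℂ p.sgn = p.sgn := by cases p <;> simp [Parity.sgn]
  have e0 : D.resolventKernel p μ κ r δ x y =
      D.dressing (freeKernel μ κ r δ) x y + p.sgn * D.dressing (freeKernel μ κ r δ) x (-y) := by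
    have hint : ∀ y, Integrable fun l : ℝ => resolventSymbol μ κ r δ l *
        ((D.normFactor l : ℂ) ^ 2 * (D.a x l * starRingEnd ℂ (D.a y l))) := fun y =>
      D.integrable_mul_a_mul_conj_a hi x y
    have h1 := D.integral_mul_a_mul_conj_a hi x y
    have h2 := D.integral_mul_a_mul_conj_a hi x (-y)
    change _ = D.dressing (freeKernel μ κ r δ) x y at h1
    change _ = D.dressing (freeKernel μ κ r δ) x (-y) at h2
    rw [← h1, ← h2, ← integral_const_mul, ← integral_add (hint y) ((hint (-y)).const_mul _),
      resolventKernel]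
    refine integral_congr_ae (Eventually.of_forall fun l => ?_)
    simp only [a_neg, map_add, map_mul, hconj, Complex.ofReal_neg]
    ring
  rw [e0]
  cases p
  · rfl
  -- Odd class: removing the value at the origin changes both dressings by the same amount, since
  -- a⁽⁰⁾ is even, and the difference is unaffected.
  · have hc := continuous_freeKernel (μ := μ) (r := r) hκ hδ
    have e : parityKernel .odd μ κ r δ = fun z => freeKernel μ κ r δ z - freeKernel μ κ r δ 0 := rfl
    rw [e, D.dressing_sub_const hc norm_freeKernel_le, D.dressing_sub_const hc norm_freeKernel_le,
      a0_neg, Parity.sgn]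
    ring

lemma exists_resolventKernel_bound (p : Parity) {m : ℝ} (hm : 0 < m) : ∃ C : ℝ, 0 ≤ C ∧
    ∀ μ : ℝ, m ≤ |μ| → ∀ κ : ℝ, (κ = 1 ∨ κ = -1) → ∀ r : ℝ, 0 ≤ r →
      (∀ δ x y : ℝ, 0 < δ → ‖D.resolventKernel p μ κ r δ x y‖ ≤
        C * (1 + r) ^ (-rate p) * ((1 + x ^ 2) * (1 + y ^ 2))) ∧
      ∃ R : ℝ → ℝ → ℂ, ∀ x y,
        Tendsto (fun δ => D.resolventKernel p μ κ r δ x y) (𝓝[>] 0) (𝓝 (R x y)) := by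
  obtain ⟨C₁, hC₁, h1⟩ := exists_parityKernel_bound p hm
  obtain ⟨C₂, hC₂, h2⟩ := D.exists_dressing_bound
  refine ⟨2 * (C₂ * C₁), by positivity, fun μ hμ κ hκ r hr => ?_⟩
  obtain ⟨hb, H, hH⟩ := h1 μ hμ κ hκ r hr
  refine ⟨fun δ x y hδ => ?_, fun x y => D.dressing H x y + p.sgn * D.dressing H x (-y),
    fun x y => ?_⟩
  · have hd := h2 _ _ fun z => hb δ z hδ
    have hd2 := hd x (-y)
    rw [neg_sq] at hd2
    rw [D.resolventKernel_eq p hκ hδ]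
    refine (norm_add_le _ _).trans ?_
    rw [norm_mul, p.norm_sgn, one_mul]
    refine (add_le_add (hd x y) hd2).trans (le_of_eq ?_)
    ring
  · have ht := fun y => D.tendsto_dressing (L := 𝓝[>] (0 : ℝ)) (Φ := fun δ => parityKernel p μ κ r δ)
      (B := C₁ * (1 + r) ^ (-rate p))
      (by filter_upwards [self_mem_nhdsWithin] with δ hδ
          exact continuous_parityKernel p hκ hδ)
      (by filter_upwards [self_mem_nhdsWithin] with δ hδ
          exact fun z => hb δ z hδ) hH x y
    refine ((ht y).add ((ht (-y)).const_mul _)).congr' ?_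
    filter_upwards [self_mem_nhdsWithin] with δ hδ
    exact (D.resolventKernel_eq p hκ hδ μ r x y).symm

end Data

end TwoSoliton

/-! ### Weights, and the resolvent solution represented by its kernel -/

namespace TwoSoliton

lemma weight_pos (x : ℝ) : 0 < weight x := Real.sqrt_pos.mpr (by positivity)

lemma weight_sq (x : ℝ) : weight x ^ 2 = 1 + x ^ 2 := Real.sq_sqrt (by positivity)

lemma continuous_weight : Continuous weight := by unfold weight; fun_prop

lemma continuous_weight_rpow (s : ℝ) : Continuous fun x => weight x ^ s :=
  continuous_weight.rpow_const fun x => Or.inl (weight_pos x).ne'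

lemma weight_rpow_two_sub (s x : ℝ) : weight x ^ (-s) * (1 + x ^ 2) = weight x ^ (2 - s) := by
  rw [← weight_sq, ← Real.rpow_two, ← Real.rpow_add (weight_pos x)]
  congr 1; ring

lemma rpow_neg_one_add_le_weight {r : ℝ} (hr : 0 ≤ r) (p : Parity) :
    (1 + r) ^ (-rate p) ≤ weight r ^ (-rate p) := by
  refine Real.rpow_le_rpow_of_nonpos (weight_pos r) ?_ (neg_nonpos.mpr (rate_pos p).le)
  rw [weight]
  exact Real.sqrt_le_iff.mpr ⟨by linarith, by nlinarith⟩

lemma memLp_weight {s : ℝ} (hs : 1 / 2 < s) : MemLp (fun x => weight x ^ (-s)) 2 := by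
  refine (memLp_two_iff_integrable_sq (continuous_weight_rpow _).aestronglyMeasurable).mpr ?_
  have h := integrable_rpow_neg_one_add_norm_sq (E := ℝ) (μ := volume) (r := 2 * s)
    (by simp; linarith)
  refine h.congr (Eventually.of_forall fun x => ?_)
  simp only
  rw [weight, Real.sqrt_eq_rpow, ← Real.rpow_mul (by positivity),
    ← Real.rpow_mul_natCast (by positivity), Real.norm_eq_abs, sq_abs]
  congr 1; push_cast; ring

/-- Weighted `L²` functions have finite second moments in `L¹`. -/
lemma integrable_one_add_sq_mul {σ : ℝ} (hσ : 5 / 2 < σ) {f : ℝ → ℂ}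
    (hf : MemLp (fun x => ((weight x ^ σ : ℝ) : ℂ) * f x) 2) :
    Integrable (fun x => (1 + x ^ 2) * ‖f x‖) ∧
      ENNReal.ofReal (∫ x, (1 + x ^ 2) * ‖f x‖) ≤
        eLpNorm (fun x => weight x ^ (2 - σ)) 2 volume *
          eLpNorm (fun x => ((weight x ^ σ : ℝ) : ℂ) * f x) 2 volume := by
  have hw : MemLp (fun x => weight x ^ (2 - σ)) 2 := by
    have := memLp_weight (s := σ - 2) (by linarith)
    rwa [neg_sub] at this
  have e : ((fun x => weight x ^ (2 - σ)) • fun x => ‖((weight x ^ σ : ℝ) : ℂ) * f x‖) =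
      fun x => (1 + x ^ 2) * ‖f x‖ := by
    funext x
    have h0 := Real.rpow_pos_of_pos (weight_pos x) σ
    simp only [Pi.smul_apply', smul_eq_mul, norm_mul, Complex.norm_of_nonneg h0.le]
    rw [← mul_assoc, ← Real.rpow_add (weight_pos x), sub_add_cancel, Real.rpow_two, weight_sq]
  have hs := hf.norm.smul hw (r := 1)
  have hle := eLpNorm_smul_le_mul_eLpNorm (p := 2) (q := 2) (r := 1) hf.norm.1 hw.1
  rw [e] at hs hle
  have hi := memLp_one_iff_integrable.mp hs
  refine ⟨hi, ?_⟩
  rw [eLpNorm_norm] at hle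
  refine le_trans (le_of_eq ?_) hle
  rw [eLpNorm_one_eq_lintegral_enorm, ofReal_integral_eq_lintegral_ofReal hi
    (Eventually.of_forall fun x => by positivity)]
  refine lintegral_congr fun x => ?_
  rw [Real.enorm_of_nonneg (by positivity)]

/-- Boundedness of both multipliers puts the solution in L² and in the domain of B. -/
lemma exists_norm_resolventSymbol_le {μ κ r δ : ℝ} (hκ : κ = 1 ∨ κ = -1) (hδ : 0 < δ) : ∃ K : ℝ,
    (∀ l, ‖resolventSymbol μ κ r δ l‖ ≤ K) ∧ ∀ l : ℝ, ‖2 * (l : ℂ) ^ 2 * resolventSymbol μ κ r δ l‖ ≤ K := by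
  set c := 1 / 2 + (1 + |μ|) / (2 * δ)
  have hc : 0 ≤ c := by positivity
  have h1 : ∀ l, ‖resolventSymbol μ κ r δ l‖ * (1 + l ^ 2) ≤ c := fun l => by
    have := norm_resolventSymbol_le (μ := μ) (r := r) hκ hδ l
    rwa [← div_eq_mul_inv, le_div_iff₀ (by positivity)] at this
  refine ⟨2 * c, fun l => ?_, fun l => ?_⟩
  · have := h1 l
    nlinarith [norm_nonneg (resolventSymbol μ κ r δ l),
      mul_nonneg (norm_nonneg (resolventSymbol μ κ r δ l)) (sq_nonneg l)]
  · have := h1 l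
    rw [norm_mul, norm_mul, norm_pow, Complex.norm_two, Complex.norm_real, Real.norm_eq_abs, sq_abs]
    nlinarith [norm_nonneg (resolventSymbol μ κ r δ l),
      mul_nonneg (norm_nonneg (resolventSymbol μ κ r δ l)) (sq_nonneg l)]

namespace Data

variable (D : Data)

lemma exists_norm_normFactor_mul_a_le : ∃ K : ℝ, 0 ≤ K ∧ ∀ x l : ℝ,
    ‖(D.normFactor l : ℂ) * D.a x l‖ ≤ K := by
  obtain ⟨c1, h1⟩ := Asymptotics.isBigO_top.mp D.isBigO_a1
  obtain ⟨c0, h0⟩ := Asymptotics.isBigO_top.mp D.isBigO_a0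
  simp only [norm_one, mul_one] at h1 h0
  have p0 := D.normFactor_pos 0
  have hc1 : 0 ≤ c1 := (norm_nonneg _).trans (h1 0)
  have hc0 : 0 ≤ c0 := (norm_nonneg _).trans (h0 0)
  refine ⟨(1 + D.normFactor 0) * (1 + c1 + c0), by positivity, fun x l => ?_⟩
  have e : (D.normFactor l : ℂ) * D.a x l = ((l : ℂ) ^ 2 * D.normFactor l
      + D.a1 x * ((l : ℂ) ^ 1 * D.normFactor l) + D.a0 x * ((l : ℂ) ^ 0 * D.normFactor l)) *
        Complex.exp (-(2 * Complex.I * l * x)) := by rw [a]; ring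
  rw [e, norm_mul, norm_cexp_mode, mul_one]
  refine (norm_add₃_le).trans ?_
  rw [norm_mul (D.a1 x), norm_mul (D.a0 x)]
  have b2 := D.pow_mul_normFactor_le 2 le_rfl l
  have b1 := D.pow_mul_normFactor_le 1 (by norm_num) l
  have b0 := D.pow_mul_normFactor_le 0 (by norm_num) l
  calc _ ≤ (1 + D.normFactor 0) + c1 * (1 + D.normFactor 0) + c0 * (1 + D.normFactor 0) := by
        gcongr
        · exact h1 x
        · exact h0 x
    _ = _ := by ring

/-- The coefficient `⟨Ψ_d(·,λ), f⟩` of an integrable function, for all real `λ`. -/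
def coeff (p : Parity) (f : ℝ → ℂ) : ℝ → ℂ :=
  symm p fun l => D.normFactor l * ∫ x : ℝ, starRingEnd ℂ (D.a x l) * f x

lemma coeff_ae_eq (p : Parity) {f : ℝ → ℂ} (h1 : Integrable f) (h2 : MemLp f 2) :
    D.coeff p f =ᵐ[volume] D.modeCoeff p h2 := (symm_congr p (D.analysis_toLp h1 h2)).symm

lemma coeff_neg (p : Parity) (f : ℝ → ℂ) (l : ℝ) : D.coeff p f (-l) = p.sgn * D.coeff p f l := by
  simp only [coeff, symm, neg_neg, mul_add, ← mul_assoc p.sgn p.sgn, p.sgn_mul_self]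
  ring

lemma coeff_eq_integral (p : Parity) {f : ℝ → ℂ} (hf : Integrable f) (l : ℝ) :
    D.coeff p f l = ∫ y, D.normFactor l *
      starRingEnd ℂ (D.a y l + p.sgn * D.a y ((-l : ℝ) : ℂ)) * f y := by
  rw [coeff, ← D.integral_conj_contMode_mul p f hf]
  refine integral_congr_ae (Eventually.of_forall fun y => ?_)
  simp only [contMode_eq, map_mul, Complex.conj_ofReal]
  ring

lemma continuous_a_comp {X : Type*} [TopologicalSpace X] {u v : X → ℝ} (hu : Continuous u)
    (hv : Continuous v) : Continuous fun q => D.a (u q) (v q) := by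
  have h0 := D.continuous_a0.comp hu
  have h1 := D.continuous_a1.comp hu
  simp only [Function.comp_def] at h0 h1
  unfold a
  fun_prop

section Solution

variable (p : Parity) {f : ℝ → ℂ} (μ κ r : ℝ)

/-- The continuous representative of `(B - 2μ - 2iκδ)⁻¹ exp (-iκrB) P_c f`. -/
def solution (f : ℝ → ℂ) (δ x : ℝ) : ℂ :=
  ∫ l : ℝ, resolventSymbol μ κ r δ l * D.coeff p f l * (D.a x l * D.normFactor l)

lemma memLp_coeff (h1 : Integrable f) (h2 : MemLp f 2) : MemLp (D.coeff p f) 2 :=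
  (memLp_congr_ae (D.coeff_ae_eq p h1 h2)).mpr (D.memLp_modeCoeff p h2)

lemma exists_norm_coeff_le (h1 : Integrable f) : ∃ K : ℝ, ∀ l, ‖D.coeff p f l‖ ≤ K := by
  obtain ⟨K, hK0, hK⟩ := D.exists_norm_normFactor_mul_a_le
  refine ⟨∫ y, 2 * K * ‖f y‖, fun l => ?_⟩
  rw [D.coeff_eq_integral p h1]
  refine norm_integral_le_of_norm_le (h1.norm.const_mul _) (Eventually.of_forall fun y => ?_)
  rw [norm_mul]
  gcongr
  have e : (D.normFactor l : ℂ) * starRingEnd ℂ (D.a y l + p.sgn * D.a y ((-l : ℝ) : ℂ)) =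
      starRingEnd ℂ (D.normFactor l * D.a y l +
        p.sgn * (D.normFactor (-l) * D.a y ((-l : ℝ) : ℂ))) := by
    rw [normFactor_neg]
    simp only [map_add, map_mul, Complex.conj_ofReal]
    ring
  rw [e, Complex.norm_conj]
  refine (norm_add_le _ _).trans ?_
  rw [norm_mul p.sgn, p.norm_sgn, one_mul]
  linarith [hK y l, hK y (-l)]

variable {κ} {δ : ℝ}

lemma integrable_symbol_mul_coeff (hκ : κ = 1 ∨ κ = -1) (hδ : 0 < δ)
    (h1 : Integrable f) (h2 : MemLp f 2) :
    Integrable fun l => resolventSymbol μ κ r δ l * D.coeff p f l := by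
  obtain ⟨K, hK⟩ := D.exists_norm_coeff_le p h1
  exact (integrable_resolventSymbol hκ hδ).mul_bdd (c := K) (D.memLp_coeff p h1 h2).1
    (Eventually.of_forall hK)

lemma memLp_symbol_mul_coeff (hκ : κ = 1 ∨ κ = -1) (hδ : 0 < δ)
    (h1 : Integrable f) (h2 : MemLp f 2) :
    MemLp (fun l => resolventSymbol μ κ r δ l * D.coeff p f l) 2 := by
  obtain ⟨K, hK, -⟩ := exists_norm_resolventSymbol_le (μ := μ) (r := r) hκ hδ
  exact memLp_mul_of_bound (continuous_resolventSymbol hκ hδ) hK (D.memLp_coeff p h1 h2)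

lemma memLp_sq_mul_symbol_mul_coeff (hκ : κ = 1 ∨ κ = -1) (hδ : 0 < δ)
    (h1 : Integrable f) (h2 : MemLp f 2) :
    MemLp (fun l : ℝ => 2 * (l : ℂ) ^ 2 * (resolventSymbol μ κ r δ l * D.coeff p f l)) 2 := by
  obtain ⟨K, -, hK⟩ := exists_norm_resolventSymbol_le (μ := μ) (r := r) hκ hδ
  have hc := continuous_resolventSymbol (μ := μ) (r := r) hκ hδ
  have := memLp_mul_of_bound (by fun_prop) hK (D.memLp_coeff p h1 h2)
  simpa only [mul_assoc] using this

lemma continuous_solution (hκ : κ = 1 ∨ κ = -1) (hδ : 0 < δ)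
    (h1 : Integrable f) (h2 : MemLp f 2) :
    Continuous (D.solution p μ κ r f δ) := by
  obtain ⟨K, hK0, hK⟩ := D.exists_norm_normFactor_mul_a_le
  have hi := D.integrable_symbol_mul_coeff p μ r hκ hδ h1 h2
  have hn := D.continuous_normFactor
  refine continuous_of_dominated
    (bound := fun l => ‖resolventSymbol μ κ r δ l * D.coeff p f l‖ * K) (fun x => ?_)
    (fun x => Eventually.of_forall fun l => ?_) (hi.norm.mul_const K)
    (Eventually.of_forall fun l => ?_)
  · refine hi.1.mul (Continuous.aestronglyMeasurable ?_)
    exact (D.continuous_a_comp continuous_const continuous_id).mul (by fun_prop)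
  · rw [norm_mul]
    gcongr
    rw [mul_comm]; exact hK x l
  · exact continuous_const.mul ((D.continuous_a l).mul continuous_const)

/-- The symbol is even in λ and the coefficient has parity p, so their product is its own parity
extension from the half-line, apart from λ = 0. -/
lemma solution_ae_eq (hκ : κ = 1 ∨ κ = -1) (hδ : 0 < δ)
    (h1 : Integrable f) (h2 : MemLp f 2) :
    D.solution p μ κ r f δ =ᵐ[volume]
      D.modeSum p ((D.memLp_symbol_mul_coeff p μ r hκ hδ h1 h2).restrict (Set.Ioi 0)) := by
  have hm := D.memLp_symbol_mul_coeff p μ r hκ hδ h1 h2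
  have e : (memLp_extend p (hm.restrict (Set.Ioi 0))).toLp _ = hm.toLp _ := by
    refine (MemLp.toLp_eq_toLp_iff _ _).mpr ?_
    have h0 : ∀ᵐ l : ℝ, l ≠ 0 := by simp [ae_iff]
    filter_upwards [h0] with l hl
    rcases lt_or_gt_of_ne hl with hl | hl
    · have := extend_neg_of_pos p (fun l => resolventSymbol μ κ r δ l * D.coeff p f l)
        (neg_pos.mpr hl)
      rw [neg_neg] at this
      rw [this, resolventSymbol_neg, coeff_neg, mul_left_comm, ← mul_assoc p.sgn, p.sgn_mul_self,
        one_mul]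
    · rw [extend_of_pos _ _ hl]
  rw [modeSum, e]
  exact (D.synthesis_toLp (D.integrable_symbol_mul_coeff p μ r hκ hδ h1 h2) hm).symm

/-- Fubini in (λ,y): the symbol is integrable because δ > 0, f is integrable, and the normalized
modes are uniformly bounded. -/
lemma solution_eq_integral_kernel (hκ : κ = 1 ∨ κ = -1) (hδ : 0 < δ) (h1 : Integrable f) (x : ℝ) :
    (Integrable fun y => D.resolventKernel p μ κ r δ x y * f y) ∧
    D.solution p μ κ r f δ x = ∫ y, D.resolventKernel p μ κ r δ x y * f y := by
  obtain ⟨K, hK0, hK⟩ := D.exists_norm_normFactor_mul_a_le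
  have hi := integrable_resolventSymbol (μ := μ) (r := r) hκ hδ
  have hc := continuous_resolventSymbol (μ := μ) (r := r) hκ hδ
  have hn := D.continuous_normFactor
  set T : ℝ → ℝ → ℂ := fun l y => (D.normFactor l : ℂ) ^ 2 *
    (D.a x l * starRingEnd ℂ (D.a y l + p.sgn * D.a y ((-l : ℝ) : ℂ))) with hT
  have hTb : ∀ l y, ‖T l y‖ ≤ K * (2 * K) := fun l y => by
    have e : T l y = (D.normFactor l * D.a x l) *
        starRingEnd ℂ (D.normFactor l * D.a y l +
        p.sgn * (D.normFactor (-l) * D.a y ((-l : ℝ) : ℂ))) := by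
      rw [normFactor_neg]
      simp only [hT, map_add, map_mul, Complex.conj_ofReal]
      ring
    rw [e, norm_mul, Complex.norm_conj]
    refine mul_le_mul (hK x l) ((norm_add_le _ _).trans ?_) (norm_nonneg _) hK0
    rw [norm_mul p.sgn, p.norm_sgn, one_mul]
    linarith [hK y l, hK y (-l)]
  have hTc : Continuous fun q : ℝ × ℝ => T q.1 q.2 := by
    have c1 := D.continuous_a_comp (continuous_const (y := x)) (continuous_fst (X := ℝ) (Y := ℝ))
    have c2 := D.continuous_a_comp (continuous_snd (X := ℝ)) (continuous_fst (Y := ℝ))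
    have c3 := D.continuous_a_comp (continuous_snd (X := ℝ)) (continuous_fst (Y := ℝ)).neg
    exact ((Complex.continuous_ofReal.comp (hn.comp continuous_fst)).pow 2).mul
      (c1.mul (Complex.continuous_conj.comp (c2.add (c3.const_mul _))))
  have hint : Integrable (Function.uncurry fun l y => resolventSymbol μ κ r δ l * T l y * f y)
      (volume.prod volume) := by
    have h3 := (hi.mul_prod h1).mul_bdd (c := K * (2 * K)) hTc.aestronglyMeasurable
      (Eventually.of_forall fun q => hTb q.1 q.2)
    refine h3.congr (Eventually.of_forall fun q => ?_)
    simp only [Function.uncurry]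
    ring
  have e1 : ∀ y, D.resolventKernel p μ κ r δ x y * f y =
      ∫ l, resolventSymbol μ κ r δ l * T l y * f y := fun y => by
    rw [integral_mul_const]; rfl
  refine ⟨?_, ?_⟩
  · simp only [e1]
    exact hint.integral_prod_right
  · simp only [e1]
    rw [← integral_integral_swap hint, solution]
    refine integral_congr_ae (Eventually.of_forall fun l => ?_)
    simp only
    rw [D.coeff_eq_integral p h1, ← integral_const_mul, ← integral_mul_const]
    refine integral_congr_ae (Eventually.of_forall fun y => ?_)
    simp only [hT]
    ring

/-- Solvability is checked on coefficients: (2λ² - z) cancels the inverse in the symbol and leaves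
the evolution factor. Uniqueness holds because Im z = 2κδ ≠ 0. -/
lemma isResolvent_solution (hκ : κ = 1 ∨ κ = -1) (hδ : 0 < δ) (h1 : Integrable f) (h2 : MemLp f 2)
    (hE : MemLp (fun l : ℝ => Complex.exp (-(2 * Complex.I * (l : ℂ) ^ 2 * (κ * r : ℝ))) *
      D.coeff p f l) 2 (volume.restrict (Set.Ioi 0))) :
    D.IsResolvent (2 * μ + 2 * Complex.I * κ * δ) (D.modeSum p hE) (D.solution p μ κ r f δ) := by
  have hm := (D.memLp_symbol_mul_coeff p μ r hκ hδ h1 h2).restrict (Set.Ioi 0)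
  have hw := (D.memLp_sq_mul_symbol_mul_coeff p μ r hκ hδ h1 h2).restrict (Set.Ioi 0)
  have hu := D.solution_ae_eq p μ r hκ hδ h1 h2
  have hs : D.SolvesResolvent (2 * μ + 2 * Complex.I * κ * δ) (D.modeSum p hE)
      (D.solution p μ κ r f δ) := by
    refine ⟨D.modeSum p hw, D.isDiagonal_of_ae_eq_modeSum p _ hm hw hu (ae_eq_refl _), ?_⟩
    have e := D.modeSum_sub p hw (hm.const_mul (2 * μ + 2 * Complex.I * κ * δ))
    rw [D.modeSum_congr p _ hE (Eventually.of_forall fun l => ?_)] at e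
    · filter_upwards [e, hu, D.modeSum_const_mul p (2 * μ + 2 * Complex.I * κ * δ) hm]
        with x h3 h4 h5
      rw [h3, Pi.sub_apply, h4, h5]
    · have hne := resolvent_ne_zero (μ := μ) hκ hδ l
      simp only [Pi.sub_apply, resolventSymbol]
      rw [← sub_mul, ← mul_assoc, ← mul_assoc, mul_inv_cancel₀ hne, one_mul]
  refine ⟨hs, fun u' hu' => D.solvesResolvent_unique ?_ hs hu'⟩
  have e : (2 * μ + 2 * Complex.I * κ * δ : ℂ).im = 2 * κ * δ := by simp
  rw [e]
  rcases hκ with rfl | rfl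
  · linarith
  · linarith

end Solution

end Data

end TwoSoliton

end

/-! ### Assembly of the weighted decay estimate and the limiting absorption principle -/

theorem mainTheorem2 (D : TwoSoliton.Data) (p : TwoSoliton.Parity)
    (σ : ℝ) (hσ : 7 / 2 < σ) (μmin : ℝ) (hμmin : 0 < μmin) :
    ∃ M : ℝ, 0 < M ∧
      ∀ μ : ℝ, μmin ≤ |μ| → ∀ κ : ℝ, (κ = 1 ∨ κ = -1) → ∀ r : ℝ, 0 ≤ r →
      ∀ f : ℝ → ℂ, MemLp f 2 volume →
        MemLp (fun x => ((TwoSoliton.weight x ^ σ : ℝ) : ℂ) * f x) 2 volume →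
        ∃ (g h : ℝ → ℂ) (u : ℝ → ℝ → ℂ) (v : ℝ → ℂ),
          D.IsContProj p f g ∧
          D.IsEvolution (κ * r) g h ∧
          (∀ δ : ℝ, 0 < δ →
            D.IsResolvent (2 * μ + 2 * Complex.I * κ * δ) h (u δ) ∧ Continuous (u δ)) ∧
          (∀ x : ℝ, Tendsto (fun δ => u δ x) (𝓝[>] 0) (𝓝 (v x))) ∧
          MemLp (fun x => ((TwoSoliton.weight x ^ (-σ) : ℝ) : ℂ) * v x) 2 volume ∧
          Tendsto (fun δ =>
              eLpNorm (fun x => ((TwoSoliton.weight x ^ (-σ) : ℝ) : ℂ) * (u δ x - v x)) 2 volume)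
            (𝓝[>] 0) (𝓝 0) ∧
          eLpNorm (fun x => ((TwoSoliton.weight x ^ (-σ) : ℝ) : ℂ) * v x) 2 volume ≤
            ENNReal.ofReal (M * TwoSoliton.weight r ^ (-(TwoSoliton.rate p))) *
              eLpNorm (fun x => ((TwoSoliton.weight x ^ σ : ℝ) : ℂ) * f x) 2 volume := by
  obtain ⟨C, hC0, hC⟩ := D.exists_resolventKernel_bound p hμmin
  have hW : MemLp (fun x => TwoSoliton.weight x ^ (2 - σ)) 2 := by
    have := TwoSoliton.memLp_weight (s := σ - 2) (by linarith)
    rwa [neg_sub] at this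
  set W := (eLpNorm (fun x => TwoSoliton.weight x ^ (2 - σ)) 2 volume).toReal with hWdef
  have hW0 : 0 ≤ W := ENNReal.toReal_nonneg
  -- One factor W comes from Cauchy-Schwarz in y, the other from the weighted norm in x; the summand
  -- 1 only ensures positivity.
  refine ⟨C * W * W + 1, by positivity, fun μ hμ κ hκ r hr f hf2 hfw => ?_⟩
  obtain ⟨hb, R, hR⟩ := hC μ hμ κ hκ r hr
  obtain ⟨hi, hle⟩ := TwoSoliton.integrable_one_add_sq_mul (by linarith : 5 / 2 < σ) hfw
  set N := (eLpNorm (fun x => ((TwoSoliton.weight x ^ σ : ℝ) : ℂ) * f x) 2 volume).toReal with hN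
  have hN0 : 0 ≤ N := ENNReal.toReal_nonneg
  have hIle : ∫ x, (1 + x ^ 2) * ‖f x‖ ≤ W * N := by
    have := ENNReal.toReal_mono (ENNReal.mul_ne_top hW.2.ne hfw.2.ne) hle
    rwa [ENNReal.toReal_mul, ENNReal.toReal_ofReal
      (integral_nonneg fun x => by positivity)] at this
  have hf1 : Integrable f := hi.mono' hf2.1 (Eventually.of_forall fun x => by
    nlinarith [norm_nonneg (f x), mul_nonneg (sq_nonneg x) (norm_nonneg (f x))])
  have hA := (D.memLp_coeff p hf1 hf2).restrict (Set.Ioi 0)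
  have hE : MemLp (fun l : ℝ => Complex.exp (-(2 * Complex.I * (l : ℂ) ^ 2 * (κ * r : ℝ))) *
      D.coeff p f l) 2 (volume.restrict (Set.Ioi 0)) :=
    (TwoSoliton.memLp_mul_of_bound (by fun_prop)
      (fun l => (TwoSoliton.norm_cexp_evolution l (κ * r)).le)
      (D.memLp_coeff p hf1 hf2)).restrict (Set.Ioi 0)
  set u : ℝ → ℝ → ℂ := D.solution p μ κ r f with hu
  set q := (1 + r) ^ (-TwoSoliton.rate p) with hq
  have hq0 : 0 ≤ q := Real.rpow_nonneg (by linarith) _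
  have hker := fun δ (hδ : 0 < δ) => D.solution_eq_integral_kernel p μ r hκ hδ hf1
  have hdom : ∀ δ x y : ℝ, 0 < δ → ‖D.resolventKernel p μ κ r δ x y * f y‖ ≤
      C * q * (1 + x ^ 2) * ((1 + y ^ 2) * ‖f y‖) := fun δ x y hδ => by
    rw [norm_mul]
    refine (mul_le_mul_of_nonneg_right (hb δ x y hδ) (norm_nonneg _)).trans (le_of_eq ?_)
    ring
  have hub : ∀ δ x : ℝ, 0 < δ → ‖u δ x‖ ≤ C * q * (W * N) * (1 + x ^ 2) := fun δ x hδ => by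
    rw [hu, (hker δ hδ x).2]
    refine (norm_integral_le_of_norm_le (hi.const_mul _)
      (Eventually.of_forall fun y => hdom δ x y hδ)).trans ?_
    rw [integral_const_mul]
    calc _ ≤ C * q * (1 + x ^ 2) * (W * N) := by gcongr
      _ = _ := by ring
  -- The limit is defined by the limiting kernel; its quadratic bound is inherited from u δ by
  -- passing to the limit.
  set v : ℝ → ℂ := fun x => ∫ y, R x y * f y with hv
  have hlim : ∀ x : ℝ, Tendsto (fun δ => u δ x) (𝓝[>] 0) (𝓝 (v x)) := fun x => by
    have ht : Tendsto (fun δ => ∫ y, D.resolventKernel p μ κ r δ x y * f y) (𝓝[>] 0)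
        (𝓝 (v x)) := by
      refine tendsto_integral_filter_of_dominated_convergence
        (fun y => C * q * (1 + x ^ 2) * ((1 + y ^ 2) * ‖f y‖)) ?_ ?_ (hi.const_mul _)
        (Eventually.of_forall fun y => (hR x y).mul_const _)
      · filter_upwards [self_mem_nhdsWithin] with δ hδ
        exact (hker δ hδ x).1.1
      · filter_upwards [self_mem_nhdsWithin] with δ hδ
        exact Eventually.of_forall fun y => hdom δ x y hδ
    refine ht.congr' ?_
    filter_upwards [self_mem_nhdsWithin] with δ hδ
    exact (hker δ hδ x).2.symm
  have hvb : ∀ x : ℝ, ‖v x‖ ≤ C * q * (W * N) * (1 + x ^ 2) := fun x =>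
    le_of_tendsto (hlim x).norm (by
      filter_upwards [self_mem_nhdsWithin] with δ hδ
      exact hub δ x hδ)
  have huc : ∀ δ : ℝ, 0 < δ → Continuous (u δ) := fun δ hδ =>
    D.continuous_solution p μ r hκ hδ hf1 hf2
  have hvm : AEStronglyMeasurable v volume := by
    -- Measurability of v is obtained along the sequence δ = 1/(n+1), as a limit of continuous
    -- functions.
    have hδ : ∀ n : ℕ, (0 : ℝ) < 1 / ((n : ℝ) + 1) := fun n => by positivity
    have ht : Tendsto (fun n : ℕ => 1 / ((n : ℝ) + 1)) atTop (𝓝[>] 0) :=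
      tendsto_nhdsWithin_iff.mpr ⟨tendsto_one_div_add_atTop_nhds_zero_nat,
        Eventually.of_forall hδ⟩
    exact aestronglyMeasurable_of_tendsto_ae atTop (fun n => (huc _ (hδ n)).aestronglyMeasurable)
      (Eventually.of_forall fun x => (hlim x).comp ht)
  have hwc : Continuous fun x => ((TwoSoliton.weight x ^ (-σ) : ℝ) : ℂ) :=
    Complex.continuous_ofReal.comp (TwoSoliton.continuous_weight_rpow _)
  -- A quadratic bound times the weight leaves ⟨x⟩^{2-σ}, which is square integrable; it dominates
  -- both v and u δ - v.
  have hwb : ∀ (c x : ℝ) (w : ℂ), ‖w‖ ≤ c * (1 + x ^ 2) →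
      ‖((TwoSoliton.weight x ^ (-σ) : ℝ) : ℂ) * w‖ ≤ c * TwoSoliton.weight x ^ (2 - σ) :=
    fun c x w hw => by
      have h0 := Real.rpow_nonneg (TwoSoliton.weight_pos x).le (-σ)
      rw [norm_mul, Complex.norm_of_nonneg h0, ← TwoSoliton.weight_rpow_two_sub]
      refine (mul_le_mul_of_nonneg_left hw h0).trans (le_of_eq ?_)
      ring
  have hvw : ∀ x, ‖((TwoSoliton.weight x ^ (-σ) : ℝ) : ℂ) * v x‖ ≤
      C * q * (W * N) * ‖TwoSoliton.weight x ^ (2 - σ)‖ := fun x => by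
    rw [Real.norm_of_nonneg (Real.rpow_nonneg (TwoSoliton.weight_pos x).le _)]
    exact hwb _ x _ (hvb x)
  refine ⟨D.modeSum p hA, D.modeSum p hE, u, v, ?_, ?_, fun δ hδ => ⟨?_, huc δ hδ⟩, hlim, ?_, ?_, ?_⟩
  · refine ⟨D.coeff p f, (D.isModeCoeff_iff p hf2).mpr
      (ae_restrict_of_ae (D.coeff_ae_eq p hf1 hf2)), ?_⟩
    simp only [one_mul]
    exact (D.isModeSum_modeSum p hA).1
  · exact D.isDiagonal_of_ae_eq_modeSum p _ hA hE (ae_eq_refl _) (ae_eq_refl _)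
  · exact D.isResolvent_solution p μ r hκ hδ hf1 hf2 hE
  · exact hW.of_le_mul (hwc.aestronglyMeasurable.mul hvm) (Eventually.of_forall hvw)
  · refine TwoSoliton.tendsto_eLpNorm_two_of_dominated
      (bound := fun x => 2 * (C * q * (W * N)) * TwoSoliton.weight x ^ (2 - σ)) (hW.const_mul _)
      ?_ ?_ (Eventually.of_forall fun x => ?_)
    · filter_upwards [self_mem_nhdsWithin] with δ hδ
      exact hwc.aestronglyMeasurable.mul ((huc δ hδ).aestronglyMeasurable.sub hvm)
    · filter_upwards [self_mem_nhdsWithin] with δ hδ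
      refine Eventually.of_forall fun x => hwb _ x _ ((norm_sub_le _ _).trans ?_)
      linarith [hub δ x hδ, hvb x]
    · simpa using ((hlim x).sub_const (v x)).const_mul ((TwoSoliton.weight x ^ (-σ) : ℝ) : ℂ)
  · refine (eLpNorm_le_mul_eLpNorm_of_ae_le_mul (Eventually.of_forall hvw) 2).trans ?_
    rw [← ENNReal.ofReal_toReal hW.2.ne, ← ENNReal.ofReal_toReal hfw.2.ne, ← hWdef, ← hN,
      ← ENNReal.ofReal_mul (by positivity), ← ENNReal.ofReal_mul' hN0]
    refine ENNReal.ofReal_le_ofReal ?_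
    have hqr := TwoSoliton.rpow_neg_one_add_le_weight hr p
    have hr0 := Real.rpow_nonneg (TwoSoliton.weight_pos r).le (-TwoSoliton.rate p)
    calc C * q * (W * N) * W = C * W * W * q * N := by ring
      _ ≤ (C * W * W + 1) * TwoSoliton.weight r ^ (-TwoSoliton.rate p) * N := by
        gcongr
        linarith
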